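/- **Conventions.** Everything is over $\mathbb{C}$. A partition for $\mathrm{Gr}(k,n)$ is a sequence $n-k\ge\lambda_1\ge\dots\ge\lambda_k\ge 0$ (with $\lambda_j=0$ for $j>k$), and $|\lambda|=\sum_j\lambda_j$. A Schubert problem in $\mathrm{Gr}(k,n)$ is a list $\boldsymbol\lambda=(\lambda^1,\dots,\lambda^s)$ of such partitions (some possibly $0$) with $\sum_i|\lambda^i|=k(n-k)$. An instance of it in an $n$-dimensional space $A$ is a tuple $F=(F^1_\bullet,\dots,F^s_\bullet)$ of complete flags in $A$; its solution set $\Omega_{\boldsymbol\lambda}F$ consists of the $k$-planes $H\subset A$ with $\dim(H\cap F^i_{n-k+j-\lambda^i_j})\ge j$ for all $i$ and all $1\le j\le k$. "General" means: belonging to some dense Zariski-open subset of the product of flag varieties. If $\lambda,\mu$ are partitions, $\lambda+\mu$ is the componentwise sum, $(r,\mu)$ (for $r\ge\mu_1$) is $\mu$ with a first row of length $r$ added on top, and $r^m=(r,\dots,r)$ ($m$ parts). **Fibrations.** Let $\boldsymbol\lambda,\boldsymbol\mu,\boldsymbol\nu$ be Schubert problems in $\mathrm{Gr}(k+a,n+b)$,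 $\mathrm{Gr}(k,n)$, $\mathrm{Gr}(a,b)$. Then $\boldsymbol\lambda$ is *fibered over $\boldsymbol\mu$ with fiber $\boldsymbol\nu$* if there are a dense open set $U$ of instances of $\boldsymbol\lambda$ in $\mathbb{C}^{n+b}$ and an assignment to each $F\in U$ of an $n$-dimensional subspace $V\subset\mathbb{C}^{n+b}$, an instance $E$ of $\boldsymbol\mu$ in $V$, and, for each $h\in\Omega_{\boldsymbol\mu}E$, an instance $G(h)$ of $\boldsymbol\nu$ in $\mathbb{C}^{n+b}/V$, such that: 1. for all $F\in U$ and $H\in\Omega_{\boldsymbol\lambda}F$, we have $H\cap V\in\Omega_{\boldsymbol\mu}E$; 2. for all $F\in U$, $h\in\Omega_{\boldsymbol\mu}E$ and $H\in\Omega_{\boldsymbol\lambda}F$ with $H\cap V=h$, the image $H/h$ of $H$ in $\mathbb{C}^{n+b}/V$ lies in $\Omega_{\boldsymbol\nu}G(h)$; 3. for all $F\in U$, the map $H\mapsto(H\cap V,\,H/(H\cap V))$ is a bijection from $\Omega_{\boldsymbol\lambda}F$ to $\{(h,K): h\in\Omega_{\boldsymbol\mu}E,\ K\in\Omega_{\boldsymbol\nu}G(h)\}$;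 4. for every $n$-dimensional $V_0\subset\mathbb{C}^{n+b}$, general instances $E_0$ of $\boldsymbol\mu$ in $V_0$ have the following two properties: some $F\in U$ is assigned $V=V_0$ and $E=E_0$; and for every $h\in\Omega_{\boldsymbol\mu}E_0$, a general instance $G_0$ of $\boldsymbol\nu$ in $\mathbb{C}^{n+b}/V_0$ equals $G(h)$ for some $F\in U$ that is assigned $V=V_0$ and $E=E_0$. **Theorem 3.9.** Let $0<a<b$ and $s\ge 5$. Let $\kappa,\rho$ be partitions with $\kappa_a=\rho_a=0$ and $\kappa_1\le b-a-1$, and let $$\boldsymbol\nu=\bigl(\nu^1,\ (b-a-1,\kappa),\ 1^{a-1}+\rho,\ \nu^4,\ \nu^5,\dots,\nu^s\bigr)$$ be a Schubert problem in $\mathrm{Gr}(a,b)$. Then $$\boldsymbol\lambda=\bigl((b-a+2,\nu^1),\ (b-a,b-a,\kappa),\ 2^a+\rho,\ 1^{a+1}+\nu^4,\ 1^{a+1}+\nu^5,\ \nu^6,\dots,\nu^s\bigr)$$ is a Schubert problem in $\mathrm{Gr}(2+a,5+b)$. It is fibered over the Schubert problem $\boldsymbol\mu=\bigl((2),(1),(1),(1),(1)\bigr)$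 in $\mathrm{Gr}(2,5)$ with fiber $\boldsymbol\nu$, and a general instance of $\boldsymbol\mu$ has exactly $3$ solutions. -/

import Mathlib

noncomputable section

namespace Schubert

open Module

/-! ### Partitions

A partition is a sequence `p : ℕ → ℕ`, with `p j` its part number `j + 1`. -/

/-- `p` is a partition for `Gr(k, n)`: weakly decreasing, first part at most `n - k`, at most `k`
nonzero parts. -/
def IsPartitionFor (k n : ℕ) (p : ℕ → ℕ) : Prop :=
  Antitone p ∧ p 0 ≤ n - k ∧ p k = 0

/-- `(r, p)`: the partition `p` with a row of length `r ≥ p 0` placed on top. -/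
def addRow (r : ℕ) (p : ℕ → ℕ) : ℕ → ℕ
  | 0 => r
  | j + 1 => p j

/-- `r ^ m = (r, …, r)`, the partition with `m` parts equal to `r`. Sums of partitions are
componentwise, hence sums of functions. -/
def rect (r m : ℕ) : ℕ → ℕ := fun j => if j < m then r else 0

/-- A Schubert problem in `Gr(k, n)`: a list of partitions for `Gr(k, n)` whose sizes add up to
`k (n - k)`. -/
def IsSchubertProblem (k n : ℕ) {s : ℕ} (lam : Fin s → ℕ → ℕ) : Prop :=
  (∀ i, IsPartitionFor k n (lam i)) ∧ ∑ i, ∑ j ∈ Finset.range k, lam i j = k * (n - k)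

/-! ### Flags and Schubert varieties -/

/-- A complete flag `F_0 ⊂ F_1 ⊂ ⋯ ⊂ F_n = V` with `dim F_j = j` in an `n`-dimensional space `V`.
The indices `j > n` carry no information, as then `F_j = V`. -/
@[ext]
structure CompleteFlag (n : ℕ) (V : Type*) [AddCommGroup V] [Module ℂ V] where
  space : ℕ → Submodule ℂ V
  mono : Monotone space
  finrank_space : ∀ j ≤ n, finrank ℂ (space j) = j
  space_eq_top : ∀ j, n ≤ j → space j = ⊤

variable {V : Type*} [AddCommGroup V] [Module ℂ V]

/-- The flag spanned by the initial segments of a basis. -/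
def CompleteFlag.ofBasis {n : ℕ} (v : Basis (Fin n) ℂ V) : CompleteFlag n V where
  space j := Submodule.span ℂ (v '' {i | (i : ℕ) < j})
  mono := fun j l h => Submodule.span_mono (Set.image_mono fun i hi => lt_of_lt_of_le hi h)
  finrank_space := by
    intro j hj
    have hli : LinearIndependent ℂ (fun i : {i : Fin n | (i : ℕ) < j} => v i) :=
      v.linearIndependent.comp _ Subtype.val_injective
    have h := finrank_span_eq_card hli
    have hr : Set.range (fun i : {i : Fin n | (i : ℕ) < j} => v i) = v '' {i | (i : ℕ) < j} := by
      ext x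
      simp
    rw [hr] at h
    rw [h, Fintype.card_subtype]
    have hc := Fin.card_filter_val_lt (n := n) (m := j)
    simpa [hj] using hc
  space_eq_top := by
    intro j hj
    have : {i : Fin n | (i : ℕ) < j} = Set.univ := by
      ext i
      simp only [Set.mem_ofPred_eq, Set.mem_univ, iff_true]
      omega
    rw [this, Set.image_univ, v.span_eq]

/-- The Schubert variety of all `k`-planes `H` in the `n`-dimensional space `V` with
`dim (H ∩ F_{n - k + j - p_j}) ≥ j` for `j = 1, …, k`, where `p_j` is the `j`-th part of `p`
(written with `j + 1` in place of `j`, since the parts are numbered from `0` here). -/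
def schubertVariety (k n : ℕ) (p : ℕ → ℕ) (F : CompleteFlag n V) : Set (Submodule ℂ V) :=
  {H | finrank ℂ H = k ∧
    ∀ j < k, j + 1 ≤ finrank ℂ (H ⊓ F.space (n - k + (j + 1) - p j) : Submodule ℂ V)}

/-- The set of solutions of the instance `F` of the Schubert problem `lam`. -/
def solutions (k n : ℕ) {s : ℕ} (lam : Fin s → ℕ → ℕ) (F : Fin s → CompleteFlag n V) :
    Set (Submodule ℂ V) :=
  {H | finrank ℂ H = k ∧ ∀ i, H ∈ schubertVariety k n (lam i) (F i)}

/-! ### General instances -/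

/-- `U` is Zariski open in the product of `s` copies of the variety of complete flags of `V`. That
variety carries the quotient topology of the variety of bases of `V` (that is, of `GL_n`), so this
says that the bases inducing a point of `U` are the complement of the common zero set of a set of
polynomials in the coordinates of the basis vectors. -/
def IsZariskiOpen {n s : ℕ} (U : Set (Fin s → CompleteFlag n V)) : Prop :=
  ∃ (e : Basis (Fin n) ℂ V) (S : Set (MvPolynomial (Fin s × Fin n × Fin n) ℂ)),
    ∀ v : Fin s → Basis (Fin n) ℂ V, (fun i => CompleteFlag.ofBasis (v i)) ∈ U ↔
      ∃ p ∈ S, MvPolynomial.eval (fun x => e.repr (v x.1 x.2.1) x.2.2) p ≠ 0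

/-- A dense Zariski open set of tuples of flags; as the product of flag varieties is irreducible,
this is the same as a nonempty open set. -/
def IsDenseOpen {n s : ℕ} (U : Set (Fin s → CompleteFlag n V)) : Prop :=
  IsZariskiOpen U ∧ U.Nonempty

/-- `P` holds for general tuples of flags. -/
def ForGeneral {n s : ℕ} (P : (Fin s → CompleteFlag n V) → Prop) : Prop :=
  ∃ U : Set (Fin s → CompleteFlag n V), IsDenseOpen U ∧ ∀ F ∈ U, P F

/-- `d(lam) = d`: every general instance of the Schubert problem `lam` has exactly `d` solutions. -/
def HasDegree (k n : ℕ) {s : ℕ} (lam : Fin s → ℕ → ℕ) (d : ℕ) : Prop :=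
  ForGeneral fun F : Fin s → CompleteFlag n (Fin n → ℂ) => (solutions k n lam F).encard = d

/-! ### Fibrations of Schubert problems -/

/-- What a fibration attaches to an instance of a Schubert problem in the space `A`: a subspace `V`
of dimension `n`, flags `E` in `V`, and, for `h` in `Gr(k, V)`, flags `G h` in `A / V`. (Only the
values of `G` at the solutions `h` of the instance `E` matter.) -/
structure FibrationData (A : Type*) [AddCommGroup A] [Module ℂ A] (n b t u : ℕ) where
  V : Submodule ℂ A
  finrank_V : finrank ℂ V = n
  E : Fin t → CompleteFlag n V
  G : Submodule ℂ V → Fin u → CompleteFlag b (A ⧸ V)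

/-- The instance `F` of `lam` is fibered by the data `D`, over an instance of `mu` with fibers
instances of `nu`. Here `H ∩ V` is `H.comap V.subtype` as a subspace of `V`, and `H / (H ∩ V)` is
`H.map V.mkQ` as a subspace of `A / V`. -/
structure FibersInstance (k n a b : ℕ) {A : Type*} [AddCommGroup A] [Module ℂ A] {s t u : ℕ}
    (lam : Fin s → ℕ → ℕ) (mu : Fin t → ℕ → ℕ) (nu : Fin u → ℕ → ℕ)
    (F : Fin s → CompleteFlag (n + b) A) (D : FibrationData A n b t u) : Prop where
  base : ∀ H ∈ solutions (k + a) (n + b) lam F,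
    H.comap D.V.subtype ∈ solutions k n mu D.E
  fiber : ∀ h ∈ solutions k n mu D.E, ∀ H ∈ solutions (k + a) (n + b) lam F,
    H.comap D.V.subtype = h → H.map D.V.mkQ ∈ solutions a b nu (D.G h)
  bijective : Set.BijOn (fun H : Submodule ℂ A => (H.comap D.V.subtype, H.map D.V.mkQ))
    (solutions (k + a) (n + b) lam F)
    {x | x.1 ∈ solutions k n mu D.E ∧ x.2 ∈ solutions a b nu (D.G x.1)}

/-- The Schubert problem `lam` in `Gr(k + a, n + b)` is fibered over the Schubert problem `mu` in
`Gr(k, n)` with fiber the Schubert problem `nu` in `Gr(a, b)`: there are a dense open set `U` of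
instances of `lam` and a rule `D` attaching fibration data to them, such that

* every instance in `U` is fibered by its data;
* for each `n`-dimensional subspace `V₀`, all general instances `E₀` of `mu` in `V₀` arise;
* for a general `E₀` and each of its solutions `h`, all general instances `G₀` of `nu` in the
  quotient by `V₀` arise at `h` from those instances of `lam` that induce `E₀`. -/
def IsFibered (k n a b : ℕ) {s t u : ℕ}
    (lam : Fin s → ℕ → ℕ) (mu : Fin t → ℕ → ℕ) (nu : Fin u → ℕ → ℕ) : Prop :=
  IsSchubertProblem (k + a) (n + b) lam ∧ IsSchubertProblem k n mu ∧ IsSchubertProblem a b nu ∧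
  ∃ (U : Set (Fin s → CompleteFlag (n + b) (Fin (n + b) → ℂ)))
    (D : (Fin s → CompleteFlag (n + b) (Fin (n + b) → ℂ)) →
      FibrationData (Fin (n + b) → ℂ) n b t u),
    IsDenseOpen U ∧
    (∀ F ∈ U, FibersInstance k n a b lam mu nu F (D F)) ∧
    ∀ (V₀ : Submodule ℂ (Fin (n + b) → ℂ)) (hV₀ : finrank ℂ V₀ = n),
      ForGeneral fun E₀ : Fin t → CompleteFlag n V₀ =>
        (∃ F ∈ U, ∃ G, D F = ⟨V₀, hV₀, E₀, G⟩) ∧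
        ∀ h ∈ solutions k n mu E₀,
          ForGeneral fun G₀ : Fin u → CompleteFlag b ((Fin (n + b) → ℂ) ⧸ V₀) =>
            ∃ F ∈ U, ∃ G, D F = ⟨V₀, hV₀, E₀, G⟩ ∧ G h = G₀

end Schubert

end

/-! Write `A` for the ambient space of dimension `5 + b`. The rows and columns added to `ν` force
every solution `H` of the total problem to meet five subspaces: `L` of dimension 2 in dimension at
least 1, `M` of dimension 5 in at least 2, `T` of dimension `b + 1` in at least `a`, and `P`, `Q` of
dimension `b + 3` in at least `a + 1`. Put `V = (L + M) ∩ (L + T)`. In general position `V` has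
dimension 5, contains `L`, and meets each of `M`, `T`, `P`, `Q` in dimension 3. A dimension count
(`finrank_inf_baseSpace`) shows that `h = H ∩ V` is a plane meeting all five traces on `V`, that is,
a solution of the base problem.

Given such an `h`, put `W = (P + h) ∩ (Q + h)` and `Z = (M ∩ W) + (T ∩ W)`. Then `dim Z = b + 2`, `Z
∩ V = h` and `Z + V = A`, so `Z / h` is identified with `A / V`. Dimensions give `H = (H ∩ P) + h =
(H ∩ Q) + h = (H ∩ M) + (H ∩ T)`, hence `H ⊆ Z` (`PairPosition.le_fiberSpace`), and `H` is the same
thing as its image `K` in `A / V`. For a member `S` of a flag, `dim (H ∩ S)` is `dim (h ∩ S)` plus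
the dimension of the intersection of `K` with the image of `Z ∩ S`. The Schubert conditions on `H`
thus become, flag by flag, those of `ν` on `K` for the flags of images
(`GoodInstance.mem_solutions_iff`).

General position has to be open and nonempty. A plane `h` is encoded by vectors `x ∈ L` and `t ∈ T`
spanning it; the bad loci are then projections of closed cones, hence closed by elimination theory
(`isClosed_exists_ne_zero`). For nonemptiness, split `A` as `V ⊕ A / V` and merge flags `E` of `V`
with flags `G` of `A / V` along suitable lattice paths. The merged instance is in general position
(`GoodBase.goodInstance`), and the data attached to it are `E` and, for every `h`, the same `G`
(`GoodBase.compatible`). This also proves that all general `E₀` and `G₀` arise. General position of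
`E` itself is checked on an explicit sample.

For the degree, let `x` move in the pencil `ℙ(L)`. A matching `t` exists exactly when a 3 × 3
determinant, a cubic form on the pencil, vanishes. Three solutions mean a nonzero discriminant,
which is an open condition; the sample, with three explicit solutions, satisfies it. -/

noncomputable section

namespace Schubert

open Module Topology

/-! ### Zariski topologies -/

section Zariski

variable {X Y : Type*}

/-- The Zariski topology on `X` defined by an algebra `R` of functions. -/
abbrev zariski (R : Subalgebra ℂ (X → ℂ)) : TopologicalSpace X where
  IsOpen U := ∀ x ∈ U, ∃ f ∈ R, f x ≠ 0 ∧ ∀ y, f y ≠ 0 → y ∈ U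
  isOpen_univ := fun x _ => ⟨1, R.one_mem, by simp, by simp⟩
  isOpen_inter := by
    rintro U W hU hW x ⟨hxU, hxW⟩
    obtain ⟨f, hf, hfx, hf'⟩ := hU x hxU
    obtain ⟨g, hg, hgx, hg'⟩ := hW x hxW
    refine ⟨f * g, R.mul_mem hf hg, mul_ne_zero hfx hgx, fun y hy => ?_⟩
    exact ⟨hf' y (left_ne_zero_of_mul hy), hg' y (right_ne_zero_of_mul hy)⟩
  isOpen_sUnion := by
    rintro S hS x ⟨U, hU, hxU⟩
    obtain ⟨f, hf, hfx, hf'⟩ := hS U hU x hxU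
    exact ⟨f, hf, hfx, fun y hy => ⟨U, hU, hf' y hy⟩⟩

theorem isOpen_zariski_iff {R : Subalgebra ℂ (X → ℂ)} {U : Set X} :
    IsOpen[zariski R] U ↔ ∀ x ∈ U, ∃ f ∈ R, f x ≠ 0 ∧ ∀ y, f y ≠ 0 → y ∈ U := Iff.rfl

theorem isClosed_zariski_iff {R : Subalgebra ℂ (X → ℂ)} {S : Set X} :
    IsClosed[zariski R] S ↔ ∀ x ∉ S, ∃ f ∈ R, f x ≠ 0 ∧ ∀ y ∈ S, f y = 0 := by
  rw [← @isOpen_compl_iff X S (zariski R), isOpen_zariski_iff]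
  refine forall₂_congr fun x _ => exists_congr fun f => and_congr_right fun _ =>
    and_congr_right fun _ => forall_congr' fun y => ?_
  rw [Set.mem_compl_iff, not_imp_not]

theorem isClosed_zeros {R : Subalgebra ℂ (X → ℂ)} {f : X → ℂ} (hf : f ∈ R) :
    IsClosed[zariski R] {x | f x = 0} :=
  isClosed_zariski_iff.2 fun _ hx => ⟨f, hf, hx, fun _ hy => hy⟩

/-- Evaluation at a point, on an algebra of functions. -/
def evalAt (R : Subalgebra ℂ (X → ℂ)) (x : X) : R →+* ℂ :=
  (Pi.evalRingHom (fun _ => ℂ) x).comp R.val.toRingHom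

@[simp]
theorem evalAt_apply (R : Subalgebra ℂ (X → ℂ)) (x : X) (f : R) : evalAt R x f = f.1 x := rfl

theorem evalAt_surjective (R : Subalgebra ℂ (X → ℂ)) (x : X) :
    Function.Surjective (evalAt R x) := fun c => ⟨algebraMap ℂ R c, rfl⟩

open MvPolynomial in
/-- The resultant argument: if forms with coefficients in `R` have no common zero at `x₀`, then
neither have they on a neighbourhood of `x₀`. -/
theorem exists_ne_zero_of_no_common_zero {R : Subalgebra ℂ (X → ℂ)} {ι : Type*} [Fintype ι]
    [DecidableEq ι] (J : Ideal (MvPolynomial ι R))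
    (hJ : ∀ p ∈ J, ∀ d, homogeneousComponent d p ∈ J) (x₀ : X)
    (h₀ : ∀ y : ι → ℂ, (∀ p ∈ J, eval y (map (evalAt R x₀) p) = 0) → y = 0) :
    ∃ f : R, f.1 x₀ ≠ 0 ∧ ∀ x, f.1 x ≠ 0 →
      ∀ y : ι → ℂ, (∀ p ∈ J, eval y (map (evalAt R x) p) = 0) → y = 0 := by
  have hsurj : Function.Surjective (map (σ := ι) (evalAt R x₀)) :=
    map_surjective _ (evalAt_surjective R x₀)
  set I := J.map (map (σ := ι) (evalAt R x₀)) with hI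
  -- Nullstellensatz: the specialized ideal has no zero besides the origin, so a power of each
  -- variable lies in it.
  have hrad : ∀ i, ∃ k, (MvPolynomial.X i : MvPolynomial ι ℂ) ^ k ∈ I := by
    intro i
    have : (MvPolynomial.X i : MvPolynomial ι ℂ) ∈ I.radical := by
      rw [← vanishingIdeal_zeroLocus_eq_radical (K := ℂ), mem_vanishingIdeal_iff]
      intro y hy
      have : y = 0 := h₀ y fun p hp => by
        have := hy _ (Ideal.mem_map_of_mem _ hp)
        simpa [aeval_eq_eval] using this
      simp [this]
    exact this
  choose k hk using hrad
  -- Any common upper bound of the exponents `k i` would do.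
  set d := ∑ i, k i with hd
  have hq : ∀ i, ∃ q ∈ J, q.IsHomogeneous d ∧ map (evalAt R x₀) q = MvPolynomial.X i ^ d := by
    intro i
    have hmem : (MvPolynomial.X i : MvPolynomial ι ℂ) ^ d ∈ I := by
      have hle : k i ≤ d := Finset.single_le_sum (f := k) (fun _ _ => Nat.zero_le _)
        (Finset.mem_univ i)
      rw [← Nat.sub_add_cancel hle, pow_add]
      exact I.mul_mem_left _ (hk i)
    obtain ⟨q, hqJ, hq⟩ := (Ideal.mem_map_iff_of_surjective _ hsurj).1 hmem
    -- Only the part of degree `d` of the lift is kept: `J` is homogeneous, and the specialization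
    -- `X i ^ d` has no other part.
    refine ⟨homogeneousComponent d q, hJ q hqJ d, homogeneousComponent_isHomogeneous _ _, ?_⟩
    ext μ
    have := congrArg (coeff μ) hq
    rw [coeff_map] at this ⊢
    rw [coeff_homogeneousComponent]
    split_ifs with hμ
    · exact this
    · rw [map_zero]
      exact ((isHomogeneous_X_pow i d).coeff_eq_zero hμ).symm
  choose q hqJ hqh hqm using hq
  -- Pigeonhole: a monomial of this degree is divisible by some `X i ^ d`, so it is the
  -- specialization of an element `N μ` of `J`, homogeneous of degree `D`.
  set D := Fintype.card ι * d + 1 with hD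
  obtain ⟨s, hsmem⟩ : ∃ s : Finset (ι →₀ ℕ), ∀ μ : ι →₀ ℕ, μ ∈ s ↔ ∑ i, μ i = D :=
    ⟨Finset.finsuppAntidiag Finset.univ D, fun μ => by simp [Finset.mem_finsuppAntidiag]⟩
  have hpig : ∀ μ : s, ∃ i, d ≤ μ.1 i := by
    rintro ⟨μ, hμ⟩
    by_contra! hcon
    have h1 := (hsmem μ).1 hμ
    have h2 : ∑ i, μ i ≤ ∑ _i : ι, d := Finset.sum_le_sum fun i _ => (hcon i).le
    simp only [Finset.sum_const, Finset.card_univ, smul_eq_mul] at h2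
    omega
  choose i hi using hpig
  let N : s → MvPolynomial ι R := fun μ => monomial (μ.1 - Finsupp.single (i μ) d) 1 * q (i μ)
  have hNJ : ∀ μ, N μ ∈ J := fun μ => J.mul_mem_left _ (hqJ _)
  have hsingle : ∀ μ : s, μ.1 - Finsupp.single (i μ) d + Finsupp.single (i μ) d = μ.1 := by
    intro μ
    refine tsub_add_cancel_of_le ?_
    rw [Finsupp.single_le_iff]
    exact hi μ
  have hNh : ∀ μ, (N μ).IsHomogeneous D := by
    intro μ
    have h1 : (monomial (μ.1 - Finsupp.single (i μ) d) (1 : R)).IsHomogeneous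
        (μ.1 - Finsupp.single (i μ) d).degree := isHomogeneous_monomial _ rfl
    have h2 := h1.mul (hqh (i μ))
    have h3 : (μ.1 - Finsupp.single (i μ) d).degree + d = D := by
      have := congrArg Finsupp.degree (hsingle μ)
      rw [map_add, Finsupp.degree_single] at this
      rw [this, Finsupp.degree_eq_sum]
      exact (hsmem μ.1).1 μ.2
    rwa [h3] at h2
  -- The coefficient matrix of the forms `N μ`. It specializes to the identity at `x₀`; at any `x`,
  -- a common zero `y` puts the vector of all monomials of degree `D` in `y` into its kernel. So `y
  -- = 0` wherever the determinant does not vanish.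
  let B : Matrix s s R := Matrix.of fun μ ν => coeff ν.1 (N μ)
  have hdet : ∀ x, (B.det).1 x = (B.map (evalAt R x)).det := fun x =>
    RingHom.map_det (evalAt R x) B
  refine ⟨B.det, ?_, ?_⟩
  · have : B.map (evalAt R x₀) = 1 := by
      ext μ ν
      have h1 : map (evalAt R x₀) (N μ) = monomial μ.1 1 := by
        simp only [N, map_mul, hqm, map_monomial, map_one]
        rw [X_pow_eq_monomial, monomial_mul, hsingle, one_mul]
      simp only [Matrix.map_apply, B, Matrix.of_apply]
      rw [← coeff_map, h1, coeff_monomial, Matrix.one_apply]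
      by_cases hμν : μ = ν
      · rw [if_pos (congrArg Subtype.val hμν), if_pos hμν]
      · rw [if_neg (fun h => hμν (Subtype.ext h)), if_neg hμν]
    rw [hdet, this, Matrix.det_one]
    exact one_ne_zero
  · intro x hx y hy
    rw [hdet] at hx
    have hker : (B.map (evalAt R x)).mulVec (fun ν : s => ∏ j, y j ^ ν.1 j) = 0 := by
      ext μ
      have h1 := hy (N μ) (hNJ μ)
      rw [eval_eq'] at h1
      rw [Pi.zero_apply, ← h1]
      simp only [Matrix.mulVec, dotProduct, Matrix.map_apply, B, Matrix.of_apply, ← coeff_map]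
      refine (Finset.sum_coe_sort s
        (fun ν => coeff ν (map (evalAt R x) (N μ)) * ∏ j, y j ^ ν j)).trans ?_
      symm
      refine Finset.sum_subset ?_ ?_
      · intro ν hν
        rw [hsmem]
        have h2 : ((map (evalAt R x)) (N μ)).IsHomogeneous D := (hNh μ).map _
        have h3 := h2 (mem_support_iff.1 hν)
        rw [← h3, Finsupp.weight_apply, Finsupp.sum_fintype _ _ (by simp)]
        simp
      · intro ν _ hν
        rw [notMem_support_iff.1 hν, zero_mul]
    have hzero := Matrix.eq_zero_of_mulVec_eq_zero hx hker
    ext j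
    -- The entry `y j ^ D` of the vanishing vector gives `y j = 0`.
    have hj : Finsupp.single j D ∈ s := by
      rw [hsmem]
      simp [Finsupp.single_apply]
    have := congrFun hzero ⟨_, hj⟩
    simp only [Pi.zero_apply] at this
    rw [Finset.prod_eq_single j] at this
    · simpa using this
    · intro l _ hl
      simp [hl.symm]
    · simp

variable [AddCommGroup Y] [Module ℂ Y]

/-- The regular functions on `X × Y`, where the vector space `Y` carries its polynomial
functions. -/
def extend (R : Subalgebra ℂ (X → ℂ)) (Y : Type*) [AddCommGroup Y] [Module ℂ Y] :
    Subalgebra ℂ (X × Y → ℂ) :=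
  Algebra.adjoin ℂ
    ({g | ∃ f ∈ R, g = fun z => f z.1} ∪ {g | ∃ φ : Dual ℂ Y, g = fun z => φ z.2})

open MvPolynomial in
theorem exists_polynomial_of_mem_extend {R : Subalgebra ℂ (X → ℂ)} {ι : Type*} [Fintype ι]
    (e : Basis ι ℂ Y) {g : X × Y → ℂ} (hg : g ∈ extend R Y) :
    ∃ p : MvPolynomial ι R, ∀ x y, g (x, y) = eval (e.equivFun y) (map (evalAt R x) p) := by
  induction hg using Algebra.adjoin_induction with
  | mem g hg =>
    rcases hg with ⟨f, hf, rfl⟩ | ⟨φ, rfl⟩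
    · exact ⟨C ⟨f, hf⟩, fun x y => by simp⟩
    · refine ⟨∑ i, C (algebraMap ℂ R (φ (e i))) * MvPolynomial.X i, fun x y => ?_⟩
      have h : ∀ c : ℂ, (algebraMap ℂ R c).1 x = c := fun c => rfl
      have h' : φ y = ∑ i, φ (e i) * e.repr y i := by
        calc φ y = φ (∑ i, e.equivFun y i • e i) := by rw [e.sum_equivFun]
          _ = _ := by rw [map_sum]; simp [mul_comm]
      simpa [h] using h'
  | algebraMap c => exact ⟨C (algebraMap ℂ R c), fun x y => by simp⟩
  | add f g _ _ hf hg =>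
    obtain ⟨p, hp⟩ := hf
    obtain ⟨q, hq⟩ := hg
    exact ⟨p + q, fun x y => by simp [hp, hq]⟩
  | mul f g _ _ hf hg =>
    obtain ⟨p, hp⟩ := hf
    obtain ⟨q, hq⟩ := hg
    exact ⟨p * q, fun x y => by simp [hp, hq]⟩

open MvPolynomial in
theorem eval_smul_eq_sum {ι : Type*} (p : MvPolynomial ι ℂ) (c : ℂ) (y : ι → ℂ) :
    eval (c • y) p =
      ∑ d ∈ Finset.range (p.totalDegree + 1), eval y (homogeneousComponent d p) * c ^ d := by
  conv_lhs => rw [← sum_homogeneousComponent p]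
  rw [map_sum]
  refine Finset.sum_congr rfl fun d _ => ?_
  rw [eval_eq, eval_eq, Finset.sum_mul]
  refine Finset.sum_congr rfl fun μ hμ => ?_
  have hdeg := homogeneousComponent_isHomogeneous d p (mem_support_iff.1 hμ)
  rw [Finsupp.weight_apply, Finsupp.sum] at hdeg
  simp only [Pi.one_apply, smul_eq_mul, mul_one] at hdeg
  simp only [Pi.smul_apply, smul_eq_mul, mul_pow, Finset.prod_mul_distrib,
    Finset.prod_pow_eq_pow_sum, hdeg]
  ring

-- Along the line through `y` the values of `p` form a polynomial in `c` whose coefficients are the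
-- values of the homogeneous parts. Infinitely many roots make them vanish; `c = 0` is not needed,
-- which suits cones with the vertex removed.
open MvPolynomial in
theorem eval_homogeneousComponent_eq_zero {ι : Type*} (p : MvPolynomial ι ℂ) (y : ι → ℂ)
    (h : ∀ c : ℂ, c ≠ 0 → eval (c • y) p = 0) (d : ℕ) :
    eval y (homogeneousComponent d p) = 0 := by
  by_cases hd : p.totalDegree < d
  · rw [homogeneousComponent_eq_zero d p hd, map_zero]
  let f : Polynomial ℂ := ∑ d ∈ Finset.range (p.totalDegree + 1),
    Polynomial.C (eval y (homogeneousComponent d p)) * Polynomial.X ^ d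
  have hf : f = 0 := by
    refine Polynomial.eq_zero_of_infinite_isRoot f
      (Set.Infinite.mono (s := {0}ᶜ) ?_ (Set.finite_singleton 0).infinite_compl)
    intro c hc
    change Polynomial.eval c f = 0
    rw [← h c hc, eval_smul_eq_sum]
    simp [f, Polynomial.eval_finsetSum]
  have h1 := congrArg (Polynomial.coeff · d) hf
  simp only [f, Polynomial.finsetSum_coeff, Polynomial.coeff_C_mul, Polynomial.coeff_X_pow,
    Polynomial.coeff_zero] at h1
  rw [Finset.sum_eq_single d (fun b _ hb => by rw [if_neg hb.symm, mul_zero])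
    (fun hd' => absurd (Finset.mem_range.2 (by omega)) hd'), if_pos rfl, mul_one] at h1
  exact h1

open MvPolynomial in
/-- The main theorem of elimination theory: the projection of a closed cone is closed. -/
theorem isClosed_exists_ne_zero {R : Subalgebra ℂ (X → ℂ)} [FiniteDimensional ℂ Y]
    {S : Set (X × Y)} (hS : IsClosed[zariski (extend R Y)] S)
    (hc : ∀ x y (c : ℂ), c ≠ 0 → (x, y) ∈ S → (x, c • y) ∈ S) :
    IsClosed[zariski R] {x | ∃ y ≠ 0, (x, y) ∈ S} := by
  classical
  rw [isClosed_zariski_iff] at hS ⊢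
  intro x₀ hx₀
  let e := finBasis ℂ Y
  -- The polynomials vanishing on `S`. Since `S` is a cone in the second variable, this ideal is
  -- homogeneous.
  let J : Ideal (MvPolynomial (Fin (finrank ℂ Y)) R) :=
    { carrier := {p | ∀ x y, (x, y) ∈ S → eval (e.equivFun y) (map (evalAt R x) p) = 0}
      add_mem' := fun {p q} hp hq x y h => by
        rw [map_add, map_add, hp x y h, hq x y h, add_zero]
      zero_mem' := fun x y _ => by rw [map_zero, map_zero]
      smul_mem' := fun p q hq x y h => by
        rw [smul_eq_mul, map_mul, map_mul, hq x y h, mul_zero] }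
  have hJ : ∀ p ∈ J, ∀ d, homogeneousComponent d p ∈ J := by
    intro p hp d x y hxy
    have h1 : map (evalAt R x) (homogeneousComponent d p) =
        homogeneousComponent d (map (evalAt R x) p) := by
      ext μ
      rw [coeff_map, coeff_homogeneousComponent, coeff_homogeneousComponent, coeff_map]
      split_ifs
      · rfl
      · exact map_zero _
    rw [h1]
    refine eval_homogeneousComponent_eq_zero _ _ (fun c hc0 => ?_) d
    rw [← map_smul]
    exact hp x _ (hc x y c hc0 hxy)
  obtain ⟨f, hf0, hf⟩ := exists_ne_zero_of_no_common_zero J hJ x₀ (by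
    intro y hy
    by_contra hy0
    have hmem : (x₀, e.equivFun.symm y) ∉ S := fun hmem =>
      hx₀ ⟨_, fun h => hy0 ((LinearEquiv.map_eq_zero_iff _).1 h), hmem⟩
    obtain ⟨g, hg, hg0, hgS⟩ := hS _ hmem
    obtain ⟨p, hp⟩ := exists_polynomial_of_mem_extend e hg
    refine hg0 ?_
    rw [hp, LinearEquiv.apply_symm_apply]
    exact hy p fun x z hxz => by rw [← hp]; exact hgS _ hxz)
  refine ⟨f.1, f.2, hf0, ?_⟩
  rintro x ⟨y, hy0, hxy⟩
  by_contra hfx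
  refine hy0 (e.equivFun.injective ?_)
  rw [map_zero]
  exact hf x hfx _ fun p hp => hp x y hxy

/-- A map to a vector space is regular if its coordinates are. -/
def Regular (R : Subalgebra ℂ (X → ℂ)) (f : X → Y) : Prop :=
  ∀ φ : Dual ℂ Y, (fun x => φ (f x)) ∈ R

namespace Regular

variable {R : Subalgebra ℂ (X → ℂ)}

theorem add {f g : X → Y} (hf : Regular R f) (hg : Regular R g) :
    Regular R (fun x => f x + g x) := fun φ => by
  simp only [map_add]
  exact R.add_mem (hf φ) (hg φ)

theorem smul {c : X → ℂ} {f : X → Y} (hc : c ∈ R) (hf : Regular R f) :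
    Regular R (fun x => c x • f x) := fun φ => by
  simp only [map_smul, smul_eq_mul]
  exact R.mul_mem hc (hf φ)

theorem const (y : Y) : Regular R (fun _ => y) := fun φ => R.algebraMap_mem (φ y)

theorem apply {Y' : Type*} [AddCommGroup Y'] [Module ℂ Y'] {f : X → Y} (hf : Regular R f)
    (ψ : Y →ₗ[ℂ] Y') : Regular R (fun x => ψ (f x)) := fun φ => hf (φ ∘ₗ ψ)

theorem mem {f : X → ℂ} (hf : Regular R f) : f ∈ R := hf LinearMap.id

theorem lift {Y' : Type*} [AddCommGroup Y'] [Module ℂ Y'] {f : X → Y} (hf : Regular R f) :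
    Regular (extend R Y') (fun z => f z.1) := fun φ =>
  Algebra.subset_adjoin (Or.inl ⟨_, hf φ, rfl⟩)

theorem snd : Regular (extend R Y) (fun z : X × Y => z.2) := fun φ =>
  Algebra.subset_adjoin (Or.inr ⟨φ, rfl⟩)

end Regular

end Zariski

/-! ### Membership in a member of a flag as a polynomial condition on bases -/

section FlagConditions

variable {X : Type*} {n : ℕ} {A : Type*} [AddCommGroup A] [Module ℂ A]

theorem CompleteFlag.mem_ofBasis_space {v : Basis (Fin n) ℂ A} {j : ℕ} {w : A} :
    w ∈ (CompleteFlag.ofBasis v).space j ↔ ∀ k : Fin n, j ≤ k → v.repr w k = 0 := by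
  change w ∈ Submodule.span ℂ (v '' {i | (i : ℕ) < j}) ↔ _
  rw [v.mem_span_image]
  constructor
  · intro h k hk
    by_contra h0
    have := h (Finsupp.mem_support_iff.2 h0)
    simp only [Set.mem_ofPred_eq] at this
    omega
  · intro h k hk
    by_contra h0
    simp only [Set.mem_ofPred_eq, not_lt] at h0
    exact Finsupp.mem_support_iff.1 hk (h k h0)

/-- Cramer's rule. It makes a coordinate in a moving basis polynomial in the entries, up to the
nowhere vanishing factor `e.det v`. -/
theorem det_update_eq (e v : Basis (Fin n) ℂ A) (k : Fin n) (w : A) :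
    e.det (Function.update v k w) = v.repr w k * e.det v := by
  conv_lhs => rw [← v.sum_repr w]
  rw [AlternatingMap.map_update_sum, Finset.sum_eq_single k]
  · rw [AlternatingMap.map_update_smul, Function.update_eq_self, smul_eq_mul]
  · intro j _ hj
    rw [AlternatingMap.map_update_smul, AlternatingMap.map_update_self _ _ hj.symm, smul_zero]
  · simp

variable {R : Subalgebra ℂ (X → ℂ)}

theorem Regular.det {g : X → Fin n → A} (hg : ∀ j, Regular R (fun x => g x j))
    (e : Basis (Fin n) ℂ A) : (fun x => e.det (g x)) ∈ R := by
  have h : (fun x => e.det (g x)) = ∑ σ : Equiv.Perm (Fin n),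
      (Equiv.Perm.sign σ : ℤ) • ∏ i, fun x => e.coord (σ i) (g x i) := by
    ext x
    rw [Basis.det_apply, Matrix.det_apply, Finset.sum_apply]
    refine Finset.sum_congr rfl fun σ _ => ?_
    simp [Basis.toMatrix_apply, Units.smul_def]
  rw [h]
  exact R.sum_mem fun σ _ => R.zsmul_mem (R.prod_mem fun i _ => hg i _) _

/-- The coordinates in a moving basis, up to a common factor. -/
theorem exists_regular_coord [FiniteDimensional ℂ A] {β : X → Basis (Fin n) ℂ A}
    (hβ : ∀ j, Regular R (fun x => β x j)) {f : X → A} (hf : Regular R f) (k : Fin n) :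
    ∃ g ∈ R, ∀ x, g x = 0 ↔ (β x).repr (f x) k = 0 := by
  rcases isEmpty_or_nonempty X with hX | ⟨⟨x₀⟩⟩
  · exact ⟨0, R.zero_mem, fun x => hX.elim x⟩
  let e := β x₀
  refine ⟨fun x => e.det (Function.update (β x) k (f x)), Regular.det (fun j => ?_) e,
    fun x => ?_⟩
  · by_cases hj : j = k
    · subst hj
      simpa using hf
    · simpa [hj] using hβ j
  · beta_reduce
    rw [det_update_eq, mul_eq_zero, or_iff_left]
    exact (e.isUnit_det (β x)).ne_zero

theorem isClosed_mem_space [FiniteDimensional ℂ A] {β : X → Basis (Fin n) ℂ A}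
    (hβ : ∀ j, Regular R (fun x => β x j)) {f : X → A} (hf : Regular R f) (j : ℕ) :
    IsClosed[zariski R] {x | f x ∈ (CompleteFlag.ofBasis (β x)).space j} := by
  simp only [CompleteFlag.mem_ofBasis_space, Set.ofPred_forall]
  refine @isClosed_iInter _ _ (zariski R) _ fun k => @isClosed_iInter _ _ (zariski R) _ fun _ => ?_
  obtain ⟨g, hg, h⟩ := exists_regular_coord hβ hf k
  simp only [← h]
  exact isClosed_zeros hg

/-- The polynomial functions of the entries of tuples of bases. -/
def basesAlgebra (s : ℕ) (e : Basis (Fin n) ℂ A) :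
    Subalgebra ℂ ((Fin s → Basis (Fin n) ℂ A) → ℂ) :=
  Algebra.adjoin ℂ
    (Set.range fun (y : Fin s × Fin n × Fin n) v => e.repr (v y.1 y.2.1) y.2.2)

theorem regular_bases {s : ℕ} (e : Basis (Fin n) ℂ A) (i : Fin s) (j : Fin n) :
    Regular (basesAlgebra s e) (fun v => v i j) := by
  intro φ
  have h : (fun v : Fin s → Basis (Fin n) ℂ A => φ (v i j)) =
      ∑ k, φ (e k) • fun v : Fin s → Basis (Fin n) ℂ A => e.repr (v i j) k := by
    ext v
    rw [Finset.sum_apply]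
    calc φ (v i j) = φ (∑ k, e.repr (v i j) k • e k) := by rw [e.sum_repr]
      _ = _ := by rw [map_sum]; simp [mul_comm]
  rw [h]
  exact Subalgebra.sum_mem _ fun k _ => Subalgebra.smul_mem _
    (Algebra.subset_adjoin (Set.mem_range_self (i, j, k))) _

theorem isZariskiOpen_of_isOpen {s : ℕ} (e : Basis (Fin n) ℂ A)
    {U : Set (Fin s → CompleteFlag n A)}
    (hU : IsOpen[zariski (basesAlgebra s e)] {v | (fun i => CompleteFlag.ofBasis (v i)) ∈ U}) :
    IsZariskiOpen U := by
  -- The largest possible set of polynomials: all those whose nonvanishing locus lies in `U`.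
  refine ⟨e, {p | ∀ v : Fin s → Basis (Fin n) ℂ A,
    MvPolynomial.eval (fun x => e.repr (v x.1 x.2.1) x.2.2) p ≠ 0 →
      (fun i => CompleteFlag.ofBasis (v i)) ∈ U}, fun v => ⟨fun hv => ?_, ?_⟩⟩
  · obtain ⟨f, hf, hfv, hf'⟩ := isOpen_zariski_iff.1 hU v hv
    rw [basesAlgebra, Algebra.adjoin_range_eq_range_aeval] at hf
    obtain ⟨p, rfl⟩ := hf
    have h : ∀ w, MvPolynomial.aeval (fun (y : Fin s × Fin n × Fin n)
        (v : Fin s → Basis (Fin n) ℂ A) => e.repr (v y.1 y.2.1) y.2.2) p w =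
        MvPolynomial.eval (fun x => e.repr (w x.1 x.2.1) x.2.2) p := by
      intro w
      clear hfv hf'
      induction p using MvPolynomial.induction_on with
      | C c => simp
      | add p q hp hq => simp_all
      | mul_X p i hp => simp_all
    refine ⟨p, fun w hw => hf' w ?_, ?_⟩
    · exact (h w).trans_ne hw
    · exact (h v).symm.trans_ne hfv
  · rintro ⟨p, hp, hv⟩
    exact hp v hv

end FlagConditions

/-! ### Position of subspaces and vectors -/

section Position

variable {A : Type*} [AddCommGroup A] [Module ℂ A]

/-- `u` and `w` are linearly dependent modulo `S`. -/
def Dep (S : Submodule ℂ A) (u w : A) : Prop :=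
  -- The nonzero pair `(c, d)` can be eliminated, so dependence is a closed condition. It holds
  -- automatically when `u` or `w` lies in `S`.
  ∃ c d : ℂ, (c ≠ 0 ∨ d ≠ 0) ∧ c • u + d • w ∈ S

theorem Dep.symm {S : Submodule ℂ A} {u w : A} (h : Dep S u w) : Dep S w u := by
  obtain ⟨c, d, h0, h⟩ := h
  exact ⟨d, c, h0.symm, by rwa [add_comm]⟩

theorem Dep.smul_left {S : Submodule ℂ A} {u w : A} (h : Dep S u w) {a : ℂ} (ha : a ≠ 0) :
    Dep S (a • u) w := by
  obtain ⟨c, d, h0, h⟩ := h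
  refine ⟨c / a, d, h0.imp_left fun hc => div_ne_zero hc ha, ?_⟩
  rwa [smul_smul, div_mul_cancel₀ _ ha]

theorem Dep.smul_right {S : Submodule ℂ A} {u w : A} (h : Dep S u w) {a : ℂ} (ha : a ≠ 0) :
    Dep S u (a • w) := (h.symm.smul_left ha).symm

/-- `x` and `t` span a plane that meets all of `L`, `M`, `T`, `P`, `Q`. -/
structure IsPair (L M T P Q : Submodule ℂ A) (x t : A) : Prop where
  left_ne : x ≠ 0
  right_ne : t ≠ 0
  left_mem : x ∈ L
  right_mem : t ∈ T
  depM : Dep M x t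
  depP : Dep P x t
  depQ : Dep Q x t

/-- `m` is dependent modulo `P` and modulo `Q` on each of `x` and `t`. -/
structure Aligned (P Q : Submodule ℂ A) (x t m : A) : Prop where
  -- If `x` and `t` span a plane `h` meeting `P` and `Q` each in a line, the four conditions
  -- together say `m ∈ (P + h) ∩ (Q + h)`. In this form they are closed and homogeneous in each of
  -- `x`, `t`, `m` separately, as elimination requires.
  left_left : Dep P m x
  left_right : Dep P m t
  right_left : Dep Q m x
  right_right : Dep Q m t

theorem Aligned.smul {P Q : Submodule ℂ A} {x t m : A} (h : Aligned P Q x t m) {a : ℂ}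
    (ha : a ≠ 0) : Aligned P Q x t (a • m) :=
  ⟨h.1.smul_left ha, h.2.smul_left ha, h.3.smul_left ha, h.4.smul_left ha⟩

theorem Aligned.smul_left {P Q : Submodule ℂ A} {x t m : A} (h : Aligned P Q x t m) {a : ℂ}
    (ha : a ≠ 0) : Aligned P Q (a • x) t m :=
  ⟨h.1.smul_right ha, h.2, h.3.smul_right ha, h.4⟩

theorem Aligned.smul_right {P Q : Submodule ℂ A} {x t m : A} (h : Aligned P Q x t m) {a : ℂ}
    (ha : a ≠ 0) : Aligned P Q x (a • t) m :=
  ⟨h.1, h.2.smul_right ha, h.3, h.4.smul_right ha⟩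

/-- `L`, `P ∩ Q`, `M ∩ P` and `M ∩ Q` are independent within the intersection of `L + M` and
`L + T`. -/
def Independent (L M T P Q : Submodule ℂ A) : Prop :=
  -- This encodes a relation `x + o + u + v = 0` with `x ∈ L`, `u = x₂ + t₂` in `M ∩ P`, `v = x₃ +
  -- t₃` in `M ∩ Q` and `-o = x₁ + t₂ + t₃` in `P ∩ Q`, where `x₁ = x + x₂ + x₃`. Taking the
  -- unknowns in `L` and `T` keeps all conditions linear and closed.
  ∀ x₁ ∈ L, ∀ x₂ ∈ L, ∀ x₃ ∈ L, ∀ t₂ ∈ T, ∀ t₃ ∈ T, x₂ + t₂ ∈ M → x₂ + t₂ ∈ P →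
    x₃ + t₃ ∈ M → x₃ + t₃ ∈ Q → x₁ + t₂ + t₃ ∈ P → x₁ + t₂ + t₃ ∈ Q →
    x₁ = 0 ∧ x₂ = 0 ∧ x₃ = 0 ∧ t₂ = 0 ∧ t₃ = 0

/-- No nonzero vector of `M ∩ (L + T) ∩ Y` is aligned with `x` and `t`. -/
def Isolated (L M T P Q Y : Submodule ℂ A) (x t : A) : Prop :=
  -- `Y` will be a hyperplane, so that at most a line of `M ∩ (L + T)` consists of vectors aligned
  -- with the pair.
  ∀ x' ∈ L, ∀ w ∈ T, x' + w ∈ M → x' + w ∈ Y → Aligned P Q x t (x' + w) → x' = 0 ∧ w = 0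

/-- The sum of the spaces of vectors of `M` and of `T` aligned with `x` and `t` is direct, and
meets `Y` in `0`. -/
def Avoids (M T P Q Y : Submodule ℂ A) (x t : A) : Prop :=
  ∀ m ∈ M, ∀ w ∈ T, Aligned P Q x t m → Aligned P Q x t w → m + w ∈ Y → m = 0 ∧ w = 0

/-- The general position of five flags. The subspaces of dimensions `2`, `m`, `j + 1`, `l + 1` and
`l + 1` in them are those to be met. -/
structure Generic {n : ℕ} (m j l : ℕ) (F : Fin 5 → CompleteFlag n A) : Prop where
  -- One definition serves twice: with `(m, j, l) = (5, b, b + 2)` for the total problem and with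
  -- `(3, 2, 2)` for the base problem.
  LM : ∀ w ∈ (F 0).space 2, w ∈ (F 1).space m → w = 0
  LT : ∀ w ∈ (F 0).space 2, w ∈ (F 2).space (j + 1) → w = 0
  indepM : Independent ((F 0).space 2) ((F 1).space m) ((F 2).space (j + 1))
    ((F 3).space (l + 1)) ((F 4).space (l + 1))
  indepT : Independent ((F 0).space 2) ((F 2).space (j + 1)) ((F 1).space m)
    ((F 3).space (l + 1)) ((F 4).space (l + 1))
  pair : ∀ x t, IsPair ((F 0).space 2) ((F 1).space m) ((F 2).space (j + 1))
    ((F 3).space (l + 1)) ((F 4).space (l + 1)) x t →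
    t ∉ (F 0).space (l + 2) ∧
    Isolated ((F 0).space 2) ((F 1).space m) ((F 2).space (j + 1))
      ((F 3).space (l + 1)) ((F 4).space (l + 1)) ((F 2).space (l + 2)) x t ∧
    Isolated ((F 0).space 2) ((F 2).space (j + 1)) ((F 1).space m)
      ((F 3).space (l + 1)) ((F 4).space (l + 1)) ((F 1).space (l + 2)) x t ∧
    t ∉ (F 2).space j ∧ ¬ Dep ((F 3).space l) x t ∧ ¬ Dep ((F 4).space l) x t

end Position

/-! ### Closed conditions -/

section Closed

set_option linter.unusedSectionVars false

variable {X : Type*} {A : Type*} [AddCommGroup A] [Module ℂ A] [FiniteDimensional ℂ A]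

/-- A family of subspaces spanned by initial segments of a regular family of bases. -/
def RegularFamily (R : Subalgebra ℂ (X → ℂ)) (S : X → Submodule ℂ A) : Prop :=
  ∃ (n : ℕ) (β : X → Basis (Fin n) ℂ A) (j : ℕ),
    (∀ i, Regular R (fun x => β x i)) ∧ ∀ x, S x = (CompleteFlag.ofBasis (β x)).space j

variable {R : Subalgebra ℂ (X → ℂ)} {S L M T P Q Y Y' : X → Submodule ℂ A}

theorem RegularFamily.lift (hS : RegularFamily R S) (Z : Type*) [AddCommGroup Z] [Module ℂ Z] :
    RegularFamily (extend R Z) (fun z => S z.1) := by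
  obtain ⟨n, β, j, hβ, h⟩ := hS
  exact ⟨n, fun z => β z.1, j, fun i => (hβ i).lift, fun z => h z.1⟩

theorem RegularFamily.isClosed (hS : RegularFamily R S) {f : X → A} (hf : Regular R f) :
    IsClosed[zariski R] {x | f x ∈ S x} := by
  obtain ⟨n, β, j, hβ, h⟩ := hS
  simp only [h]
  exact isClosed_mem_space hβ hf j

theorem isClosed_and {p q : X → Prop} (hp : IsClosed[zariski R] {x | p x})
    (hq : IsClosed[zariski R] {x | q x}) : IsClosed[zariski R] {x | p x ∧ q x} :=
  @IsClosed.inter X _ _ (zariski R) hp hq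

theorem RegularFamily.isClosed_dep (hS : RegularFamily R S) {f g : X → A} (hf : Regular R f)
    (hg : Regular R g) : IsClosed[zariski R] {x | Dep (S x) (f x) (g x)} := by
  have h : {x | Dep (S x) (f x) (g x)} =
      {x | ∃ y : ℂ × ℂ, y ≠ 0 ∧ (x, y) ∈ {z : X × ℂ × ℂ | z.2.1 • f z.1 + z.2.2 • g z.1 ∈ S z.1}} := by
    ext x
    simp only [Set.mem_ofPred_eq, Dep, Prod.exists, ne_eq, Prod.mk_eq_zero, not_and_or]
  rw [h]
  refine isClosed_exists_ne_zero ((hS.lift _).isClosed (Regular.add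
    (Regular.smul (Regular.snd.apply (LinearMap.fst ℂ ℂ ℂ)).mem hf.lift)
    (Regular.smul (Regular.snd.apply (LinearMap.snd ℂ ℂ ℂ)).mem hg.lift))) ?_
  intro x y c _ hy
  have := (S x).smul_mem c hy
  simpa [smul_smul] using this

theorem isClosed_aligned (hP : RegularFamily R P) (hQ : RegularFamily R Q) {f g m : X → A}
    (hf : Regular R f) (hg : Regular R g) (hm : Regular R m) :
    IsClosed[zariski R] {x | Aligned (P x) (Q x) (f x) (g x) (m x)} := by
  have h : {x | Aligned (P x) (Q x) (f x) (g x) (m x)} = {x | Dep (P x) (m x) (f x) ∧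
      Dep (P x) (m x) (g x) ∧ Dep (Q x) (m x) (f x) ∧ Dep (Q x) (m x) (g x)} := by
    ext x
    exact ⟨fun h => ⟨h.1, h.2, h.3, h.4⟩, fun h => ⟨h.1, h.2.1, h.2.2.1, h.2.2.2⟩⟩
  rw [h]
  exact isClosed_and (hP.isClosed_dep hm hf) (isClosed_and (hP.isClosed_dep hm hg)
    (isClosed_and (hQ.isClosed_dep hm hf) (hQ.isClosed_dep hm hg)))

theorem isOpen_disjoint (hL : RegularFamily R L) (hM : RegularFamily R M) :
    IsOpen[zariski R] {x | ∀ w ∈ L x, w ∈ M x → w = 0} := by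
  have h : {x | ∀ w ∈ L x, w ∈ M x → w = 0} =
      {x | ∃ y : A, y ≠ 0 ∧ (x, y) ∈ {z : X × A | z.2 ∈ L z.1 ∧ z.2 ∈ M z.1}}ᶜ := by
    ext x
    simp only [Set.mem_ofPred_eq, Set.mem_compl_iff, not_exists, not_and]
    exact forall_congr' fun w => by tauto
  rw [h, @isOpen_compl_iff _ _ (zariski R)]
  exact isClosed_exists_ne_zero (isClosed_and ((hL.lift _).isClosed Regular.snd)
    ((hM.lift _).isClosed Regular.snd))
    fun x y c _ hy => ⟨Submodule.smul_mem _ c hy.1, Submodule.smul_mem _ c hy.2⟩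

theorem isOpen_independent (hL : RegularFamily R L) (hM : RegularFamily R M)
    (hT : RegularFamily R T) (hP : RegularFamily R P) (hQ : RegularFamily R Q) :
    IsOpen[zariski R] {x | Independent (L x) (M x) (T x) (P x) (Q x)} := by
  have h : {x | Independent (L x) (M x) (T x) (P x) (Q x)} =
      {x | ∃ y : Fin 5 → A, y ≠ 0 ∧ (x, y) ∈ {z : X × (Fin 5 → A) |
        z.2 0 ∈ L z.1 ∧ z.2 1 ∈ L z.1 ∧ z.2 2 ∈ L z.1 ∧ z.2 3 ∈ T z.1 ∧ z.2 4 ∈ T z.1 ∧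
        z.2 1 + z.2 3 ∈ M z.1 ∧ z.2 1 + z.2 3 ∈ P z.1 ∧
        z.2 2 + z.2 4 ∈ M z.1 ∧ z.2 2 + z.2 4 ∈ Q z.1 ∧
        z.2 0 + z.2 3 + z.2 4 ∈ P z.1 ∧ z.2 0 + z.2 3 + z.2 4 ∈ Q z.1}}ᶜ := by
    ext x
    simp only [Set.mem_ofPred_eq, Set.mem_compl_iff, not_exists, not_and]
    constructor
    · intro h y hy0 h0 h1 h2 h3 h4 h5 h6 h7 h8 h9 h10
      obtain ⟨e0, e1, e2, e3, e4⟩ := h _ h0 _ h1 _ h2 _ h3 _ h4 h5 h6 h7 h8 h9 h10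
      refine hy0 (funext fun i => ?_)
      fin_cases i <;> assumption
    · intro h x₁ h1 x₂ h2 x₃ h3 t₂ h4 t₃ h5 h6 h7 h8 h9 h10 h11
      by_contra hne
      refine h ![x₁, x₂, x₃, t₂, t₃] (fun h0 => hne ?_) h1 h2 h3 h4 h5 h6 h7 h8 h9 h10 h11
      exact ⟨congrFun h0 0, congrFun h0 1, congrFun h0 2, congrFun h0 3, congrFun h0 4⟩
  rw [h, @isOpen_compl_iff _ _ (zariski R)]
  have r : ∀ i : Fin 5, Regular (extend R (Fin 5 → A)) (fun z => z.2 i) := fun i =>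
    Regular.snd.apply (LinearMap.proj (R := ℂ) (φ := fun _ : Fin 5 => A) i)
  refine isClosed_exists_ne_zero ?_ ?_
  · refine isClosed_and ((hL.lift _).isClosed (r 0)) <|
      isClosed_and ((hL.lift _).isClosed (r 1)) <| isClosed_and ((hL.lift _).isClosed (r 2)) <|
      isClosed_and ((hT.lift _).isClosed (r 3)) <| isClosed_and ((hT.lift _).isClosed (r 4)) <|
      isClosed_and ((hM.lift _).isClosed ((r 1).add (r 3))) <|
      isClosed_and ((hP.lift _).isClosed ((r 1).add (r 3))) <|
      isClosed_and ((hM.lift _).isClosed ((r 2).add (r 4))) <|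
      isClosed_and ((hQ.lift _).isClosed ((r 2).add (r 4))) <|
      isClosed_and ((hP.lift _).isClosed (((r 0).add (r 3)).add (r 4))) <|
      ((hQ.lift _).isClosed (((r 0).add (r 3)).add (r 4)))
  · rintro x y c - ⟨h0, h1, h2, h3, h4, h5, h6, h7, h8, h9, h10⟩
    simp only [Set.mem_ofPred_eq, Pi.smul_apply, ← smul_add]
    exact ⟨Submodule.smul_mem _ c h0, Submodule.smul_mem _ c h1, Submodule.smul_mem _ c h2,
      Submodule.smul_mem _ c h3, Submodule.smul_mem _ c h4, Submodule.smul_mem _ c h5,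
      Submodule.smul_mem _ c h6, Submodule.smul_mem _ c h7, Submodule.smul_mem _ c h8,
      Submodule.smul_mem _ c h9, Submodule.smul_mem _ c h10⟩

theorem isClosed_not_isolated (hL : RegularFamily R L) (hM : RegularFamily R M)
    (hT : RegularFamily R T) (hP : RegularFamily R P) (hQ : RegularFamily R Q)
    (hY : RegularFamily R Y) {f g : X → A} (hf : Regular R f) (hg : Regular R g) :
    IsClosed[zariski R] {x | ¬ Isolated (L x) (M x) (T x) (P x) (Q x) (Y x) (f x) (g x)} := by
  have h : {x | ¬ Isolated (L x) (M x) (T x) (P x) (Q x) (Y x) (f x) (g x)} =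
      {x | ∃ y : A × A, y ≠ 0 ∧ (x, y) ∈ {z : X × A × A | z.2.1 ∈ L z.1 ∧ z.2.2 ∈ T z.1 ∧
        z.2.1 + z.2.2 ∈ M z.1 ∧ z.2.1 + z.2.2 ∈ Y z.1 ∧
        Aligned (P z.1) (Q z.1) (f z.1) (g z.1) (z.2.1 + z.2.2)}} := by
    ext x
    simp only [Isolated, Set.mem_ofPred_eq, not_forall, Prod.exists, ne_eq, Prod.mk_eq_zero]
    constructor
    · rintro ⟨x', h1, w, h2, h3, h4, h5, h6⟩
      exact ⟨x', w, h6, h1, h2, h3, h4, h5⟩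
    · rintro ⟨x', w, h6, h1, h2, h3, h4, h5⟩
      exact ⟨x', h1, w, h2, h3, h4, h5, h6⟩
  rw [h]
  have r1 : Regular (extend R (A × A)) (fun z => z.2.1) :=
    Regular.snd.apply (LinearMap.fst ℂ A A)
  have r2 : Regular (extend R (A × A)) (fun z => z.2.2) :=
    Regular.snd.apply (LinearMap.snd ℂ A A)
  refine isClosed_exists_ne_zero ?_ ?_
  · refine isClosed_and ((hL.lift _).isClosed r1) <| isClosed_and ((hT.lift _).isClosed r2) <|
      isClosed_and ((hM.lift _).isClosed (r1.add r2)) <|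
      isClosed_and ((hY.lift _).isClosed (r1.add r2)) <|
      isClosed_aligned (hP.lift _) (hQ.lift _) hf.lift hg.lift (r1.add r2)
  · rintro x y c hc ⟨h1, h2, h3, h4, h5⟩
    simp only [Set.mem_ofPred_eq, Prod.smul_fst, Prod.smul_snd, ← smul_add]
    exact ⟨Submodule.smul_mem _ c h1, Submodule.smul_mem _ c h2, Submodule.smul_mem _ c h3,
      Submodule.smul_mem _ c h4, h5.smul hc⟩

theorem isClosed_not_avoids (hM : RegularFamily R M)
    (hT : RegularFamily R T) (hP : RegularFamily R P) (hQ : RegularFamily R Q)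
    (hY : RegularFamily R Y) (hY' : RegularFamily R Y') {f g : X → A} (hf : Regular R f)
    (hg : Regular R g) :
    IsClosed[zariski R] {x | ¬ Avoids (M x) (T x) (P x) (Q x) (Y x ⊓ Y' x) (f x) (g x)} := by
  have h : {x | ¬ Avoids (M x) (T x) (P x) (Q x) (Y x ⊓ Y' x) (f x) (g x)} =
      {x | ∃ y : A × A, y ≠ 0 ∧ (x, y) ∈ {z : X × A × A | z.2.1 ∈ M z.1 ∧ z.2.2 ∈ T z.1 ∧
        Aligned (P z.1) (Q z.1) (f z.1) (g z.1) z.2.1 ∧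
        Aligned (P z.1) (Q z.1) (f z.1) (g z.1) z.2.2 ∧
        z.2.1 + z.2.2 ∈ Y z.1 ∧ z.2.1 + z.2.2 ∈ Y' z.1}} := by
    ext x
    simp only [Avoids, Set.mem_ofPred_eq, not_forall, Prod.exists, ne_eq, Prod.mk_eq_zero,
      Submodule.mem_inf]
    constructor
    · rintro ⟨x', h1, w, h2, h3, h4, h5, h6⟩
      exact ⟨x', w, h6, h1, h2, h3, h4, h5⟩
    · rintro ⟨x', w, h6, h1, h2, h3, h4, h5⟩
      exact ⟨x', h1, w, h2, h3, h4, h5, h6⟩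
  rw [h]
  have r1 : Regular (extend R (A × A)) (fun z => z.2.1) :=
    Regular.snd.apply (LinearMap.fst ℂ A A)
  have r2 : Regular (extend R (A × A)) (fun z => z.2.2) :=
    Regular.snd.apply (LinearMap.snd ℂ A A)
  refine isClosed_exists_ne_zero ?_ ?_
  · refine isClosed_and ((hM.lift _).isClosed r1) <| isClosed_and ((hT.lift _).isClosed r2) <|
      isClosed_and (isClosed_aligned (hP.lift _) (hQ.lift _) hf.lift hg.lift r1) <|
      isClosed_and (isClosed_aligned (hP.lift _) (hQ.lift _) hf.lift hg.lift r2) <|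
      isClosed_and ((hY.lift _).isClosed (r1.add r2)) ((hY'.lift _).isClosed (r1.add r2))
  · rintro x y c hc ⟨h1, h2, h3, h4, h5, h6⟩
    simp only [Set.mem_ofPred_eq, Prod.smul_fst, Prod.smul_snd, ← smul_add]
    exact ⟨Submodule.smul_mem _ c h1, Submodule.smul_mem _ c h2, h3.smul hc, h4.smul hc,
      Submodule.smul_mem _ c h5, Submodule.smul_mem _ c h6⟩

/-- Two eliminations, of `w` and then of `u`. The hypotheses `hB₁` and `hB₂` make the locus of bad
pairs a cone in each of the two vectors. -/
theorem isOpen_forall_isPair (hL : RegularFamily R L) (hM : RegularFamily R M)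
    (hT : RegularFamily R T) (hP : RegularFamily R P) (hQ : RegularFamily R Q)
    {B : X → A → A → Prop}
    (hB : IsClosed[zariski (extend (extend R A) A)] {z | B z.1.1 z.1.2 z.2})
    (hB₁ : ∀ x u w (c : ℂ), c ≠ 0 → B x u w → B x (c • u) w)
    (hB₂ : ∀ x u w (c : ℂ), c ≠ 0 → B x u w → B x u (c • w)) :
    IsOpen[zariski R]
      {x | ∀ u w, IsPair (L x) (M x) (T x) (P x) (Q x) u w → ¬ B x u w} := by
  have h : {x | ∀ u w, IsPair (L x) (M x) (T x) (P x) (Q x) u w → ¬ B x u w} =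
      {x | ∃ u : A, u ≠ 0 ∧ (x, u) ∈ {z : X × A | ∃ w : A, w ≠ 0 ∧ (z, w) ∈
        {v : (X × A) × A | v.1.2 ∈ L v.1.1 ∧ v.2 ∈ T v.1.1 ∧ Dep (M v.1.1) v.1.2 v.2 ∧
          Dep (P v.1.1) v.1.2 v.2 ∧ Dep (Q v.1.1) v.1.2 v.2 ∧ B v.1.1 v.1.2 v.2}}}ᶜ := by
    ext x
    simp only [Set.mem_ofPred_eq, Set.mem_compl_iff, not_exists, not_and]
    exact ⟨fun h u h1 w h2 h3 h4 h5 h6 h7 => h u w ⟨h1, h2, h3, h4, h5, h6, h7⟩,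
      fun h u w hp => h u hp.1 w hp.2 hp.3 hp.4 hp.5 hp.6 hp.7⟩
  rw [h, @isOpen_compl_iff _ _ (zariski R)]
  have r1 : Regular (extend (extend R A) A) (fun z => z.1.2) := Regular.snd.lift
  have r2 : Regular (extend (extend R A) A) (fun z => z.2) := Regular.snd
  refine isClosed_exists_ne_zero (isClosed_exists_ne_zero ?_ ?_) ?_
  · exact isClosed_and (((hL.lift _).lift _).isClosed r1) <|
      isClosed_and (((hT.lift _).lift _).isClosed r2) <|
      isClosed_and (((hM.lift _).lift _).isClosed_dep r1 r2) <|
      isClosed_and (((hP.lift _).lift _).isClosed_dep r1 r2) <|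
      isClosed_and (((hQ.lift _).lift _).isClosed_dep r1 r2) hB
  · rintro z w c hc ⟨h1, h2, h3, h4, h5, h6⟩
    exact ⟨h1, Submodule.smul_mem _ c h2, h3.smul_right hc, h4.smul_right hc, h5.smul_right hc,
      hB₂ _ _ _ _ hc h6⟩
  · rintro x u c hc ⟨w, hw, h1, h2, h3, h4, h5, h6⟩
    exact ⟨w, hw, Submodule.smul_mem _ c h1, h2, h3.smul_left hc, h4.smul_left hc,
      h5.smul_left hc, hB₁ _ _ _ _ hc h6⟩

theorem isOpen_and {p q : X → Prop} (hp : IsOpen[zariski R] {x | p x})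
    (hq : IsOpen[zariski R] {x | q x}) : IsOpen[zariski R] {x | p x ∧ q x} :=
  @IsOpen.inter X (zariski R) _ _ hp hq

theorem isOpen_pair_notMem (hL : RegularFamily R L) (hM : RegularFamily R M)
    (hT : RegularFamily R T) (hP : RegularFamily R P) (hQ : RegularFamily R Q)
    (hY : RegularFamily R Y) : IsOpen[zariski R]
    {x | ∀ u w, IsPair (L x) (M x) (T x) (P x) (Q x) u w → w ∉ Y x} :=
  isOpen_forall_isPair hL hM hT hP hQ (B := fun x _ w => w ∈ Y x)
    (((hY.lift _).lift _).isClosed Regular.snd) (fun _ _ _ _ _ h => h)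
    (fun _ _ _ c _ h => Submodule.smul_mem _ c h)

theorem isOpen_pair_not_dep (hL : RegularFamily R L) (hM : RegularFamily R M)
    (hT : RegularFamily R T) (hP : RegularFamily R P) (hQ : RegularFamily R Q)
    (hY : RegularFamily R Y) : IsOpen[zariski R]
    {x | ∀ u w, IsPair (L x) (M x) (T x) (P x) (Q x) u w → ¬ Dep (Y x) u w} :=
  isOpen_forall_isPair hL hM hT hP hQ (B := fun x u w => Dep (Y x) u w)
    (((hY.lift _).lift _).isClosed_dep Regular.snd.lift Regular.snd)
    (fun _ _ _ _ hc h => h.smul_left hc) (fun _ _ _ _ hc h => h.smul_right hc)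

theorem isOpen_pair_isolated {M' T' : X → Submodule ℂ A} (hL : RegularFamily R L)
    (hM : RegularFamily R M) (hT : RegularFamily R T) (hP : RegularFamily R P)
    (hQ : RegularFamily R Q) (hM' : RegularFamily R M') (hT' : RegularFamily R T')
    (hY : RegularFamily R Y) : IsOpen[zariski R]
    {x | ∀ u w, IsPair (L x) (M x) (T x) (P x) (Q x) u w →
      Isolated (L x) (M' x) (T' x) (P x) (Q x) (Y x) u w} := by
  have := isOpen_forall_isPair hL hM hT hP hQ
    (B := fun x u w => ¬ Isolated (L x) (M' x) (T' x) (P x) (Q x) (Y x) u w)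
    (isClosed_not_isolated ((hL.lift _).lift _) ((hM'.lift _).lift _) ((hT'.lift _).lift _)
      ((hP.lift _).lift _) ((hQ.lift _).lift _) ((hY.lift _).lift _) Regular.snd.lift Regular.snd)
    (fun _ _ _ _ hc h h' => h fun x' h1 w h2 h3 h4 h5 => h' x' h1 w h2 h3 h4 (h5.smul_left hc))
    (fun _ _ _ _ hc h h' => h fun x' h1 w h2 h3 h4 h5 => h' x' h1 w h2 h3 h4 (h5.smul_right hc))
  simpa only [not_not] using this

theorem isOpen_pair_avoids (hL : RegularFamily R L)
    (hM : RegularFamily R M) (hT : RegularFamily R T) (hP : RegularFamily R P)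
    (hQ : RegularFamily R Q) (hY : RegularFamily R Y) (hY' : RegularFamily R Y') :
    IsOpen[zariski R]
    {x | ∀ u w, IsPair (L x) (M x) (T x) (P x) (Q x) u w →
      Avoids (M x) (T x) (P x) (Q x) (Y x ⊓ Y' x) u w} := by
  have := isOpen_forall_isPair hL hM hT hP hQ
    (B := fun x u w => ¬ Avoids (M x) (T x) (P x) (Q x) (Y x ⊓ Y' x) u w)
    (isClosed_not_avoids ((hM.lift _).lift _) ((hT.lift _).lift _)
      ((hP.lift _).lift _) ((hQ.lift _).lift _) ((hY.lift _).lift _) ((hY'.lift _).lift _)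
      Regular.snd.lift Regular.snd)
    (fun _ _ _ _ hc h h' => h fun m h1 w h2 h3 h4 h5 =>
      h' m h1 w h2 (h3.smul_left hc) (h4.smul_left hc) h5)
    (fun _ _ _ _ hc h h' => h fun m h1 w h2 h3 h4 h5 =>
      h' m h1 w h2 (h3.smul_right hc) (h4.smul_right hc) h5)
  simpa only [not_not] using this

theorem isOpen_generic {n m j l : ℕ} {F : X → Fin 5 → CompleteFlag n A}
    (hF : ∀ i d, RegularFamily R (fun x => (F x i).space d)) :
    IsOpen[zariski R] {x | Generic m j l (F x)} := by
  have h := isOpen_and (isOpen_disjoint (hF 0 2) (hF 1 m)) <|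
    isOpen_and (isOpen_disjoint (hF 0 2) (hF 2 (j + 1))) <|
    isOpen_and (isOpen_independent (hF 0 2) (hF 1 m) (hF 2 (j + 1)) (hF 3 (l + 1))
      (hF 4 (l + 1))) <|
    isOpen_and (isOpen_independent (hF 0 2) (hF 2 (j + 1)) (hF 1 m) (hF 3 (l + 1))
      (hF 4 (l + 1))) <|
    isOpen_and (isOpen_pair_notMem (hF 0 2) (hF 1 m) (hF 2 (j + 1)) (hF 3 (l + 1))
      (hF 4 (l + 1)) (hF 0 (l + 2))) <|
    isOpen_and (isOpen_pair_isolated (hF 0 2) (hF 1 m) (hF 2 (j + 1)) (hF 3 (l + 1))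
      (hF 4 (l + 1)) (hF 1 m) (hF 2 (j + 1)) (hF 2 (l + 2))) <|
    isOpen_and (isOpen_pair_isolated (hF 0 2) (hF 1 m) (hF 2 (j + 1)) (hF 3 (l + 1))
      (hF 4 (l + 1)) (hF 2 (j + 1)) (hF 1 m) (hF 1 (l + 2))) <|
    isOpen_and (isOpen_pair_notMem (hF 0 2) (hF 1 m) (hF 2 (j + 1)) (hF 3 (l + 1))
      (hF 4 (l + 1)) (hF 2 j)) <|
    isOpen_and (isOpen_pair_not_dep (hF 0 2) (hF 1 m) (hF 2 (j + 1)) (hF 3 (l + 1))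
      (hF 4 (l + 1)) (hF 3 l))
    (isOpen_pair_not_dep (hF 0 2) (hF 1 m) (hF 2 (j + 1)) (hF 3 (l + 1))
      (hF 4 (l + 1)) (hF 4 l))
  convert h using 1
  ext x
  constructor
  · intro g
    exact ⟨g.LM, g.LT, g.indepM, g.indepT, fun u w p => (g.pair u w p).1,
      fun u w p => (g.pair u w p).2.1, fun u w p => (g.pair u w p).2.2.1,
      fun u w p => (g.pair u w p).2.2.2.1, fun u w p => (g.pair u w p).2.2.2.2.1,
      fun u w p => (g.pair u w p).2.2.2.2.2⟩
  · rintro ⟨h1, h2, h3, h4, h5, h6, h7, h8, h9, h10⟩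
    exact ⟨h1, h2, h3, h4, fun u w p => ⟨h5 u w p, h6 u w p, h7 u w p, h8 u w p, h9 u w p,
      h10 u w p⟩⟩

/-- The members of the tuples of flags spanned by tuples of bases form regular families. -/
theorem regularFamily_ofBasis {n s : ℕ} (e : Basis (Fin n) ℂ A) (i : Fin s) (d : ℕ) :
    RegularFamily (basesAlgebra s e) (fun v => (CompleteFlag.ofBasis (v i)).space d) :=
  ⟨n, fun v => v i, d, fun k => regular_bases e i k, fun _ => rfl⟩

end Closed

open Submodule

/-! ### Dimension counts for `V` and for `H ∩ V` -/

section LinearAlgebra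

set_option linter.unusedSectionVars false

variable {A : Type*} [AddCommGroup A] [Module ℂ A] [FiniteDimensional ℂ A]

theorem finrank_add_le_of_le {X Y H : Submodule ℂ A} (hX : X ≤ H) (hY : Y ≤ H) :
    finrank ℂ X + finrank ℂ Y ≤ finrank ℂ H + finrank ℂ (X ⊓ Y : Submodule ℂ A) := by
  rw [← finrank_sup_add_finrank_inf_eq]
  exact Nat.add_le_add_right (finrank_mono (sup_le hX hY)) _

theorem finrank_add_le (X Y : Submodule ℂ A) :
    finrank ℂ X + finrank ℂ Y ≤ finrank ℂ A + finrank ℂ (X ⊓ Y : Submodule ℂ A) := by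
  have := finrank_add_le_of_le (le_top : X ≤ ⊤) (le_top : Y ≤ ⊤)
  rwa [finrank_top] at this

theorem exists_ne_zero_of_one_le {X : Submodule ℂ A} (h : 1 ≤ finrank ℂ X) : ∃ z ∈ X, z ≠ 0 :=
  (Submodule.ne_bot_iff X).1 (one_le_finrank_iff.1 h)

theorem one_le_finrank_of_mem {X : Submodule ℂ A} {z : A} (hz : z ∈ X) (h0 : z ≠ 0) :
    1 ≤ finrank ℂ X := one_le_finrank_iff.2 ((Submodule.ne_bot_iff X).2 ⟨z, hz, h0⟩)

theorem finrank_sup_of_disjoint {X Y : Submodule ℂ A} (h : ∀ w ∈ X, w ∈ Y → w = 0) :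
    finrank ℂ (X ⊔ Y : Submodule ℂ A) = finrank ℂ X + finrank ℂ Y := by
  have h0 : X ⊓ Y = ⊥ := (Submodule.eq_bot_iff _).2 fun w hw => h w hw.1 hw.2
  have := finrank_sup_add_finrank_inf_eq X Y
  rwa [h0, finrank_bot, add_zero] at this

theorem finrank_four_le {V X₁ X₂ X₃ X₄ : Submodule ℂ A} (h₁ : X₁ ≤ V) (h₂ : X₂ ≤ V) (h₃ : X₃ ≤ V)
    (h₄ : X₄ ≤ V) (h : ∀ x₁ ∈ X₁, ∀ x₂ ∈ X₂, ∀ x₃ ∈ X₃, ∀ x₄ ∈ X₄, x₁ + x₂ + x₃ + x₄ = 0 →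
      x₁ = 0 ∧ x₂ = 0 ∧ x₃ = 0 ∧ x₄ = 0) :
    finrank ℂ X₁ + finrank ℂ X₂ + finrank ℂ X₃ + finrank ℂ X₄ ≤ finrank ℂ V := by
  rw [← finrank_sup_of_disjoint (X := X₁) (Y := X₂), ← finrank_sup_of_disjoint (Y := X₃),
    ← finrank_sup_of_disjoint (Y := X₄)]
  · exact finrank_mono (sup_le (sup_le (sup_le h₁ h₂) h₃) h₄)
  · rintro w hw hw'
    obtain ⟨y, hy, z, hz, rfl⟩ := mem_sup.1 hw
    obtain ⟨u, hu, v, hv, rfl⟩ := mem_sup.1 hy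
    exact neg_eq_zero.1 (h u hu v hv z hz _ (neg_mem hw') (by abel)).2.2.2
  · rintro w hw hw'
    obtain ⟨u, hu, v, hv, rfl⟩ := mem_sup.1 hw
    exact neg_eq_zero.1 (h u hu v hv _ (neg_mem hw') 0 (zero_mem _) (by abel)).2.2.1
  · rintro w hw hw'
    exact (h w hw _ (neg_mem hw') 0 (zero_mem _) 0 (zero_mem _) (by abel)).1

/-- The space `V` in which the base of the fibration lives. -/
def baseSpace (L M T : Submodule ℂ A) : Submodule ℂ A := (L ⊔ M) ⊓ (L ⊔ T)

variable {L M T P Q : Submodule ℂ A}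

theorem baseSpace_swap : baseSpace L T M = baseSpace L M T := inf_comm _ _

/-- Decompose `u` and `v` along `L + T`; the relation then expresses `-o` through the same
`T`-parts, which is the configuration that `Independent` excludes. -/
theorem Independent.eq_zero (hI : Independent L M T P Q)
    {x o u v : A} (hx : x ∈ L) (ho : o ∈ baseSpace L M T ⊓ P ⊓ Q)
    (hu : u ∈ baseSpace L M T ⊓ M ⊓ P) (hv : v ∈ baseSpace L M T ⊓ M ⊓ Q)
    (h : x + o + u + v = 0) : x = 0 ∧ o = 0 ∧ u = 0 ∧ v = 0 := by
  obtain ⟨x₂, hx₂, t₂, ht₂, h₂⟩ := mem_sup.1 hu.1.1.2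
  obtain ⟨x₃, hx₃, t₃, ht₃, h₃⟩ := mem_sup.1 hv.1.1.2
  have ho' : x + x₂ + x₃ + t₂ + t₃ = -o := by
    rw [eq_neg_iff_add_eq_zero, ← h, ← h₂, ← h₃]
    abel
  obtain ⟨e1, e2, e3, e4, e5⟩ := hI (x + x₂ + x₃) (add_mem (add_mem hx hx₂) hx₃) x₂ hx₂ x₃ hx₃
    t₂ ht₂ t₃ ht₃ (h₂ ▸ hu.1.2) (h₂ ▸ hu.2) (h₃ ▸ hv.1.2) (h₃ ▸ hv.2)
    (ho' ▸ neg_mem ho.1.2) (ho' ▸ neg_mem ho.2)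
  have hx0 : x = 0 := by simpa [e2, e3] using e1
  have hu0 : u = 0 := by rw [← h₂, e2, e4, add_zero]
  have hv0 : v = 0 := by rw [← h₃, e3, e5, add_zero]
  refine ⟨hx0, ?_, hu0, hv0⟩
  simpa [hx0, hu0, hv0] using h

/-- The dimensions that the general position of `L`, `M`, `T`, `P`, `Q` leads to. -/
theorem finrank_baseSpace {b : ℕ} (hA : finrank ℂ A = 5 + b) (hL : finrank ℂ L = 2)
    (hMT : finrank ℂ M + finrank ℂ T = b + 6) (hP : finrank ℂ P = b + 3)
    (hQ : finrank ℂ Q = b + 3) (hLM : ∀ w ∈ L, w ∈ M → w = 0) (hLT : ∀ w ∈ L, w ∈ T → w = 0)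
    (hI : Independent L M T P Q) :
    finrank ℂ (baseSpace L M T) = 5 ∧
    finrank ℂ (baseSpace L M T ⊓ M : Submodule ℂ A) = 3 ∧
    finrank ℂ (baseSpace L M T ⊓ P : Submodule ℂ A) = 3 ∧
    finrank ℂ (baseSpace L M T ⊓ Q : Submodule ℂ A) = 3 ∧
    finrank ℂ (baseSpace L M T ⊓ P ⊓ Q : Submodule ℂ A) = 1 ∧
    finrank ℂ (baseSpace L M T ⊓ M ⊓ P : Submodule ℂ A) = 1 ∧
    finrank ℂ (baseSpace L M T ⊓ M ⊓ Q : Submodule ℂ A) = 1 := by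
  have hle : L ≤ baseSpace L M T := le_inf le_sup_left le_sup_left
  -- Let `v = dim V`; counting gives `v ≥ 5`. The three pieces besides `L` have dimension at least
  -- `v - 4` each, so independence yields `2 + 3 (v - 4) ≤ v`, hence `v ≤ 5`. All estimates are then
  -- equalities.
  have h0 := finrank_four_le hle (inf_le_left.trans inf_le_left : baseSpace L M T ⊓ P ⊓ Q ≤ _)
    (inf_le_left.trans inf_le_left : baseSpace L M T ⊓ M ⊓ P ≤ _)
    (inf_le_left.trans inf_le_left : baseSpace L M T ⊓ M ⊓ Q ≤ _)
    (fun x hx o ho u hu v hv h => hI.eq_zero hx ho hu hv h)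
  have h1 := finrank_sup_of_disjoint hLM
  have h2 := finrank_sup_of_disjoint hLT
  have h3 : _ ≤ _ + finrank ℂ (baseSpace L M T) := finrank_add_le (L ⊔ M) (L ⊔ T)
  have h4 := finrank_add_le_of_le (X := baseSpace L M T) (H := L ⊔ M) inf_le_left
    (le_sup_right : M ≤ L ⊔ M)
  have h5 := finrank_add_le (baseSpace L M T ⊓ P) Q
  have h6 := finrank_add_le (baseSpace L M T) P
  have h7 := finrank_add_le (baseSpace L M T ⊓ M) P
  have h8 := finrank_add_le (baseSpace L M T ⊓ M) Q
  have h9 := finrank_add_le (baseSpace L M T) Q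
  have h10 := finrank_add_le (baseSpace L M T ⊓ Q) P
  rw [inf_right_comm (baseSpace L M T) Q P] at h10
  omega

/-- A solution of the large problem meets `V` in a solution of the small one. -/
theorem finrank_inf_baseSpace {a b : ℕ} (hA : finrank ℂ A = 5 + b) (hL : finrank ℂ L = 2)
    (hM : finrank ℂ M = 5) (hT : finrank ℂ T = b + 1) (hP : finrank ℂ P = b + 3)
    (hQ : finrank ℂ Q = b + 3) (hLM : ∀ w ∈ L, w ∈ M → w = 0) (hLT : ∀ w ∈ L, w ∈ T → w = 0)
    (hI : Independent L M T P Q) (hI' : Independent L T M P Q) {H : Submodule ℂ A}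
    (hH : finrank ℂ H = 2 + a) (hHL : 1 ≤ finrank ℂ (H ⊓ L : Submodule ℂ A))
    (hHM : 2 ≤ finrank ℂ (H ⊓ M : Submodule ℂ A)) (hHT : a ≤ finrank ℂ (H ⊓ T : Submodule ℂ A))
    (hHP : a + 1 ≤ finrank ℂ (H ⊓ P : Submodule ℂ A))
    (hHQ : a + 1 ≤ finrank ℂ (H ⊓ Q : Submodule ℂ A)) :
    finrank ℂ (H ⊓ baseSpace L M T : Submodule ℂ A) = 2 ∧
    1 ≤ finrank ℂ (H ⊓ baseSpace L M T ⊓ L : Submodule ℂ A) ∧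
    1 ≤ finrank ℂ (H ⊓ baseSpace L M T ⊓ M : Submodule ℂ A) ∧
    1 ≤ finrank ℂ (H ⊓ baseSpace L M T ⊓ T : Submodule ℂ A) ∧
    1 ≤ finrank ℂ (H ⊓ baseSpace L M T ⊓ P : Submodule ℂ A) ∧
    1 ≤ finrank ℂ (H ⊓ baseSpace L M T ⊓ Q : Submodule ℂ A) := by
  set V := baseSpace L M T with hV
  obtain ⟨d1, d2, d3, d4, d5, d6, d7⟩ := finrank_baseSpace hA hL (by omega) hP hQ hLM hLT hI
  obtain ⟨-, f2, f3, f4, f5, f6, f7⟩ := finrank_baseSpace hA hL (by omega) hP hQ hLT hLM hI'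
  rw [baseSpace_swap] at f2 f3 f4 f5 f6 f7
  rw [← hV] at d1 d2 d3 d4 d5 d6 d7 f2 f3 f4 f5 f6 f7
  have hLV : L ≤ V := le_inf le_sup_left le_sup_left
  have gL : H ⊓ L ≤ H ⊓ V ⊓ L := le_inf (le_inf inf_le_left (inf_le_right.trans hLV)) inf_le_right
  have gT : H ⊓ (L ⊔ M) ⊓ T ≤ H ⊓ V ⊓ T :=
    le_inf (le_inf (inf_le_left.trans inf_le_left) (le_inf (inf_le_left.trans inf_le_right)
      (inf_le_right.trans le_sup_right))) inf_le_right
  have e1 := finrank_mono gL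
  have e2 := finrank_mono gT
  -- the intersections with a subspace of `H`
  have sub : ∀ (X S : Submodule ℂ A), X ≤ H → finrank ℂ X + finrank ℂ (H ⊓ S : Submodule ℂ A) ≤
      2 + a + finrank ℂ (X ⊓ S : Submodule ℂ A) := by
    intro X S hX
    have := finrank_add_le_of_le hX (inf_le_left : H ⊓ S ≤ H)
    rwa [← inf_assoc, inf_eq_left.2 hX, hH] at this
  -- As `L ∩ M = 0`, the contributions 1 and 2 of `L` and `M` add up. Hence `H ∩ (L + M)` meets `T`,
  -- and it does so inside `V`.
  have hN : 3 ≤ finrank ℂ (H ⊓ (L ⊔ M) : Submodule ℂ A) := by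
    have := finrank_sup_of_disjoint (X := H ⊓ L) (Y := H ⊓ M)
      (fun w hw hw' => hLM w hw.2 hw'.2)
    have h' := finrank_mono (sup_le (le_inf inf_le_left (inf_le_right.trans le_sup_left))
      (le_inf inf_le_left (inf_le_right.trans le_sup_right)) :
        (H ⊓ L) ⊔ (H ⊓ M) ≤ H ⊓ (L ⊔ M))
    omega
  have e3 := sub (H ⊓ (L ⊔ M)) T inf_le_left
  have hLT2 : finrank ℂ (H ⊓ V ⊓ L : Submodule ℂ A) + finrank ℂ (H ⊓ V ⊓ T : Submodule ℂ A) ≤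
      finrank ℂ (H ⊓ V : Submodule ℂ A) := by
    rw [← finrank_sup_of_disjoint (X := H ⊓ V ⊓ L) (Y := H ⊓ V ⊓ T)
      (fun w hw hw' => hLT w hw.2 hw'.2)]
    exact finrank_mono (sup_le inf_le_left inf_le_left)
  have eP := sub (H ⊓ V) P inf_le_left
  have eQ := sub (H ⊓ V) Q inf_le_left
  -- If `H ∩ V` has dimension `n`, then `P` and `Q` cut it in dimension at least `n - 1`, while `V ∩
  -- P ∩ Q` is a line; so `2 (n - 1) ≤ n + 1`, that is, `n ≤ 3`.
  have ePQ := finrank_add_le_of_le (inf_le_left : H ⊓ V ⊓ P ≤ H ⊓ V)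
    (inf_le_left : H ⊓ V ⊓ Q ≤ H ⊓ V)
  have hPQ : H ⊓ V ⊓ P ⊓ (H ⊓ V ⊓ Q) ≤ V ⊓ P ⊓ Q :=
    le_inf (le_inf (inf_le_left.trans (inf_le_left.trans inf_le_right))
      (inf_le_left.trans inf_le_right)) (inf_le_right.trans inf_le_right)
  have ePQ' := finrank_mono hPQ
  -- a three-dimensional intersection contradicts independence
  have key : ∀ {M T : Submodule ℂ A} (_ : baseSpace L M T = V)
      (_ : Independent L M T P Q) (_ : finrank ℂ (V ⊓ M ⊓ P : Submodule ℂ A) = 1)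
      (_ : finrank ℂ (V ⊓ M ⊓ Q : Submodule ℂ A) = 1),
      finrank ℂ (H ⊓ V : Submodule ℂ A) = 3 →
      ¬ 2 ≤ finrank ℂ (H ⊓ V ⊓ M : Submodule ℂ A) := by
    intro M T hVM hI hp hq h3 h2
    have k1 := finrank_add_le_of_le (inf_le_left : H ⊓ V ⊓ M ≤ H ⊓ V)
      (inf_le_left : H ⊓ V ⊓ P ≤ H ⊓ V)
    have k2 := finrank_add_le_of_le (inf_le_left : H ⊓ V ⊓ M ≤ H ⊓ V)
      (inf_le_left : H ⊓ V ⊓ Q ≤ H ⊓ V)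
    -- Within a three-dimensional `H ∩ V`, the traces of `L`, `P ∩ Q`, `M ∩ P` and `M ∩ Q` would all
    -- be nonzero, and four independent lines do not fit.
    have hle := finrank_four_le
      (inf_le_left : H ⊓ V ⊓ L ≤ H ⊓ V)
      (inf_le_left.trans inf_le_left : H ⊓ V ⊓ P ⊓ (H ⊓ V ⊓ Q) ≤ H ⊓ V)
      (inf_le_left.trans inf_le_left : H ⊓ V ⊓ M ⊓ (H ⊓ V ⊓ P) ≤ H ⊓ V)
      (inf_le_left.trans inf_le_left : H ⊓ V ⊓ M ⊓ (H ⊓ V ⊓ Q) ≤ H ⊓ V)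
      (fun x hx o ho u hu v hv h => hI.eq_zero hx.2
        (hVM.symm ▸ ⟨⟨ho.1.1.2, ho.1.2⟩, ho.2.2⟩)
        (hVM.symm ▸ ⟨⟨hu.1.1.2, hu.1.2⟩, hu.2.2⟩)
        (hVM.symm ▸ ⟨⟨hv.1.1.2, hv.1.2⟩, hv.2.2⟩) h)
    omega
  have keyM := key rfl hI d6 d7
  have keyT := key baseSpace_swap hI' f6 f7
  have hle3 : finrank ℂ (H ⊓ V : Submodule ℂ A) ≤ 3 := by omega
  -- The alternative that excludes `n = 3`: either `H ∩ (L + M)` has dimension 3, and then `M` meets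
  -- `H ∩ V` in dimension at least `n - 1`; or it is larger, and then `T` meets `H ∩ V` in dimension
  -- at least 2.
  have hN3 : finrank ℂ (H ⊓ (L ⊔ M) : Submodule ℂ A) = 3 →
      2 + finrank ℂ (H ⊓ V : Submodule ℂ A) ≤
        3 + finrank ℂ (H ⊓ V ⊓ M : Submodule ℂ A) := by
    intro h3
    have k := finrank_add_le_of_le (inf_le_inf_left H inf_le_left : H ⊓ V ≤ H ⊓ (L ⊔ M))
      (inf_le_inf_left H le_sup_right : H ⊓ M ≤ H ⊓ (L ⊔ M))
    have k' := finrank_mono (inf_le_inf_left (H ⊓ V) inf_le_right :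
      H ⊓ V ⊓ (H ⊓ M) ≤ H ⊓ V ⊓ M)
    omega
  have hne3 : finrank ℂ (H ⊓ V : Submodule ℂ A) ≠ 3 := by
    intro h3
    by_cases h : finrank ℂ (H ⊓ (L ⊔ M) : Submodule ℂ A) = 3
    · exact keyM h3 (by have := hN3 h; omega)
    · exact keyT h3 (by omega)
  omega

end LinearAlgebra

/-! ### The space `Z` over a plane spanned by a pair -/

section FiberSpace

set_option linter.unusedSectionVars false

variable {A : Type*} [AddCommGroup A] [Module ℂ A] [FiniteDimensional ℂ A]

/-- The space `Z` that contains all solutions of the large problem that meet the base space in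
`h`. -/
def fiberSpace (M T P Q h : Submodule ℂ A) : Submodule ℂ A :=
  (M ⊓ ((P ⊔ h) ⊓ (Q ⊔ h))) ⊔ (T ⊓ ((P ⊔ h) ⊓ (Q ⊔ h)))

variable {L M T P Q P' Q' Y Y' : Submodule ℂ A} {x t : A}

theorem IsPair.coeff_eq_zero (hp : IsPair L M T P Q x t) (hLT : ∀ w ∈ L, w ∈ T → w = 0)
    {c d : ℂ} (h : c • x + d • t = 0) : c = 0 ∧ d = 0 := by
  have hx : c • x = 0 := hLT _ (smul_mem _ c hp.left_mem)
    (by rw [eq_neg_of_add_eq_zero_left h]; exact neg_mem (smul_mem _ d hp.right_mem))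
  have ht : d • t = 0 := by simpa [hx] using h
  exact ⟨(smul_eq_zero.1 hx).resolve_right hp.left_ne,
    (smul_eq_zero.1 ht).resolve_right hp.right_ne⟩

theorem finrank_span_pair_eq (h : LinearIndependent ℂ ![x, t]) :
    finrank ℂ (span ℂ {x, t}) = 2 := by
  have := finrank_span_eq_card h
  rwa [Matrix.range_cons, Matrix.range_cons, Matrix.range_empty, Set.union_empty,
    Set.singleton_union, Fintype.card_fin] at this

theorem IsPair.finrank_span (hp : IsPair L M T P Q x t) (hLT : ∀ w ∈ L, w ∈ T → w = 0) :
    finrank ℂ (span ℂ {x, t}) = 2 :=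
  finrank_span_pair_eq (LinearIndependent.pair_iff.2 fun _ _ h => hp.coeff_eq_zero hLT h)

theorem left_mem_span_pair : x ∈ span ℂ {x, t} := subset_span (by simp)

theorem right_mem_span_pair : t ∈ span ℂ {x, t} := subset_span (by simp)

theorem dep_of_mem {S : Submodule ℂ A} {z : A} (hz : z ∈ span ℂ {x, t}) (h0 : z ≠ 0)
    (hS : z ∈ S) : Dep S x t := by
  obtain ⟨c, d, rfl⟩ := mem_span_pair.1 hz
  refine ⟨c, d, ?_, hS⟩
  by_contra! h
  simp [h.1, h.2] at h0

theorem IsPair.one_le_finrank (hp : IsPair L M T P Q x t) (hLT : ∀ w ∈ L, w ∈ T → w = 0)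
    {S : Submodule ℂ A} (hS : Dep S x t) :
    1 ≤ finrank ℂ (span ℂ {x, t} ⊓ S : Submodule ℂ A) := by
  obtain ⟨c, d, h0, h⟩ := hS
  refine one_le_finrank_of_mem (z := c • x + d • t)
    ⟨add_mem (smul_mem _ _ left_mem_span_pair) (smul_mem _ _ right_mem_span_pair), h⟩ fun hz => ?_
  obtain ⟨hc, hd⟩ := hp.coeff_eq_zero hLT hz
  simp [hc, hd] at h0

/-- A plane meeting the five subspaces is spanned by a pair. -/
theorem exists_isPair {h : Submodule ℂ A} (hLT : ∀ w ∈ L, w ∈ T → w = 0) (hh : finrank ℂ h = 2)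
    (hL : 1 ≤ finrank ℂ (h ⊓ L : Submodule ℂ A)) (hM : 1 ≤ finrank ℂ (h ⊓ M : Submodule ℂ A))
    (hT : 1 ≤ finrank ℂ (h ⊓ T : Submodule ℂ A)) (hP : 1 ≤ finrank ℂ (h ⊓ P : Submodule ℂ A))
    (hQ : 1 ≤ finrank ℂ (h ⊓ Q : Submodule ℂ A)) :
    ∃ x t, IsPair L M T P Q x t ∧ h = span ℂ {x, t} := by
  obtain ⟨x, ⟨hxh, hx⟩, hx0⟩ := exists_ne_zero_of_one_le hL
  obtain ⟨t, ⟨hth, ht⟩, ht0⟩ := exists_ne_zero_of_one_le hT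
  have hli : LinearIndependent ℂ ![x, t] := LinearIndependent.pair_iff.2 fun c d h => by
    have h1 : c • x = 0 := hLT _ (smul_mem _ c hx)
      (by rw [eq_neg_of_add_eq_zero_left h]; exact neg_mem (smul_mem _ d ht))
    have h2 : d • t = 0 := by simpa [h1] using h
    exact ⟨(smul_eq_zero.1 h1).resolve_right hx0, (smul_eq_zero.1 h2).resolve_right ht0⟩
  have hfr : finrank ℂ (span ℂ {x, t}) = 2 := finrank_span_pair_eq hli
  have hspan : span ℂ {x, t} = h := by
    refine eq_of_le_of_finrank_le (span_le.2 ?_) (by omega)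
    rintro z (rfl | rfl)
    exacts [hxh, hth]
  have hd : ∀ S : Submodule ℂ A, 1 ≤ finrank ℂ (h ⊓ S : Submodule ℂ A) → Dep S x t := by
    intro S hS
    obtain ⟨z, ⟨hz, hzS⟩, hz0⟩ := exists_ne_zero_of_one_le hS
    exact dep_of_mem (hspan.symm ▸ hz) hz0 hzS
  exact ⟨x, t, ⟨hx0, ht0, hx, ht, hd M hM, hd P hP, hd Q hQ⟩, hspan.symm⟩

theorem IsPair.span_le_baseSpace (hp : IsPair L M T P Q x t) (hLM : ∀ w ∈ L, w ∈ M → w = 0) :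
    span ℂ {x, t} ≤ baseSpace L M T := by
  obtain ⟨c, d, h0, h⟩ := hp.depM
  have hd : d ≠ 0 := by
    rintro rfl
    rw [zero_smul, add_zero] at h
    have := hLM _ (smul_mem _ c hp.left_mem) h
    rw [smul_eq_zero] at this
    simp_all [hp.left_ne]
  refine span_le.2 ?_
  rintro z (rfl | rfl)
  · exact ⟨mem_sup_left hp.left_mem, mem_sup_left hp.left_mem⟩
  · refine ⟨?_, mem_sup_right hp.right_mem⟩
    have : z = d⁻¹ • (c • x + d • z) + (-(d⁻¹ * c)) • x := by
      rw [smul_add, smul_smul, smul_smul, inv_mul_cancel₀ hd]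
      module
    rw [this]
    exact add_mem (smul_mem _ _ (mem_sup_right h)) (smul_mem _ _ (mem_sup_left hp.left_mem))

/-- Modulo `S` the plane of `x` and `t` becomes a line, spanned by whichever image is nonzero.
Dependence on a zero image is no condition, and dependence on a nonzero one is membership in that
line. -/
theorem mem_sup_span_pair_iff {S : Submodule ℂ A} (hS : Dep S x t) (hnot : ¬ (x ∈ S ∧ t ∈ S))
    {m : A} : m ∈ S ⊔ span ℂ {x, t} ↔ Dep S m x ∧ Dep S m t := by
  have key : ∀ {u v : A}, u ∉ S → Dep S u v → ∃ e : ℂ, v - e • u ∈ S := by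
    rintro u v hu ⟨c, d, h0, h⟩
    have hd : d ≠ 0 := by
      rintro rfl
      rw [zero_smul, add_zero] at h
      exact hu ((smul_mem_iff _ (h0.resolve_right (by simp))).1 h)
    refine ⟨-(d⁻¹ * c), ?_⟩
    have : v - (-(d⁻¹ * c)) • u = d⁻¹ • (c • u + d • v) := by
      rw [smul_add, smul_smul d⁻¹ d, inv_mul_cancel₀ hd]
      module
    rw [this]
    exact smul_mem _ _ h
  constructor
  · intro hm
    obtain ⟨p, hpS, z, hz, rfl⟩ := mem_sup.1 hm
    obtain ⟨c, d, rfl⟩ := mem_span_pair.1 hz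
    by_cases hx : x ∈ S
    · have ht : t ∉ S := fun ht => hnot ⟨hx, ht⟩
      refine ⟨⟨0, 1, by simp, by simpa using hx⟩, ⟨1, -d, by simp, ?_⟩⟩
      have : (1 : ℂ) • (p + (c • x + d • t)) + -d • t = p + c • x := by module
      rw [this]
      exact add_mem hpS (smul_mem _ _ hx)
    · obtain ⟨e, he⟩ := key hx hS
      have h1 : Dep S (p + (c • x + d • t)) x := by
        refine ⟨1, -(c + d * e), by simp, ?_⟩
        have : (1 : ℂ) • (p + (c • x + d • t)) + -(c + d * e) • x = p + d • (t - e • x) := by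
          module
        rw [this]
        exact add_mem hpS (smul_mem _ _ he)
      refine ⟨h1, ?_⟩
      by_cases he0 : e = 0
      · exact ⟨0, 1, by simp, by simpa [he0] using he⟩
      · refine ⟨e, -(c + d * e), by simp [he0], ?_⟩
        have : e • (p + (c • x + d • t)) + -(c + d * e) • t = e • p - c • (t - e • x) := by
          module
        rw [this]
        exact sub_mem (smul_mem _ _ hpS) (smul_mem _ _ he)
  · rintro ⟨h1, h2⟩
    by_cases hx : x ∈ S
    · obtain ⟨e, he⟩ := key (fun ht => hnot ⟨hx, ht⟩) h2.symm
      have : m = (m - e • t) + e • t := by module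
      rw [this]
      exact add_mem (mem_sup_left he) (smul_mem _ _ (mem_sup_right right_mem_span_pair))
    · obtain ⟨e, he⟩ := key hx h1.symm
      have : m = (m - e • x) + e • x := by module
      rw [this]
      exact add_mem (mem_sup_left he) (smul_mem _ _ (mem_sup_right left_mem_span_pair))

/-- A plane contained in `P` would meet the hyperplane `P'` of `P`. -/
theorem finrank_span_inf_le_one {b : ℕ} (hP : finrank ℂ P = b + 3) (hP' : finrank ℂ P' = b + 2) (hle : P' ≤ P)
    (hn : ¬ Dep P' x t) : finrank ℂ (span ℂ {x, t} ⊓ P : Submodule ℂ A) ≤ 1 := by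
  by_contra hcon
  have h1 := finrank_add_le_of_le (inf_le_right : span ℂ {x, t} ⊓ P ≤ P) hle
  obtain ⟨z, ⟨⟨hz, -⟩, hzP⟩, hz0⟩ := exists_ne_zero_of_one_le
    (show 1 ≤ finrank ℂ (span ℂ {x, t} ⊓ P ⊓ P' : Submodule ℂ A) by omega)
  exact hn (dep_of_mem hz hz0 hzP)

/-- Five subspaces and a pair in general position. -/
structure PairPosition (b : ℕ) (L M T P Q P' Q' Y Y' : Submodule ℂ A) (x t : A) : Prop where
  finrank_A : finrank ℂ A = 5 + b
  finrank_L : finrank ℂ L = 2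
  finrank_M : finrank ℂ M = 5
  finrank_T : finrank ℂ T = b + 1
  finrank_P : finrank ℂ P = b + 3
  finrank_Q : finrank ℂ Q = b + 3
  finrank_P' : finrank ℂ P' = b + 2
  finrank_Q' : finrank ℂ Q' = b + 2
  finrank_Y : finrank ℂ Y = b + 4
  finrank_Y' : finrank ℂ Y' = b + 4
  LM : ∀ w ∈ L, w ∈ M → w = 0
  LT : ∀ w ∈ L, w ∈ T → w = 0
  indepM : Independent L M T P Q
  isPair : IsPair L M T P Q x t
  hP' : P' ≤ P
  hQ' : Q' ≤ Q
  hY : T ≤ Y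
  notP' : ¬ Dep P' x t
  notQ' : ¬ Dep Q' x t
  isolM : Isolated L M T P Q Y x t
  isolT : Isolated L T M P Q Y' x t

namespace PairPosition

variable {b : ℕ}

theorem finrank_span (hp : PairPosition b L M T P Q P' Q' Y Y' x t) :
    finrank ℂ (span ℂ {x, t}) = 2 := hp.isPair.finrank_span hp.LT

theorem finrank_inf_P (hp : PairPosition b L M T P Q P' Q' Y Y' x t) :
    finrank ℂ (span ℂ {x, t} ⊓ P : Submodule ℂ A) = 1 :=
  le_antisymm (finrank_span_inf_le_one hp.finrank_P hp.finrank_P' hp.hP' hp.notP')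
    (hp.isPair.one_le_finrank hp.LT hp.isPair.depP)

theorem finrank_inf_Q (hp : PairPosition b L M T P Q P' Q' Y Y' x t) :
    finrank ℂ (span ℂ {x, t} ⊓ Q : Submodule ℂ A) = 1 :=
  le_antisymm (finrank_span_inf_le_one hp.finrank_Q hp.finrank_Q' hp.hQ' hp.notQ')
    (hp.isPair.one_le_finrank hp.LT hp.isPair.depQ)

theorem aligned_iff (hp : PairPosition b L M T P Q P' Q' Y Y' x t) {m : A} :
    Aligned P Q x t m ↔ m ∈ (P ⊔ span ℂ {x, t}) ⊓ (Q ⊔ span ℂ {x, t}) := by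
  have key : ∀ {S : Submodule ℂ A}, finrank ℂ (span ℂ {x, t} ⊓ S : Submodule ℂ A) = 1 →
      ¬ (x ∈ S ∧ t ∈ S) := by
    rintro S hS ⟨h1, h2⟩
    have : span ℂ {x, t} ≤ S := span_le.2 (by rintro z (rfl | rfl) <;> assumption)
    rw [inf_eq_left.2 this, hp.finrank_span] at hS
    omega
  rw [mem_inf, mem_sup_span_pair_iff hp.isPair.depP (key hp.finrank_inf_P),
    mem_sup_span_pair_iff hp.isPair.depQ (key hp.finrank_inf_Q)]
  exact ⟨fun h => ⟨⟨h.1, h.2⟩, h.3, h.4⟩, fun h => ⟨h.1.1, h.1.2, h.2.1, h.2.2⟩⟩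

theorem finrank_sup_P (hp : PairPosition b L M T P Q P' Q' Y Y' x t) :
    finrank ℂ (P ⊔ span ℂ {x, t} : Submodule ℂ A) = b + 4 := by
  have h1 := finrank_sup_add_finrank_inf_eq P (span ℂ {x, t})
  rw [inf_comm, hp.finrank_inf_P, hp.finrank_span, hp.finrank_P] at h1
  omega

theorem finrank_sup_Q (hp : PairPosition b L M T P Q P' Q' Y Y' x t) :
    finrank ℂ (Q ⊔ span ℂ {x, t} : Submodule ℂ A) = b + 4 := by
  have h1 := finrank_sup_add_finrank_inf_eq Q (span ℂ {x, t})
  rw [inf_comm, hp.finrank_inf_Q, hp.finrank_span, hp.finrank_Q] at h1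
  omega

theorem disjoint (hp : PairPosition b L M T P Q P' Q' Y Y' x t) :
    ∀ w ∈ M ⊓ ((P ⊔ span ℂ {x, t}) ⊓ (Q ⊔ span ℂ {x, t})),
      w ∈ T ⊓ ((P ⊔ span ℂ {x, t}) ⊓ (Q ⊔ span ℂ {x, t})) → w = 0 := by
  rintro w ⟨hM, hW⟩ ⟨hT, -⟩
  exact (hp.isolM 0 (zero_mem _) w hT (by simpa using hM) (by simpa using hp.hY hT)
    (by simpa using hp.aligned_iff.2 hW)).2

theorem span_le_fiberSpace (hp : PairPosition b L M T P Q P' Q' Y Y' x t) :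
    span ℂ {x, t} ≤ fiberSpace M T P Q (span ℂ {x, t}) := by
  have hW : span ℂ {x, t} ≤ (P ⊔ span ℂ {x, t}) ⊓ (Q ⊔ span ℂ {x, t}) :=
    le_inf le_sup_right le_sup_right
  have ht : t ∈ fiberSpace M T P Q (span ℂ {x, t}) :=
    mem_sup_right ⟨hp.isPair.right_mem, hW right_mem_span_pair⟩
  obtain ⟨c, d, h0, h⟩ := hp.isPair.depM
  have hq : c • x + d • t ∈ span ℂ {x, t} :=
    add_mem (smul_mem _ _ left_mem_span_pair) (smul_mem _ _ right_mem_span_pair)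
  have hc : c ≠ 0 := by
    rintro rfl
    rw [zero_smul, zero_add] at h hq
    have := hp.disjoint _ ⟨h, hW hq⟩ ⟨smul_mem _ _ hp.isPair.right_mem, hW hq⟩
    simp_all [hp.isPair.right_ne]
  refine span_le.2 ?_
  rintro z (rfl | rfl)
  · have : z = c⁻¹ • (c • z + d • t) + (-(c⁻¹ * d)) • t := by
      rw [smul_add, smul_smul, inv_mul_cancel₀ hc]
      module
    have hmem := add_mem (smul_mem _ c⁻¹ (mem_sup_left ⟨h, hW hq⟩ :
      _ ∈ fiberSpace M T P Q (span ℂ {z, t}))) (smul_mem _ (-(c⁻¹ * d)) ht)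
    rwa [← this] at hmem
  · exact ht

theorem finrank_M_inf (hp : PairPosition b L M T P Q P' Q' Y Y' x t) :
    3 ≤ finrank ℂ (M ⊓ ((P ⊔ span ℂ {x, t}) ⊓ (Q ⊔ span ℂ {x, t})) : Submodule ℂ A) := by
  have h1 := finrank_add_le (P ⊔ span ℂ {x, t}) (Q ⊔ span ℂ {x, t})
  have h2 := finrank_add_le M ((P ⊔ span ℂ {x, t}) ⊓ (Q ⊔ span ℂ {x, t}))
  rw [hp.finrank_sup_P, hp.finrank_sup_Q, hp.finrank_A] at h1
  rw [hp.finrank_M, hp.finrank_A] at h2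
  omega

theorem finrank_T_inf (hp : PairPosition b L M T P Q P' Q' Y Y' x t) :
    b ≤ finrank ℂ (T ⊓ ((P ⊔ span ℂ {x, t}) ⊓ (Q ⊔ span ℂ {x, t})) : Submodule ℂ A) + 1 := by
  have h1 := finrank_add_le (P ⊔ span ℂ {x, t}) (Q ⊔ span ℂ {x, t})
  have h2 := finrank_add_le T ((P ⊔ span ℂ {x, t}) ⊓ (Q ⊔ span ℂ {x, t}))
  rw [hp.finrank_sup_P, hp.finrank_sup_Q, hp.finrank_A] at h1
  rw [hp.finrank_T, hp.finrank_A] at h2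
  omega

theorem finrank_base (hp : PairPosition b L M T P Q P' Q' Y Y' x t) :
    finrank ℂ (baseSpace L M T) = 5 :=
  (finrank_baseSpace hp.finrank_A hp.finrank_L (by rw [hp.finrank_M, hp.finrank_T]; omega)
    hp.finrank_P hp.finrank_Q hp.LM hp.LT hp.indepM).1

/-- If `m + w` lies in `V` with `m ∈ M` and `w ∈ T`, then `m ∈ L + T` and `w ∈ L + M`, so both
summands lie in `V`. Isolation says that the aligned vectors of `M ∩ V` and those of `T ∩ V` meet a
hyperplane only in 0, so each kind fills at most a line. -/
theorem finrank_fiberSpace_inf (hp : PairPosition b L M T P Q P' Q' Y Y' x t) :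
    finrank ℂ (fiberSpace M T P Q (span ℂ {x, t}) ⊓ baseSpace L M T : Submodule ℂ A) ≤ 2 := by
  set W := (P ⊔ span ℂ {x, t}) ⊓ (Q ⊔ span ℂ {x, t}) with hW
  have h1 : finrank ℂ (M ⊓ W ⊓ baseSpace L M T : Submodule ℂ A) ≤ 1 := by
    have h := finrank_add_le (M ⊓ W ⊓ baseSpace L M T) Y
    have h0 : M ⊓ W ⊓ baseSpace L M T ⊓ Y = ⊥ := by
      rw [Submodule.eq_bot_iff]
      rintro w ⟨⟨⟨hwM, hwW⟩, -, hw⟩, hwY⟩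
      obtain ⟨x', hx', t', ht', rfl⟩ := mem_sup.1 hw
      obtain ⟨e1, e2⟩ := hp.isolM x' hx' t' ht' hwM hwY (hp.aligned_iff.2 hwW)
      rw [e1, e2, add_zero]
    rw [h0, finrank_bot, hp.finrank_A, hp.finrank_Y] at h
    omega
  have h2 : finrank ℂ (T ⊓ W ⊓ baseSpace L M T : Submodule ℂ A) ≤ 1 := by
    have h := finrank_add_le (T ⊓ W ⊓ baseSpace L M T) Y'
    have h0 : T ⊓ W ⊓ baseSpace L M T ⊓ Y' = ⊥ := by
      rw [Submodule.eq_bot_iff]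
      rintro w ⟨⟨⟨hwM, hwW⟩, hw, -⟩, hwY⟩
      obtain ⟨x', hx', t', ht', rfl⟩ := mem_sup.1 hw
      obtain ⟨e1, e2⟩ := hp.isolT x' hx' t' ht' hwM hwY (hp.aligned_iff.2 hwW)
      rw [e1, e2, add_zero]
    rw [h0, finrank_bot, hp.finrank_A, hp.finrank_Y'] at h
    omega
  have hle : fiberSpace M T P Q (span ℂ {x, t}) ⊓ baseSpace L M T ≤
      (M ⊓ W ⊓ baseSpace L M T) ⊔ (T ⊓ W ⊓ baseSpace L M T) := by
    rintro z ⟨hz, hzV⟩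
    obtain ⟨m, ⟨hm, hmW⟩, w, ⟨hw, hwW⟩, rfl⟩ := mem_sup.1 hz
    have hmV : m ∈ baseSpace L M T := by
      refine ⟨mem_sup_right hm, ?_⟩
      have : m = m + w - w := by abel
      rw [this]
      exact sub_mem hzV.2 (mem_sup_right hw)
    have hwV : w ∈ baseSpace L M T := by
      have := sub_mem hzV hmV
      rwa [add_sub_cancel_left] at this
    exact add_mem (mem_sup_left ⟨⟨hm, hmW⟩, hmV⟩) (mem_sup_right ⟨⟨hw, hwW⟩, hwV⟩)
  have h3 := finrank_mono hle
  have h4 := finrank_add_le_finrank_add_finrank (M ⊓ W ⊓ baseSpace L M T)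
    (T ⊓ W ⊓ baseSpace L M T)
  omega

theorem fiberSpace_inf (hp : PairPosition b L M T P Q P' Q' Y Y' x t) :
    fiberSpace M T P Q (span ℂ {x, t}) ⊓ baseSpace L M T = span ℂ {x, t} := by
  symm
  refine eq_of_le_of_finrank_le
    (le_inf hp.span_le_fiberSpace (hp.isPair.span_le_baseSpace hp.LM)) ?_
  rw [hp.finrank_span]
  exact hp.finrank_fiberSpace_inf

/-- The direct sum defining `Z` has dimension at least `3 + (b - 1)`, and `dim (Z + V) = dim Z + 5 -
2` is at most `5 + b`. The two bounds agree. -/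
theorem finrank_fiberSpace_and_sup (hp : PairPosition b L M T P Q P' Q' Y Y' x t) :
    finrank ℂ (fiberSpace M T P Q (span ℂ {x, t})) = b + 2 ∧
      fiberSpace M T P Q (span ℂ {x, t}) ⊔ baseSpace L M T = ⊤ := by
  have h1 := finrank_sup_of_disjoint hp.disjoint
  have h2 := hp.finrank_M_inf
  have h3 := hp.finrank_T_inf
  have h4 := finrank_sup_add_finrank_inf_eq (fiberSpace M T P Q (span ℂ {x, t}))
    (baseSpace L M T)
  rw [hp.fiberSpace_inf, hp.finrank_span, hp.finrank_base] at h4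
  have h5 := finrank_le (fiberSpace M T P Q (span ℂ {x, t}) ⊔ baseSpace L M T)
  rw [hp.finrank_A] at h5
  change finrank ℂ (fiberSpace M T P Q (span ℂ {x, t})) = _ at h1
  refine ⟨by omega, eq_top_of_finrank_eq ?_⟩
  rw [hp.finrank_A]
  omega

theorem finrank_fiberSpace (hp : PairPosition b L M T P Q P' Q' Y Y' x t) :
    finrank ℂ (fiberSpace M T P Q (span ℂ {x, t})) = b + 2 := hp.finrank_fiberSpace_and_sup.1

theorem fiberSpace_sup (hp : PairPosition b L M T P Q P' Q' Y Y' x t) :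
    fiberSpace M T P Q (span ℂ {x, t}) ⊔ baseSpace L M T = ⊤ := hp.finrank_fiberSpace_and_sup.2

theorem fiberSpace_inf_eq_bot (hp : PairPosition b L M T P Q P' Q' Y Y' x t)
    {S : Submodule ℂ A} (hS : Avoids M T P Q S x t) :
    fiberSpace M T P Q (span ℂ {x, t}) ⊓ S = ⊥ := by
  rw [Submodule.eq_bot_iff]
  rintro z ⟨hz, hzS⟩
  obtain ⟨m, ⟨hm, hmW⟩, w, ⟨hw, hwW⟩, rfl⟩ := mem_sup.1 hz
  obtain ⟨e1, e2⟩ := hS m hm w hw (hp.aligned_iff.2 hmW) (hp.aligned_iff.2 hwW) hzS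
  rw [e1, e2, add_zero]

/-- `Z` lies in `P + h`, where `P` is a hyperplane. -/
theorem finrank_fiberSpace_inf_P (hp : PairPosition b L M T P Q P' Q' Y Y' x t) :
    b + 1 ≤ finrank ℂ (fiberSpace M T P Q (span ℂ {x, t}) ⊓ P : Submodule ℂ A) := by
  have h := finrank_add_le_of_le (X := fiberSpace M T P Q (span ℂ {x, t})) (Y := P)
    (H := P ⊔ span ℂ {x, t}) (sup_le (inf_le_right.trans inf_le_left)
      (inf_le_right.trans inf_le_left)) le_sup_left
  rw [hp.finrank_sup_P, hp.finrank_fiberSpace, hp.finrank_P] at h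
  omega

theorem finrank_fiberSpace_inf_Q (hp : PairPosition b L M T P Q P' Q' Y Y' x t) :
    b + 1 ≤ finrank ℂ (fiberSpace M T P Q (span ℂ {x, t}) ⊓ Q : Submodule ℂ A) := by
  have h := finrank_add_le_of_le (X := fiberSpace M T P Q (span ℂ {x, t})) (Y := Q)
    (H := Q ⊔ span ℂ {x, t}) (sup_le (inf_le_right.trans inf_le_right)
      (inf_le_right.trans inf_le_right)) le_sup_left
  rw [hp.finrank_sup_Q, hp.finrank_fiberSpace, hp.finrank_Q] at h
  omega

theorem finrank_fiberSpace_inf_M (hp : PairPosition b L M T P Q P' Q' Y Y' x t) :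
    3 ≤ finrank ℂ (fiberSpace M T P Q (span ℂ {x, t}) ⊓ M : Submodule ℂ A) :=
  hp.finrank_M_inf.trans (finrank_mono (le_inf le_sup_left inf_le_left))

theorem finrank_fiberSpace_inf_T (hp : PairPosition b L M T P Q P' Q' Y Y' x t) :
    b ≤ finrank ℂ (fiberSpace M T P Q (span ℂ {x, t}) ⊓ T : Submodule ℂ A) + 1 :=
  hp.finrank_T_inf.trans (Nat.add_le_add_right
    (finrank_mono (le_inf le_sup_right inf_le_left)) 1)

/-- By dimension `H = (H ∩ P) + h`, since `h ∩ P` is a line, and likewise for `Q`; so `H ⊆ W`. There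
`M` and `T` are disjoint, and the dimensions 2 and `a` of their traces exhaust `H`. -/
theorem le_fiberSpace (hp : PairPosition b L M T P Q P' Q' Y Y' x t) {a : ℕ}
    {H : Submodule ℂ A} (hH : finrank ℂ H = 2 + a) (hh : H ⊓ baseSpace L M T = span ℂ {x, t})
    (hHM : 2 ≤ finrank ℂ (H ⊓ M : Submodule ℂ A)) (hHT : a ≤ finrank ℂ (H ⊓ T : Submodule ℂ A))
    (hHP : a + 1 ≤ finrank ℂ (H ⊓ P : Submodule ℂ A))
    (hHQ : a + 1 ≤ finrank ℂ (H ⊓ Q : Submodule ℂ A)) :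
    H ≤ fiberSpace M T P Q (span ℂ {x, t}) := by
  have hle : span ℂ {x, t} ≤ H := hh ▸ inf_le_left
  have key : ∀ S : Submodule ℂ A, finrank ℂ (span ℂ {x, t} ⊓ S : Submodule ℂ A) = 1 →
      a + 1 ≤ finrank ℂ (H ⊓ S : Submodule ℂ A) → H ≤ S ⊔ span ℂ {x, t} := by
    intro S h1 h2
    have h3 := finrank_sup_add_finrank_inf_eq (H ⊓ S) (span ℂ {x, t})
    have h4 : H ⊓ S ⊓ span ℂ {x, t} ≤ span ℂ {x, t} ⊓ S :=
      le_inf inf_le_right (inf_le_left.trans inf_le_right)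
    have h5 := finrank_mono h4
    rw [hp.finrank_span] at h3
    have h6 : (H ⊓ S) ⊔ span ℂ {x, t} = H :=
      eq_of_le_of_finrank_le (sup_le inf_le_left hle) (by omega)
    rw [← h6]
    exact sup_le_sup_right inf_le_right _
  have hW : H ≤ (P ⊔ span ℂ {x, t}) ⊓ (Q ⊔ span ℂ {x, t}) :=
    le_inf (key P hp.finrank_inf_P hHP) (key Q hp.finrank_inf_Q hHQ)
  have h1 := finrank_sup_of_disjoint (X := H ⊓ M) (Y := H ⊓ T)
    (fun w h1 h2 => hp.disjoint w ⟨h1.2, hW h1.1⟩ ⟨h2.2, hW h1.1⟩)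
  have h2 : (H ⊓ M) ⊔ (H ⊓ T) = H :=
    eq_of_le_of_finrank_le (sup_le inf_le_left inf_le_left) (by omega)
  rw [← h2]
  exact sup_le_sup (le_inf inf_le_right (inf_le_left.trans hW))
    (le_inf inf_le_right (inf_le_left.trans hW))

end PairPosition

end FiberSpace

/-! ### Completing flags, cutting them with a subspace, projecting them to a quotient -/

section Flags

set_option linter.unusedSectionVars false

variable {W : Type*} [AddCommGroup W] [Module ℂ W] [FiniteDimensional ℂ W]

theorem exists_finrank_succ {S : Submodule ℂ W} (h : finrank ℂ S < finrank ℂ W) :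
    ∃ S', S ≤ S' ∧ finrank ℂ S' = finrank ℂ S + 1 := by
  have hS : S ≠ ⊤ := by
    rintro rfl
    rw [finrank_top] at h
    exact lt_irrefl _ h
  obtain ⟨v, hv⟩ : ∃ v, v ∉ S := by
    by_contra! hcon
    exact hS (eq_top_iff.2 fun v _ => hcon v)
  have hv0 : v ≠ 0 := fun h0 => hv (h0 ▸ zero_mem S)
  refine ⟨S ⊔ span ℂ {v}, le_sup_left, ?_⟩
  rw [finrank_sup_of_disjoint, finrank_span_singleton hv0]
  intro w hw hw'
  obtain ⟨c, rfl⟩ := mem_span_singleton.1 hw'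
  by_contra h0
  rw [smul_eq_zero, not_or] at h0
  exact hv ((smul_mem_iff _ h0.1).1 hw)

theorem exists_finrank_pred {S : Submodule ℂ W} {d : ℕ} (h : finrank ℂ S = d + 1) :
    ∃ S', S' ≤ S ∧ finrank ℂ S' = d := by
  have key : ∀ k ≤ d + 1, ∃ S' : Submodule ℂ S, finrank ℂ S' = k := by
    intro k
    induction k with
    | zero => exact fun _ => ⟨⊥, finrank_bot _ _⟩
    | succ k ih =>
      intro hk
      obtain ⟨S', hS'⟩ := ih (by omega)
      obtain ⟨S'', -, h''⟩ := exists_finrank_succ (S := S') (by omega)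
      exact ⟨S'', by omega⟩
  obtain ⟨S', hS'⟩ := key d (by omega)
  exact ⟨S'.map S.subtype, map_subtype_le _ _, by rw [finrank_map_subtype_eq, hS']⟩

/-- A partial flag extends to a complete one. -/
theorem exists_completeFlag {n lo hi : ℕ} (hW : finrank ℂ W = n) (hlo : lo ≤ hi) (hhi : hi ≤ n)
    (f : ℕ → Submodule ℂ W) (hf : ∀ i, lo ≤ i → i < hi → f i ≤ f (i + 1))
    (hfr : ∀ i, lo ≤ i → i ≤ hi → finrank ℂ (f i) = i) :
    ∃ G : CompleteFlag n W, ∀ i, lo ≤ i → i ≤ hi → G.space i = f i := by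
  have upd : ∀ (k : ℕ) (S : Submodule ℂ W), ∃ f' : ℕ → Submodule ℂ W,
      f' k = S ∧ ∀ i, i ≠ k → f' i = f i := fun k S =>
    ⟨Function.update f k S, Function.update_self .., fun i hi => Function.update_of_ne hi ..⟩
  -- The given segment is first prolonged downwards to dimension 0, then upwards to dimension `n`.
  induction lo generalizing f with
  | succ lo ih =>
    obtain ⟨S, hS, hS'⟩ := exists_finrank_pred (hfr (lo + 1) le_rfl hlo)
    obtain ⟨f', hf', hff'⟩ := upd lo S
    obtain ⟨G, hG⟩ := ih (by omega) f' (by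
      intro i h1 h2
      by_cases hi : i = lo
      · subst hi
        rwa [hf', hff' _ (by omega)]
      · rw [hff' _ hi, hff' _ (by omega)]
        exact hf i (by omega) h2) (by
      intro i h1 h2
      by_cases hi : i = lo
      · subst hi
        rw [hf', hS']
      · rw [hff' _ hi]
        exact hfr i (by omega) h2) (fun k S =>
      ⟨Function.update f' k S, Function.update_self .., fun i hi => Function.update_of_ne hi ..⟩)
    refine ⟨G, fun i h1 h2 => ?_⟩
    rw [hG i (by omega) h2, hff' _ (by omega)]
  | zero =>
    obtain ⟨k, rfl⟩ := Nat.exists_eq_add_of_le hhi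
    induction k generalizing hi f with
    | succ k ih =>
      obtain ⟨S, hS, hS'⟩ := exists_finrank_succ (S := f hi) (by
        rw [hfr hi hlo le_rfl]
        omega)
      rw [hfr hi hlo le_rfl] at hS'
      obtain ⟨f', hf', hff'⟩ := upd (hi + 1) S
      obtain ⟨G, hG⟩ := ih (hi := hi + 1) (by omega) f' (by
          intro i _ h2
          by_cases hi' : i = hi
          · subst hi'
            rwa [hf', hff' _ (by omega)]
          · rw [hff' _ (by omega), hff' _ (by omega)]
            exact hf i (by omega) (by omega)) (by
          intro i _ h2
          by_cases hi' : i = hi + 1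
          · subst hi'
            rw [hf', hS']
          · rw [hff' _ hi']
            exact hfr i (by omega) (by omega)) (fun k S =>
      ⟨Function.update f' k S, Function.update_self .., fun i hi => Function.update_of_ne hi ..⟩)
        (by omega) (by omega)
      obtain ⟨G', hG'⟩ : ∃ G' : CompleteFlag (hi + (k + 1)) W, G'.space = G.space :=
        ⟨⟨G.space, G.mono, fun j hj => G.finrank_space j (by omega),
          fun j hj => G.space_eq_top j (by omega)⟩, rfl⟩
      refine ⟨G', fun i h1 h2 => ?_⟩
      rw [hG', hG i h1 (by omega), hff' _ (by omega)]
    | zero =>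
      refine ⟨⟨fun i => if i ≤ hi then f i else ⊤, monotone_nat_of_le_succ ?_, ?_, ?_⟩, ?_⟩
      · intro i
        by_cases h : i + 1 ≤ hi
        · simp only [if_pos h, if_pos (show i ≤ hi by omega)]
          exact hf i (by omega) (by omega)
        · exact le_top.trans_eq (if_neg h).symm
      · intro i hi'
        rw [if_pos (show i ≤ hi by omega)]
        exact hfr i (by omega) (by omega)
      · intro i hi'
        by_cases h : i ≤ hi
        · simp only [h, if_true]
          refine eq_top_of_finrank_eq ?_
          rw [hfr i (by omega) h]
          omega
        · simp only [h, if_false]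
      · intro i _ h2
        simp only [h2, if_true]

theorem CompleteFlag.finrank_inf_le {n : ℕ} (F : CompleteFlag n W) (Z : Submodule ℂ W)
    {m m' : ℕ} (h : m ≤ m') (hm' : m' ≤ n) :
    finrank ℂ (Z ⊓ F.space m' : Submodule ℂ W) + m ≤
      finrank ℂ (Z ⊓ F.space m : Submodule ℂ W) + m' := by
  have h1 := finrank_add_le_of_le (inf_le_right : Z ⊓ F.space m' ≤ F.space m') (F.mono h)
  rw [inf_assoc, inf_eq_right.2 (F.mono h), F.finrank_space m (h.trans hm'),
    F.finrank_space m' hm'] at h1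
  omega

/-- The intersection with `Z` grows by at most one at each step of the flag. If it grows as much as
possible between `m₀` and `m₁`, it grows by exactly one at every step between; so two extreme
dimensions determine all others. -/
theorem CompleteFlag.finrank_inf_eq {n : ℕ} (F : CompleteFlag n W) {Z : Submodule ℂ W}
    {m₀ d₀ m₁ m : ℕ} (h₀ : finrank ℂ (Z ⊓ F.space m₀ : Submodule ℂ W) ≤ d₀)
    (h₁ : d₀ + m₁ ≤ finrank ℂ (Z ⊓ F.space m₁ : Submodule ℂ W) + m₀) (hm₁ : m₁ ≤ n)
    (hm₀ : m₀ ≤ m) (hm : m ≤ m₁) :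
    finrank ℂ (Z ⊓ F.space m : Submodule ℂ W) + m₀ = d₀ + m := by
  have h2 := F.finrank_inf_le Z hm₀ (hm.trans hm₁)
  have h3 := F.finrank_inf_le Z hm hm₁
  omega

theorem finrank_map_mkQ (V X : Submodule ℂ W) :
    finrank ℂ (X.map V.mkQ) + finrank ℂ (X ⊓ V : Submodule ℂ W) = finrank ℂ X := by
  have h := LinearMap.finrank_range_add_finrank_ker (V.mkQ.domRestrict X)
  have h1 : LinearMap.range (V.mkQ.domRestrict X) = X.map V.mkQ := LinearMap.range_domRestrict _ _
  have h2 : (LinearMap.ker (V.mkQ.domRestrict X)).map X.subtype = X ⊓ V := by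
    ext z
    simp [mem_map, LinearMap.mem_ker, and_comm]
  rw [h1, ← finrank_map_subtype_eq X (LinearMap.ker (V.mkQ.domRestrict X)), h2] at h
  exact h

theorem finrank_inf_comap_subtype {V : Submodule ℂ W} (h : Submodule ℂ V) (X : Submodule ℂ W) :
    finrank ℂ (h ⊓ X.comap V.subtype : Submodule ℂ V) =
      finrank ℂ (h.map V.subtype ⊓ X : Submodule ℂ W) := by
  rw [← finrank_map_subtype_eq V (h ⊓ X.comap V.subtype)]
  have : (h ⊓ X.comap V.subtype).map V.subtype = h.map V.subtype ⊓ X := by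
    ext z
    constructor
    · rintro ⟨y, ⟨hy, hyX⟩, rfl⟩
      exact ⟨⟨y, hy, rfl⟩, hyX⟩
    · rintro ⟨⟨y, hy, rfl⟩, hyX⟩
      exact ⟨y, ⟨hy, hyX⟩, rfl⟩
  rw [this]

/-- The subspaces between `h` and `Z` correspond to subspaces of `W / V`, and their intersection
with any `S` is computed there. -/
theorem finrank_inf_eq_add {V Z h H : Submodule ℂ W} (hZ : Z ⊓ V = h) (hh : h ≤ H)
    (hH : H ≤ Z) (S : Submodule ℂ W) :
    finrank ℂ (H ⊓ S : Submodule ℂ W) = finrank ℂ (h ⊓ S : Submodule ℂ W) +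
      finrank ℂ (H.map V.mkQ ⊓ (Z ⊓ S).map V.mkQ : Submodule ℂ (W ⧸ V)) := by
  have hHV : H ⊓ V = h := le_antisymm (hZ ▸ inf_le_inf_right V hH)
    (le_inf hh (hZ ▸ inf_le_right))
  have h1 : (H ⊓ S).map V.mkQ = H.map V.mkQ ⊓ (Z ⊓ S).map V.mkQ := by
    refine le_antisymm (le_inf (map_mono inf_le_left) (map_mono (inf_le_inf_right S hH))) ?_
    rintro w ⟨⟨y, hy, hyw⟩, ⟨z, ⟨hzZ, hzS⟩, hzy⟩⟩
    refine ⟨z, ⟨?_, hzS⟩, hzy⟩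
    have h1 : z - y ∈ V := (Submodule.Quotient.eq V).1 (hzy.trans hyw.symm)
    have h2 : z - y ∈ H := hh (hZ ▸ ⟨sub_mem hzZ (hH hy), h1⟩)
    have := add_mem h2 hy
    rwa [sub_add_cancel] at this
  rw [← finrank_map_mkQ V (H ⊓ S), add_comm, inf_right_comm, hHV, h1]

end Flags

/-! ### Schubert conditions for a subspace and for its image in the quotient -/

section Conditions

set_option linter.unusedSectionVars false

variable {A B : Type*} [AddCommGroup A] [Module ℂ A] [FiniteDimensional ℂ A]
  [AddCommGroup B] [Module ℂ B] [FiniteDimensional ℂ B]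
  {a b : ℕ} {F : CompleteFlag (5 + b) A} {G : CompleteFlag b B} {H : Submodule ℂ A}
  {K : Submodule ℂ B} {p : ℕ → ℕ}

theorem CompleteFlag.finrank_eq {n : ℕ} (F : CompleteFlag n A) : finrank ℂ A = n := by
  have := F.finrank_space n le_rfl
  rwa [F.space_eq_top n le_rfl, finrank_top] at this

theorem CompleteFlag.le_finrank_inf {n : ℕ} (F : CompleteFlag n A) (H : Submodule ℂ A) {m d : ℕ}
    (hm : m ≤ n) (hd : d + n ≤ finrank ℂ H + m) :
    d ≤ finrank ℂ (H ⊓ F.space m : Submodule ℂ A) := by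
  have := finrank_add_le H (F.space m)
  rw [F.finrank_space m hm, F.finrank_eq] at this
  omega

/-- The new first row asks that `H` meet `F.space 2`, which `h2` grants. The other conditions move
by one row, matching the 1 by which the intersections with `H` exceed those with `K`. -/
theorem mem_schubertVariety_iff_of_addRow (hab : a < b) (hp : IsPartitionFor a b p)
    (hH : finrank ℂ H = 2 + a) (hK : finrank ℂ K = a)
    (h2 : 1 ≤ finrank ℂ (H ⊓ F.space 2 : Submodule ℂ A))
    (h : ∀ i, 1 ≤ i → i ≤ b → finrank ℂ (H ⊓ F.space (i + 4) : Submodule ℂ A) =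
      1 + finrank ℂ (K ⊓ G.space i : Submodule ℂ B)) :
    H ∈ schubertVariety (2 + a) (5 + b) (addRow (b - a + 2) p) F ↔
      K ∈ schubertVariety a b p G := by
  obtain ⟨hanti, h0, hpa⟩ := hp
  have hle : ∀ j, p j ≤ b - a := fun j => (hanti (Nat.zero_le j)).trans h0
  have hx : ∀ j < a, 5 + b - (2 + a) + (j + 1 + 1) - addRow (b - a + 2) p (j + 1) =
      (b - a + (j + 1) - p j) + 4 := by
    intro j _
    have := hle j
    simp only [addRow]
    omega
  constructor
  · rintro ⟨-, hF⟩
    refine ⟨hK, fun j hj => ?_⟩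
    have h1 := hF (j + 1) (by omega)
    have := hle j
    rw [hx j hj, h _ (by omega) (by omega)] at h1
    omega
  · rintro ⟨-, hG⟩
    refine ⟨hH, fun j hj => ?_⟩
    obtain _ | j := j
    · have : 5 + b - (2 + a) + (0 + 1) - addRow (b - a + 2) p 0 = 2 := by
        simp only [addRow]
        omega
      rwa [this]
    · by_cases hja : j < a
      · have := hle j
        rw [hx j hja, h _ (by omega) (by omega)]
        have := hG j hja
        omega
      · have : j = a := by omega
        subst this
        rw [F.space_eq_top _ (by simp only [addRow, hpa]; omega), inf_top_eq, hH]
        omega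

/-- The second row asks for dimension 2 in `F.space 5`, equivalently for `K` to meet `G.space 2`,
which is the first condition of `(b - a - 1, p)`. The first row then follows, because `F.space 4` is
a hyperplane in `F.space 5`. -/
theorem mem_schubertVariety_iff_of_addRow_addRow (ha : 0 < a) (hab : a < b)
    (hp : IsPartitionFor a b (addRow (b - a - 1) p))
    (hH : finrank ℂ H = 2 + a) (hK : finrank ℂ K = a)
    (h5 : finrank ℂ (H ⊓ F.space 5 : Submodule ℂ A) =
      1 + finrank ℂ (K ⊓ G.space 2 : Submodule ℂ B))
    (h : ∀ i, 2 ≤ i → i ≤ b → finrank ℂ (H ⊓ F.space (i + 4) : Submodule ℂ A) =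
      1 + finrank ℂ (K ⊓ G.space i : Submodule ℂ B)) :
    H ∈ schubertVariety (2 + a) (5 + b) (addRow (b - a) (addRow (b - a) p)) F ↔
      K ∈ schubertVariety a b (addRow (b - a - 1) p) G := by
  obtain ⟨hanti, h0, hpa⟩ := hp
  have hle : ∀ j, p j ≤ b - a - 1 := fun j => hanti (Nat.zero_le (j + 1))
  obtain ⟨a, rfl⟩ := Nat.exists_eq_succ_of_ne_zero ha.ne'
  have hpa' : p a = 0 := hpa
  simp only [Nat.succ_eq_add_one] at *
  have hx : ∀ j < a, 5 + b - (2 + (a + 1)) + (j + 1 + 1 + 1) -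
      addRow (b - (a + 1)) (addRow (b - (a + 1)) p) (j + 1 + 1) =
      (b - (a + 1) + (j + 1 + 1) - addRow (b - (a + 1) - 1) p (j + 1)) + 4 := by
    intro j _
    have := hle j
    simp only [addRow]
    omega
  have hx1 : 5 + b - (2 + (a + 1)) + (1 + 1) - addRow (b - (a + 1)) (addRow (b - (a + 1)) p) 1 =
      5 := by
    simp only [addRow]
    omega
  have hy0 : b - (a + 1) + (0 + 1) - addRow (b - (a + 1) - 1) p 0 = 2 := by
    simp only [addRow]
    omega
  have hb : ∀ j < a, 2 ≤ b - (a + 1) + (j + 1 + 1) - addRow (b - (a + 1) - 1) p (j + 1) ∧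
      b - (a + 1) + (j + 1 + 1) - addRow (b - (a + 1) - 1) p (j + 1) ≤ b := by
    intro j _
    have := hle j
    simp only [addRow]
    omega
  constructor
  · rintro ⟨-, hF⟩
    refine ⟨hK, fun j hj => ?_⟩
    obtain _ | j := j
    · have h1 := hF 1 (by omega)
      rw [hx1, h5] at h1
      rw [hy0]
      omega
    · have h1 := hF (j + 1 + 1) (by omega)
      rw [hx j (by omega), h _ (hb j (by omega)).1 (hb j (by omega)).2] at h1
      omega
  · rintro ⟨-, hG⟩
    have h2 : 2 ≤ finrank ℂ (H ⊓ F.space 5 : Submodule ℂ A) := by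
      have := hG 0 (by omega)
      rw [hy0] at this
      omega
    refine ⟨hH, fun j hj => ?_⟩
    obtain _ | _ | j := j
    · have : 5 + b - (2 + (a + 1)) + (0 + 1) -
          addRow (b - (a + 1)) (addRow (b - (a + 1)) p) 0 = 4 := by
        simp only [addRow]
        omega
      rw [this]
      have := F.finrank_inf_le H (show 4 ≤ 5 by omega) (by omega)
      omega
    · rw [zero_add, hx1]
      exact h2
    · by_cases hja : j < a
      · rw [hx j hja, h _ (hb j hja).1 (hb j hja).2]
        have := hG (j + 1) (by omega)
        omega
      · have : j = a := by omega
        subst this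
        rw [F.space_eq_top _ (by simp only [addRow, hpa']; omega), inf_top_eq, hH]
        omega

/-- The first `a - 1` conditions live in `F.space m` with `m ≤ b`, where the dimensions for `H` and
`K` agree. The condition numbered `a`, at `b + 1`, follows from the previous one because the
intersection gains 1 there; the last two hold for dimension reasons. -/
theorem mem_schubertVariety_iff_of_rect_two (ha : 0 < a) (hab : a < b)
    (hp : IsPartitionFor a b (rect 1 (a - 1) + p)) (hanti : Antitone p) (hpa : p (a - 1) = 0)
    (hH : finrank ℂ H = 2 + a) (hK : finrank ℂ K = a)
    (h1 : finrank ℂ (H ⊓ F.space (b + 1) : Submodule ℂ A) =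
      1 + finrank ℂ (K ⊓ G.space (b - 2) : Submodule ℂ B))
    (h : ∀ i, i + 2 ≤ b → finrank ℂ (H ⊓ F.space (i + 2) : Submodule ℂ A) =
      finrank ℂ (K ⊓ G.space i : Submodule ℂ B)) :
    H ∈ schubertVariety (2 + a) (5 + b) (rect 2 a + p) F ↔
      K ∈ schubertVariety a b (rect 1 (a - 1) + p) G := by
  obtain ⟨a, rfl⟩ := Nat.exists_eq_succ_of_ne_zero ha.ne'
  simp only [Nat.succ_eq_add_one, Nat.add_sub_cancel] at *
  have hle : ∀ j < a, p j + 1 ≤ b - (a + 1) := by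
    intro j hj
    have h1 := hp.2.1
    have h2 := hanti (Nat.zero_le j)
    simp only [Pi.add_apply, rect, if_pos (show 0 < a by omega)] at h1
    omega
  have hp0 : ∀ j, a ≤ j → p j = 0 := fun j hj => Nat.le_zero.1 (hpa ▸ hanti hj)
  have hx : ∀ j < a, 5 + b - (2 + (a + 1)) + (j + 1) - (rect 2 (a + 1) + p) j =
      (b - (a + 1) + (j + 1) - (rect 1 a + p) j) + 2 := by
    intro j hj
    have := hle j hj
    simp only [Pi.add_apply, rect, if_pos hj, if_pos (show j < a + 1 by omega)]
    omega
  have hb : ∀ j < a, b - (a + 1) + (j + 1) - (rect 1 a + p) j + 2 ≤ b := by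
    intro j hj
    have := hle j hj
    simp only [Pi.add_apply, rect, if_pos hj]
    omega
  have hxa : 5 + b - (2 + (a + 1)) + (a + 1) - (rect 2 (a + 1) + p) a = b + 1 := by
    simp only [Pi.add_apply, rect, if_pos (show a < a + 1 by omega), hp0 a le_rfl]
    omega
  constructor
  · rintro ⟨-, hF⟩
    refine ⟨hK, fun j hj => ?_⟩
    by_cases hja : j < a
    · have h1 := hF j (by omega)
      rwa [hx j hja, h _ (hb j hja)] at h1
    · have : j = a := by omega
      subst this
      rw [G.space_eq_top _ (by
        simp only [Pi.add_apply, rect, if_neg (show ¬ j < j by omega), hp0 j le_rfl]; omega),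
        inf_top_eq, hK]
  · rintro ⟨-, hG⟩
    refine ⟨hH, fun j hj => ?_⟩
    by_cases hja : j < a
    · rw [hx j hja, h _ (hb j hja)]
      exact hG j (by omega)
    · obtain rfl | rfl | rfl : j = a ∨ j = a + 1 ∨ j = a + 2 := by omega
      · rw [hxa, h1]
        obtain _ | j := j
        · omega
        · have h2 := hG j (by omega)
          have h3 := finrank_mono (inf_le_inf_left K (G.mono
            (show b - (j + 1 + 1) + (j + 1) - (rect 1 (j + 1) + p) j ≤ b - 2 by
              have := hb j (by omega)
              omega)))
          omega
      · refine F.le_finrank_inf H ?_ ?_ <;>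
        · simp only [Pi.add_apply, rect, if_neg (show ¬ a + 1 < a + 1 by omega),
            hp0 (a + 1) (by omega)]
          omega
      · rw [F.space_eq_top _ (by
          simp only [Pi.add_apply, rect, if_neg (show ¬ a + 2 < a + 1 by omega),
            hp0 (a + 2) (by omega)]
          omega), inf_top_eq, hH]
        omega

/-- The new column shifts the first `a` conditions by two members of the flag and adds a condition
on `F.space (b + 3)`, which is `h3`. -/
theorem mem_schubertVariety_iff_of_rect_one (hab : a < b) (hp : IsPartitionFor a b p)
    (hH : finrank ℂ H = 2 + a) (hK : finrank ℂ K = a)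
    (h3 : a + 1 ≤ finrank ℂ (H ⊓ F.space (b + 3) : Submodule ℂ A))
    (h : ∀ i ≤ b, finrank ℂ (H ⊓ F.space (i + 2) : Submodule ℂ A) =
      finrank ℂ (K ⊓ G.space i : Submodule ℂ B)) :
    H ∈ schubertVariety (2 + a) (5 + b) (rect 1 (a + 1) + p) F ↔
      K ∈ schubertVariety a b p G := by
  obtain ⟨hanti, h0, hpa⟩ := hp
  have hle : ∀ j, p j ≤ b - a := fun j => (hanti (Nat.zero_le j)).trans h0
  have hp0 : ∀ j, a ≤ j → p j = 0 := fun j hj => Nat.le_zero.1 (hpa ▸ hanti hj)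
  have hx : ∀ j < a, 5 + b - (2 + a) + (j + 1) - (rect 1 (a + 1) + p) j =
      (b - a + (j + 1) - p j) + 2 := by
    intro j hj
    have := hle j
    simp only [Pi.add_apply, rect, if_pos (show j < a + 1 by omega)]
    omega
  constructor
  · rintro ⟨-, hF⟩
    refine ⟨hK, fun j hj => ?_⟩
    have h1 := hF j (by omega)
    rwa [hx j hj, h _ (by omega)] at h1
  · rintro ⟨-, hG⟩
    refine ⟨hH, fun j hj => ?_⟩
    by_cases hja : j < a
    · rw [hx j hja, h _ (by omega)]
      exact hG j hja
    · obtain rfl | rfl : j = a ∨ j = a + 1 := by omega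
      · have : 5 + b - (2 + j) + (j + 1) - (rect 1 (j + 1) + p) j = b + 3 := by
          simp only [Pi.add_apply, rect, if_pos (show j < j + 1 by omega), hp0 j le_rfl]
          omega
        rwa [this]
      · rw [F.space_eq_top _ (by
          simp only [Pi.add_apply, rect, if_neg (show ¬ a + 1 < a + 1 by omega),
            hp0 (a + 1) (by omega)]
          omega), inf_top_eq, hH]
        omega

theorem mem_schubertVariety_iff_of_same (hab : a < b) (hp : IsPartitionFor a b p)
    (hH : finrank ℂ H = 2 + a) (hK : finrank ℂ K = a)
    (h : ∀ i ≤ b, finrank ℂ (H ⊓ F.space (i + 3) : Submodule ℂ A) =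
      finrank ℂ (K ⊓ G.space i : Submodule ℂ B)) :
    H ∈ schubertVariety (2 + a) (5 + b) p F ↔ K ∈ schubertVariety a b p G := by
  obtain ⟨hanti, h0, hpa⟩ := hp
  have hle : ∀ j, p j ≤ b - a := fun j => (hanti (Nat.zero_le j)).trans h0
  have hp0 : ∀ j, a ≤ j → p j = 0 := fun j hj => Nat.le_zero.1 (hpa ▸ hanti hj)
  have hx : ∀ j < a, 5 + b - (2 + a) + (j + 1) - p j = (b - a + (j + 1) - p j) + 3 := by
    intro j hj
    have := hle j
    omega
  constructor
  · rintro ⟨-, hF⟩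
    refine ⟨hK, fun j hj => ?_⟩
    have h1 := hF j (by omega)
    rwa [hx j hj, h _ (by omega)] at h1
  · rintro ⟨-, hG⟩
    refine ⟨hH, fun j hj => ?_⟩
    by_cases hja : j < a
    · rw [hx j hja, h _ (by omega)]
      exact hG j hja
    · obtain rfl | rfl : j = a ∨ j = a + 1 := by omega
      · refine F.le_finrank_inf H ?_ ?_ <;>
        · rw [hp0 j le_rfl]
          omega
      · rw [F.space_eq_top _ (by rw [hp0 (a + 1) (by omega)]; omega), inf_top_eq, hH]
        omega

end Conditions

/-! ### Instances in general position and their fibrations -/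

/-- The Schubert problem `((2), (1), (1), (1), (1))`. -/
abbrev baseProblem : Fin 5 → ℕ → ℕ := ![rect 2 1, rect 1 1, rect 1 1, rect 1 1, rect 1 1]

/-- The fiber of the fibration. -/
abbrev fiberProblem (a b : ℕ) {r : ℕ} (ν₁ κ ρ ν₄ ν₅ : ℕ → ℕ) (τ : Fin r → ℕ → ℕ) :
    Fin (5 + r) → ℕ → ℕ :=
  Fin.append ![ν₁, addRow (b - a - 1) κ, rect 1 (a - 1) + ρ, ν₄, ν₅] τ

/-- The total problem of the fibration. -/
abbrev totalProblem (a b : ℕ) {r : ℕ} (ν₁ κ ρ ν₄ ν₅ : ℕ → ℕ) (τ : Fin r → ℕ → ℕ) :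
    Fin (5 + r) → ℕ → ℕ :=
  Fin.append ![addRow (b - a + 2) ν₁, addRow (b - a) (addRow (b - a) κ), rect 2 a + ρ,
    rect 1 (a + 1) + ν₄, rect 1 (a + 1) + ν₅] τ

theorem forall_fin_five_add {r : ℕ} {p : Fin (5 + r) → Prop} :
    (∀ i, p i) ↔ (p (Fin.castAdd r 0) ∧ p (Fin.castAdd r 1) ∧ p (Fin.castAdd r 2) ∧
      p (Fin.castAdd r 3) ∧ p (Fin.castAdd r 4)) ∧ ∀ i, p (Fin.natAdd 5 i) := by
  constructor
  · exact fun h => ⟨⟨h _, h _, h _, h _, h _⟩, fun i => h _⟩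
  · rintro ⟨⟨h0, h1, h2, h3, h4⟩, h⟩ i
    induction i using Fin.addCases with
    | left i => fin_cases i <;> assumption
    | right i => exact h i

section Instances

set_option linter.unusedSectionVars false

variable {A : Type*} [AddCommGroup A] [Module ℂ A]

/-- The first five flags. -/
def firstFive {n r : ℕ} (F : Fin (5 + r) → CompleteFlag n A) : Fin 5 → CompleteFlag n A :=
  fun i => F (Fin.castAdd r i)

/-- `x` and `t` span a plane meeting the subspaces of dimensions `2`, `m`, `j + 1`, `l + 1` and
`l + 1` in five flags. -/
abbrev IsPairOf {n : ℕ} (m j l : ℕ) (F : Fin 5 → CompleteFlag n A) (x t : A) : Prop :=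
  IsPair ((F 0).space 2) ((F 1).space m) ((F 2).space (j + 1)) ((F 3).space (l + 1))
    ((F 4).space (l + 1)) x t

/-- The space `Z` for an instance of the total problem. -/
abbrev fiberSpaceOf {b : ℕ} (F : Fin 5 → CompleteFlag (5 + b) A) (h : Submodule ℂ A) :
    Submodule ℂ A :=
  fiberSpace ((F 1).space 5) ((F 2).space (b + 1)) ((F 3).space (b + 2 + 1))
    ((F 4).space (b + 2 + 1)) h

abbrev AvoidsOf {b : ℕ} (F : Fin 5 → CompleteFlag (5 + b) A) (Y : Submodule ℂ A) (x t : A) :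
    Prop :=
  Avoids ((F 1).space 5) ((F 2).space (b + 1)) ((F 3).space (b + 2 + 1))
    ((F 4).space (b + 2 + 1)) Y x t

/-- Instances of the total problem in general position. -/
structure GoodInstance {b r : ℕ} (F : Fin (5 + r) → CompleteFlag (5 + b) A) : Prop where
  generic : Generic 5 b (b + 2) (firstFive F)
  -- These conditions bound intersections of `Z` with flag members. A bound by `k > 0` is expressed
  -- as avoiding the intersection with a further space of codimension `k`, borrowed from the third
  -- flag (`k = 2`, then `k = 3`). A bound by 0 needs no second space, so the same one is repeated.
  avoids₀ : ∀ x t, IsPairOf 5 b (b + 2) (firstFive F) x t →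
    AvoidsOf (firstFive F) ((firstFive F 0).space 5 ⊓ (firstFive F 2).space (b + 3)) x t
  avoids₁ : ∀ x t, IsPairOf 5 b (b + 2) (firstFive F) x t →
    AvoidsOf (firstFive F) ((firstFive F 1).space 6 ⊓ (firstFive F 2).space (b + 2)) x t
  avoids₂ : ∀ x t, IsPairOf 5 b (b + 2) (firstFive F) x t →
    AvoidsOf (firstFive F) ((firstFive F 2).space 2 ⊓ (firstFive F 2).space 2) x t
  avoids₃ : ∀ x t, IsPairOf 5 b (b + 2) (firstFive F) x t →
    AvoidsOf (firstFive F) ((firstFive F 3).space 2 ⊓ (firstFive F 3).space 2) x t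
  avoids₄ : ∀ x t, IsPairOf 5 b (b + 2) (firstFive F) x t →
    AvoidsOf (firstFive F) ((firstFive F 4).space 2 ⊓ (firstFive F 4).space 2) x t
  not_dep : ∀ i : Fin r, ∀ x t, IsPairOf 5 b (b + 2) (firstFive F) x t →
    ¬ Dep ((F (Fin.natAdd 5 i)).space (b + 3)) x t
  avoids : ∀ i : Fin r, ∀ x t, IsPairOf 5 b (b + 2) (firstFive F) x t →
    AvoidsOf (firstFive F)
      ((F (Fin.natAdd 5 i)).space 3 ⊓ (F (Fin.natAdd 5 i)).space 3) x t

variable [FiniteDimensional ℂ A] {b r : ℕ} {F : Fin (5 + r) → CompleteFlag (5 + b) A} {x t : A}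

theorem GoodInstance.position (hF : GoodInstance F)
    (hp : IsPairOf 5 b (b + 2) (firstFive F) x t) :
    PairPosition b ((firstFive F 0).space 2) ((firstFive F 1).space 5)
      ((firstFive F 2).space (b + 1)) ((firstFive F 3).space (b + 2 + 1))
      ((firstFive F 4).space (b + 2 + 1)) ((firstFive F 3).space (b + 2))
      ((firstFive F 4).space (b + 2)) ((firstFive F 2).space (b + 4))
      ((firstFive F 1).space (b + 4)) x t := by
  obtain ⟨-, h1, h2, -, h3, h4⟩ := hF.generic.pair x t hp
  exact ⟨(firstFive F 0).finrank_eq, (firstFive F 0).finrank_space _ (by omega),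
    (firstFive F 1).finrank_space _ (by omega), (firstFive F 2).finrank_space _ (by omega),
    (firstFive F 3).finrank_space _ (by omega), (firstFive F 4).finrank_space _ (by omega),
    (firstFive F 3).finrank_space _ (by omega), (firstFive F 4).finrank_space _ (by omega),
    (firstFive F 2).finrank_space _ (by omega), (firstFive F 1).finrank_space _ (by omega),
    hF.generic.LM, hF.generic.LT, hF.generic.indepM, hp,
    (firstFive F 3).mono (by omega), (firstFive F 4).mono (by omega),
    (firstFive F 2).mono (by omega), h3, h4, h1, h2⟩

theorem finrank_span_inf_eq_one {S : Submodule ℂ A} (h : finrank ℂ (span ℂ {x, t}) = 2)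
    (ht : t ∉ S) {z : A} (hz : z ∈ span ℂ {x, t}) (h0 : z ≠ 0) (hzS : z ∈ S) :
    finrank ℂ (span ℂ {x, t} ⊓ S : Submodule ℂ A) = 1 := by
  refine le_antisymm ?_ (one_le_finrank_of_mem (z := z) ⟨hz, hzS⟩ h0)
  by_contra hcon
  have : span ℂ {x, t} ⊓ S = span ℂ {x, t} := eq_of_le_of_finrank_le inf_le_left (by omega)
  exact ht ((inf_eq_left.1 this) right_mem_span_pair)

theorem finrank_span_inf_eq_zero {S : Submodule ℂ A} (h : ¬ Dep S x t) :
    finrank ℂ (span ℂ {x, t} ⊓ S : Submodule ℂ A) = 0 := by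
  by_contra hcon
  obtain ⟨z, ⟨hz, hzS⟩, hz0⟩ := exists_ne_zero_of_one_le (Nat.one_le_iff_ne_zero.2 hcon)
  exact h (dep_of_mem hz hz0 hzS)

/-- The dimensions of the intersections of the flags with the plane `h` spanned by a pair and with
its space `Z`. -/
structure FlagDimensions (F : Fin (5 + r) → CompleteFlag (5 + b) A) (h Z : Submodule ℂ A) :
    Prop where
  h₀ : ∀ m, 2 ≤ m → m ≤ b + 4 → finrank ℂ (h ⊓ (firstFive F 0).space m : Submodule ℂ A) = 1
  h₁ : ∀ m, 5 ≤ m → m ≤ b + 4 → finrank ℂ (h ⊓ (firstFive F 1).space m : Submodule ℂ A) = 1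
  h₂ : ∀ m ≤ b, finrank ℂ (h ⊓ (firstFive F 2).space m : Submodule ℂ A) = 0
  h₂' : finrank ℂ (h ⊓ (firstFive F 2).space (b + 1) : Submodule ℂ A) = 1
  h₃ : ∀ m ≤ b + 2, finrank ℂ (h ⊓ (firstFive F 3).space m : Submodule ℂ A) = 0
  h₄ : ∀ m ≤ b + 2, finrank ℂ (h ⊓ (firstFive F 4).space m : Submodule ℂ A) = 0
  h₅ : ∀ i, ∀ m ≤ b + 3, finrank ℂ (h ⊓ (F (Fin.natAdd 5 i)).space m : Submodule ℂ A) = 0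
  Z₀ : ∀ m, 5 ≤ m → m ≤ b + 5 →
    finrank ℂ (Z ⊓ (firstFive F 0).space m : Submodule ℂ A) + 5 = 2 + m
  Z₁ : ∀ m, 6 ≤ m → m ≤ b + 5 →
    finrank ℂ (Z ⊓ (firstFive F 1).space m : Submodule ℂ A) + 6 = 3 + m
  Z₁' : 3 ≤ finrank ℂ (Z ⊓ (firstFive F 1).space 5 : Submodule ℂ A)
  Z₂ : ∀ m, 2 ≤ m → m ≤ b + 1 →
    finrank ℂ (Z ⊓ (firstFive F 2).space m : Submodule ℂ A) + 2 = 0 + m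
  Z₃ : ∀ m, 2 ≤ m → m ≤ b + 3 →
    finrank ℂ (Z ⊓ (firstFive F 3).space m : Submodule ℂ A) + 2 = 0 + m
  Z₄ : ∀ m, 2 ≤ m → m ≤ b + 3 →
    finrank ℂ (Z ⊓ (firstFive F 4).space m : Submodule ℂ A) + 2 = 0 + m
  Z₅ : ∀ i, ∀ m, 3 ≤ m → m ≤ b + 5 →
    finrank ℂ (Z ⊓ (F (Fin.natAdd 5 i)).space m : Submodule ℂ A) + 3 = 0 + m

theorem GoodInstance.flagDimensions (hF : GoodInstance F)
    (hp : IsPairOf 5 b (b + 2) (firstFive F) x t) :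
    FlagDimensions F (span ℂ {x, t}) (fiberSpaceOf (firstFive F) (span ℂ {x, t})) := by
  have pos := hF.position hp
  obtain ⟨g0, g1, g2, g3, g4, g5⟩ := hF.generic.pair x t hp
  have hfr := pos.finrank_span
  obtain ⟨c, d, hcd, hq⟩ := hp.depM
  have hqmem : c • x + d • t ∈ span ℂ {x, t} :=
    add_mem (smul_mem _ _ left_mem_span_pair) (smul_mem _ _ right_mem_span_pair)
  have hq0 : c • x + d • t ≠ 0 := fun h => by
    obtain ⟨hc, hd⟩ := hp.coeff_eq_zero hF.generic.LT h
    simp [hc, hd] at hcd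
  -- The vector of the plane in `M` presents `t` as an element of `L + M`, and `t` is aligned with
  -- its own pair; in this hyperplane it would contradict isolation.
  have ht1 : t ∉ (firstFive F 1).space (b + 4) := by
    intro ht
    have hd : d ≠ 0 := by
      rintro rfl
      rw [zero_smul, add_zero] at hq
      have := hF.generic.LM _ (smul_mem _ c hp.left_mem) hq
      simp_all
    have e : (-(d⁻¹ * c)) • x + d⁻¹ • (c • x + d • t) = t := by
      rw [smul_add, smul_smul d⁻¹ d, inv_mul_cancel₀ hd]
      module
    obtain ⟨e1, e2⟩ := g2 _ (smul_mem _ (-(d⁻¹ * c)) hp.left_mem) _ (smul_mem _ d⁻¹ hq)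
      (by rw [e]; exact hp.right_mem) (by rw [e]; exact ht)
      (by rw [e]; exact pos.aligned_iff.2 ⟨mem_sup_right right_mem_span_pair,
        mem_sup_right right_mem_span_pair⟩)
    rw [e1, e2, add_zero] at e
    exact hp.right_ne e.symm
  have htop : ∀ (G : CompleteFlag (5 + b) A),
      finrank ℂ (fiberSpaceOf (firstFive F) (span ℂ {x, t}) ⊓ G.space (5 + b) :
        Submodule ℂ A) = b + 2 := fun G => by
    rw [G.space_eq_top _ le_rfl, inf_top_eq]
    exact pos.finrank_fiberSpace
  have hT : b ≤ finrank ℂ (fiberSpaceOf (firstFive F) (span ℂ {x, t}) ⊓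
      (firstFive F 2).space (b + 1) : Submodule ℂ A) + 1 := pos.finrank_fiberSpace_inf_T
  have hP : b + 1 ≤ finrank ℂ (fiberSpaceOf (firstFive F) (span ℂ {x, t}) ⊓
      (firstFive F 3).space (b + 3) : Submodule ℂ A) := pos.finrank_fiberSpace_inf_P
  have hQ : b + 1 ≤ finrank ℂ (fiberSpaceOf (firstFive F) (span ℂ {x, t}) ⊓
      (firstFive F 4).space (b + 3) : Submodule ℂ A) := pos.finrank_fiberSpace_inf_Q
  have zero : ∀ (G : CompleteFlag (5 + b) A) (l m : ℕ), m ≤ l → ¬ Dep (G.space l) x t →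
      finrank ℂ (span ℂ {x, t} ⊓ G.space m : Submodule ℂ A) = 0 := fun G l m hml hd =>
    finrank_span_inf_eq_zero fun ⟨c, d, h0, h⟩ => hd ⟨c, d, h0, G.mono hml h⟩
  have bot : ∀ {Y : Submodule ℂ A}, AvoidsOf (firstFive F) (Y ⊓ Y) x t →
      finrank ℂ (fiberSpaceOf (firstFive F) (span ℂ {x, t}) ⊓ Y : Submodule ℂ A) ≤ 0 := by
    intro Y hY
    rw [inf_idem] at hY
    have : fiberSpaceOf (firstFive F) (span ℂ {x, t}) ⊓ Y = ⊥ := pos.fiberSpace_inf_eq_bot hY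
    rw [this, finrank_bot]
  have small : ∀ {Y Y' : Submodule ℂ A} {k : ℕ}, AvoidsOf (firstFive F) (Y ⊓ Y') x t →
      finrank ℂ Y' + k = 5 + b →
      finrank ℂ (fiberSpaceOf (firstFive F) (span ℂ {x, t}) ⊓ Y : Submodule ℂ A) ≤ k := by
    intro Y Y' k hY hk
    have h1 := finrank_add_le (fiberSpaceOf (firstFive F) (span ℂ {x, t}) ⊓ Y) Y'
    have h2 : fiberSpaceOf (firstFive F) (span ℂ {x, t}) ⊓ (Y ⊓ Y') = ⊥ :=
      pos.fiberSpace_inf_eq_bot hY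
    rw [inf_assoc, h2, finrank_bot, pos.finrank_A] at h1
    omega
  constructor
  · intro m h1 h2
    exact finrank_span_inf_eq_one hfr (fun h => g0 ((firstFive F 0).mono h2 h))
      left_mem_span_pair hp.left_ne ((firstFive F 0).mono h1 hp.left_mem)
  · intro m h1 h2
    exact finrank_span_inf_eq_one hfr (fun h => ht1 ((firstFive F 1).mono h2 h))
      hqmem hq0 ((firstFive F 1).mono h1 hq)
  · intro m hm
    by_contra hcon
    obtain ⟨z, ⟨hz, hzS⟩, hz0⟩ := exists_ne_zero_of_one_le (Nat.one_le_iff_ne_zero.2 hcon)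
    obtain ⟨α, β, rfl⟩ := mem_span_pair.1 hz
    have hzT := (firstFive F 2).mono (show m ≤ b + 1 by omega) hzS
    have hαx : α • x ∈ (firstFive F 2).space (b + 1) := by
      have := sub_mem hzT (smul_mem _ β hp.right_mem)
      rwa [add_sub_cancel_right] at this
    have hα := hF.generic.LT _ (smul_mem _ α hp.left_mem) hαx
    rw [hα, zero_add] at hzS hz0
    have hβ : β ≠ 0 := fun h => hz0 (by rw [h, zero_smul])
    exact g3 ((firstFive F 2).mono hm ((smul_mem_iff _ hβ).1 hzS))
  · refine le_antisymm ?_ (one_le_finrank_of_mem ⟨right_mem_span_pair, hp.right_mem⟩ hp.right_ne)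
    by_contra hcon
    have : span ℂ {x, t} ⊓ (firstFive F 2).space (b + 1) = span ℂ {x, t} :=
      eq_of_le_of_finrank_le inf_le_left (by omega)
    exact hp.left_ne (hF.generic.LT x hp.left_mem ((inf_eq_left.1 this) left_mem_span_pair))
  · exact fun m hm => zero _ _ m hm g4
  · exact fun m hm => zero _ _ m hm g5
  · exact fun i m hm => zero _ _ m hm (hF.not_dep i x t hp)
  · intro m h1 h2
    refine (firstFive F 0).finrank_inf_eq (m₁ := 5 + b) (small (hF.avoids₀ x t hp) ?_) ?_ le_rfl
      h1 (by omega)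
    · rw [CompleteFlag.finrank_space _ _ (by omega)]
      omega
    · rw [htop]
      omega
  · intro m h1 h2
    refine (firstFive F 1).finrank_inf_eq (m₁ := 5 + b) (small (hF.avoids₁ x t hp) ?_) ?_ le_rfl
      h1 (by omega)
    · rw [CompleteFlag.finrank_space _ _ (by omega)]
      omega
    · rw [htop]
      omega
  · exact pos.finrank_fiberSpace_inf_M
  · intro m h1 h2
    exact (firstFive F 2).finrank_inf_eq (m₁ := b + 1) (bot (hF.avoids₂ x t hp)) (by omega)
      (by omega) h1 h2
  · intro m h1 h2
    exact (firstFive F 3).finrank_inf_eq (m₁ := b + 3) (bot (hF.avoids₃ x t hp)) (by omega)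
      (by omega) h1 h2
  · intro m h1 h2
    exact (firstFive F 4).finrank_inf_eq (m₁ := b + 3) (bot (hF.avoids₄ x t hp)) (by omega)
      (by omega) h1 h2
  · intro i m h1 h2
    exact CompleteFlag.finrank_inf_eq _ (m₁ := 5 + b) (bot (hF.avoids i x t hp))
      (by rw [htop]; omega) le_rfl h1 (by omega)

end Instances

/-! ### Fibration data obtained by intersection with `V` and projection of `Z` -/

section Compatibility

set_option linter.unusedSectionVars false

variable {A : Type*} [AddCommGroup A] [Module ℂ A] [FiniteDimensional ℂ A]

theorem mem_solutions_baseProblem {W : Type*} [AddCommGroup W] [Module ℂ W]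
    {E : Fin 5 → CompleteFlag 5 W} {h : Submodule ℂ W} :
    h ∈ solutions 2 5 baseProblem E ↔ finrank ℂ h = 2 ∧
      1 ≤ finrank ℂ (h ⊓ (E 0).space 2 : Submodule ℂ W) ∧
      1 ≤ finrank ℂ (h ⊓ (E 1).space 3 : Submodule ℂ W) ∧
      1 ≤ finrank ℂ (h ⊓ (E 2).space 3 : Submodule ℂ W) ∧
      1 ≤ finrank ℂ (h ⊓ (E 3).space 3 : Submodule ℂ W) ∧
      1 ≤ finrank ℂ (h ⊓ (E 4).space 3 : Submodule ℂ W) := by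
  have key : ∀ {p : ℕ → ℕ} {G : CompleteFlag 5 W}, p 1 = 0 → finrank ℂ h = 2 →
      (h ∈ schubertVariety 2 5 p G ↔
        1 ≤ finrank ℂ (h ⊓ G.space (4 - p 0) : Submodule ℂ W)) := by
    intro p G hp hh
    refine ⟨fun H => H.2 0 (by omega), fun H => ⟨hh, fun j hj => ?_⟩⟩
    interval_cases j
    · exact H
    · rw [hp, G.space_eq_top _ (by omega), inf_top_eq, hh]
  have key' : ∀ i, (baseProblem i) 1 = 0 := by
    intro i
    fin_cases i <;> rfl
  simp only [solutions, Set.mem_ofPred_eq]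
  refine and_congr_right fun hh => ?_
  simp only [key (key' _) hh]
  constructor
  · exact fun H => ⟨H 0, H 1, H 2, H 3, H 4⟩
  · rintro ⟨h0, h1, h2, h3, h4⟩ i
    fin_cases i <;> assumption

variable {b r : ℕ} {F : Fin (5 + r) → CompleteFlag (5 + b) A}

/-- The fibration data `D` are obtained from the instance `F` by intersection with the space `V`
and by projection of the intersection with the spaces `Z`. -/
structure Compatible (F : Fin (5 + r) → CompleteFlag (5 + b) A)
    (D : FibrationData A 5 b 5 (5 + r)) : Prop where
  V_eq : D.V = baseSpace ((firstFive F 0).space 2) ((firstFive F 1).space 5)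
    ((firstFive F 2).space (b + 1))
  -- Only those members of the flags `E` and `G` are prescribed on which the Schubert conditions of
  -- the base and of the fiber depend; the others may be filled in arbitrarily.
  E₀ : (D.E 0).space 2 = ((firstFive F 0).space 2).comap D.V.subtype
  E₁ : (D.E 1).space 3 = ((firstFive F 1).space 5).comap D.V.subtype
  E₂ : (D.E 2).space 3 = ((firstFive F 2).space (b + 1)).comap D.V.subtype
  E₃ : (D.E 3).space 3 = ((firstFive F 3).space (b + 3)).comap D.V.subtype
  E₄ : (D.E 4).space 3 = ((firstFive F 4).space (b + 3)).comap D.V.subtype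
  G₀ : ∀ h ∈ solutions 2 5 baseProblem D.E, ∀ i, 1 ≤ i → i ≤ b →
    (D.G h (Fin.castAdd r 0)).space i = (fiberSpaceOf (firstFive F) (h.map D.V.subtype) ⊓
      (firstFive F 0).space (i + 4)).map D.V.mkQ
  G₁ : ∀ h ∈ solutions 2 5 baseProblem D.E, ∀ i, 2 ≤ i → i ≤ b →
    (D.G h (Fin.castAdd r 1)).space i = (fiberSpaceOf (firstFive F) (h.map D.V.subtype) ⊓
      (firstFive F 1).space (i + 4)).map D.V.mkQ
  G₂ : ∀ h ∈ solutions 2 5 baseProblem D.E, ∀ i, i + 2 ≤ b →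
    (D.G h (Fin.castAdd r 2)).space i = (fiberSpaceOf (firstFive F) (h.map D.V.subtype) ⊓
      (firstFive F 2).space (i + 2)).map D.V.mkQ
  G₃ : ∀ h ∈ solutions 2 5 baseProblem D.E, ∀ i ≤ b,
    (D.G h (Fin.castAdd r 3)).space i = (fiberSpaceOf (firstFive F) (h.map D.V.subtype) ⊓
      (firstFive F 3).space (i + 2)).map D.V.mkQ
  G₄ : ∀ h ∈ solutions 2 5 baseProblem D.E, ∀ i ≤ b,
    (D.G h (Fin.castAdd r 4)).space i = (fiberSpaceOf (firstFive F) (h.map D.V.subtype) ⊓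
      (firstFive F 4).space (i + 2)).map D.V.mkQ
  G₅ : ∀ h ∈ solutions 2 5 baseProblem D.E, ∀ j, ∀ i ≤ b,
    (D.G h (Fin.natAdd 5 j)).space i = (fiberSpaceOf (firstFive F) (h.map D.V.subtype) ⊓
      (F (Fin.natAdd 5 j)).space (i + 3)).map D.V.mkQ

theorem finrank_map_inf_mkQ {V Z h : Submodule ℂ A} (hZ : Z ⊓ V = h) (S : Submodule ℂ A) :
    finrank ℂ ((Z ⊓ S).map V.mkQ) + finrank ℂ (h ⊓ S : Submodule ℂ A) =
      finrank ℂ (Z ⊓ S : Submodule ℂ A) := by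
  rw [← finrank_map_mkQ V (Z ⊓ S), ← hZ, inf_right_comm]

theorem finrank_comap_subtype (V X : Submodule ℂ A) :
    finrank ℂ (X.comap V.subtype) = finrank ℂ (V ⊓ X : Submodule ℂ A) := by
  have := finrank_inf_comap_subtype (⊤ : Submodule ℂ V) X
  rwa [top_inf_eq, Submodule.map_top, range_subtype] at this

/-- What is needed to solve the instance `F` over a solution `h` of the instance of the base
problem. -/
structure OverSolution (F : Fin (5 + r) → CompleteFlag (5 + b) A) (V h Z : Submodule ℂ A) : Prop
    extends FlagDimensions F h Z where
  finrank_h : finrank ℂ h = 2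
  inf_eq : Z ⊓ V = h
  sup_eq : Z ⊔ V = ⊤

theorem GoodInstance.exists_isPairOf (hF : GoodInstance F)
    {V : Submodule ℂ A} {E : Fin 5 → CompleteFlag 5 V}
    (E₀ : (E 0).space 2 = ((firstFive F 0).space 2).comap V.subtype)
    (E₁ : (E 1).space 3 = ((firstFive F 1).space 5).comap V.subtype)
    (E₂ : (E 2).space 3 = ((firstFive F 2).space (b + 1)).comap V.subtype)
    (E₃ : (E 3).space 3 = ((firstFive F 3).space (b + 3)).comap V.subtype)
    (E₄ : (E 4).space 3 = ((firstFive F 4).space (b + 3)).comap V.subtype)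
    {h : Submodule ℂ V} (hh : h ∈ solutions 2 5 baseProblem E) :
    ∃ x t, IsPairOf 5 b (b + 2) (firstFive F) x t ∧ h.map V.subtype = span ℂ {x, t} := by
  rw [mem_solutions_baseProblem, E₀, E₁, E₂, E₃, E₄] at hh
  simp only [finrank_inf_comap_subtype] at hh
  obtain ⟨h0, h1, h2, h3, h4, h5⟩ := hh
  exact exists_isPair hF.generic.LT ((finrank_map_subtype_eq _ _).trans h0) h1 h2 h3 h4 h5

theorem GoodInstance.overSolution (hF : GoodInstance F) {V : Submodule ℂ A}
    (hV : V = baseSpace ((firstFive F 0).space 2) ((firstFive F 1).space 5)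
      ((firstFive F 2).space (b + 1))) {E : Fin 5 → CompleteFlag 5 V}
    (E₀ : (E 0).space 2 = ((firstFive F 0).space 2).comap V.subtype)
    (E₁ : (E 1).space 3 = ((firstFive F 1).space 5).comap V.subtype)
    (E₂ : (E 2).space 3 = ((firstFive F 2).space (b + 1)).comap V.subtype)
    (E₃ : (E 3).space 3 = ((firstFive F 3).space (b + 3)).comap V.subtype)
    (E₄ : (E 4).space 3 = ((firstFive F 4).space (b + 3)).comap V.subtype)
    {h : Submodule ℂ V} (hh : h ∈ solutions 2 5 baseProblem E) :
    OverSolution F V (h.map V.subtype) (fiberSpaceOf (firstFive F) (h.map V.subtype)) := by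
  obtain ⟨x, t, hp, e⟩ := hF.exists_isPairOf E₀ E₁ E₂ E₃ E₄ hh
  have pos := hF.position hp
  rw [e]
  exact ⟨hF.flagDimensions hp, pos.finrank_span, by rw [hV]; exact pos.fiberSpace_inf,
    by rw [hV]; exact pos.fiberSpace_sup⟩

theorem nonempty_completeFlag {W : Type*} [AddCommGroup W] [Module ℂ W] [FiniteDimensional ℂ W]
    {n : ℕ} (hW : finrank ℂ W = n) : Nonempty (CompleteFlag n W) :=
  let ⟨G, _⟩ := exists_completeFlag hW le_rfl (Nat.zero_le n) (fun _ => (⊥ : Submodule ℂ W))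
    (fun _ _ _ => le_rfl) (fun i _ hi => by rw [finrank_bot]; omega)
  ⟨G⟩

theorem exists_completeFlag_space_eq {W : Type*} [AddCommGroup W] [Module ℂ W]
    [FiniteDimensional ℂ W] {n d : ℕ} (hW : finrank ℂ W = n) (hd : d ≤ n) {X : Submodule ℂ W}
    (hX : finrank ℂ X = d) : ∃ G : CompleteFlag n W, G.space d = X :=
  let ⟨G, hG⟩ := exists_completeFlag hW le_rfl hd (fun _ => X) (fun _ _ _ => le_rfl)
    (fun i h1 h2 => by rw [hX]; omega)
  ⟨G, hG d le_rfl le_rfl⟩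

/-- The image of `Z ∩ S` has dimension `dim (Z ∩ S) - dim (h ∩ S)`, and the indices are shifted so
that this is exactly `i`. The images thus form a segment of a flag, which can be completed. -/
theorem GoodInstance.exists_compatible (hb : 2 ≤ b) (hF : GoodInstance F) :
    ∃ D : FibrationData A 5 b 5 (5 + r), Compatible F D := by
  obtain ⟨d1, d2, d3, d4, -⟩ := finrank_baseSpace (firstFive F 0).finrank_eq
    ((firstFive F 0).finrank_space 2 (by omega))
    (by rw [(firstFive F 1).finrank_space 5 (by omega),
      (firstFive F 2).finrank_space (b + 1) (by omega)]; omega)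
    ((firstFive F 3).finrank_space (b + 3) (by omega))
    ((firstFive F 4).finrank_space (b + 3) (by omega)) hF.generic.LM hF.generic.LT
    hF.generic.indepM
  obtain ⟨-, d2', -⟩ := finrank_baseSpace (firstFive F 0).finrank_eq
    ((firstFive F 0).finrank_space 2 (by omega))
    (by rw [(firstFive F 1).finrank_space 5 (by omega),
      (firstFive F 2).finrank_space (b + 1) (by omega)])
    ((firstFive F 3).finrank_space (b + 3) (by omega))
    ((firstFive F 4).finrank_space (b + 3) (by omega)) hF.generic.LT hF.generic.LM
    hF.generic.indepT
  rw [baseSpace_swap] at d2'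
  generalize hV : baseSpace ((firstFive F 0).space 2) ((firstFive F 1).space 5)
    ((firstFive F 2).space (b + 1)) = V at d1 d2 d3 d4 d2'
  have hLV : V ⊓ (firstFive F 0).space 2 = (firstFive F 0).space 2 :=
    inf_eq_right.2 (hV ▸ le_inf le_sup_left le_sup_left)
  obtain ⟨E0, h0⟩ := exists_completeFlag_space_eq (d := 2) d1 (by omega)
    (X := ((firstFive F 0).space 2).comap V.subtype)
    (by rw [finrank_comap_subtype, hLV, CompleteFlag.finrank_space _ _ (by omega)])
  obtain ⟨E1, h1⟩ := exists_completeFlag_space_eq (d := 3) d1 (by omega)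
    (X := ((firstFive F 1).space 5).comap V.subtype) (by rw [finrank_comap_subtype, d2])
  obtain ⟨E2, h2⟩ := exists_completeFlag_space_eq (d := 3) d1 (by omega)
    (X := ((firstFive F 2).space (b + 1)).comap V.subtype) (by rw [finrank_comap_subtype, d2'])
  obtain ⟨E3, h3⟩ := exists_completeFlag_space_eq (d := 3) d1 (by omega)
    (X := ((firstFive F 3).space (b + 3)).comap V.subtype) (by rw [finrank_comap_subtype, d3])
  obtain ⟨E4, h4⟩ := exists_completeFlag_space_eq (d := 3) d1 (by omega)
    (X := ((firstFive F 4).space (b + 3)).comap V.subtype) (by rw [finrank_comap_subtype, d4])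
  have hQ : finrank ℂ (A ⧸ V) = b := by
    have := finrank_quotient_add_finrank V
    rw [(firstFive F 0).finrank_eq] at this
    omega
  have hG : ∀ h : Submodule ℂ V, ∃ G : Fin (5 + r) → CompleteFlag b (A ⧸ V),
      h ∈ solutions 2 5 baseProblem ![E0, E1, E2, E3, E4] →
      (∀ i, 1 ≤ i → i ≤ b → (G (Fin.castAdd r 0)).space i =
        (fiberSpaceOf (firstFive F) (h.map V.subtype) ⊓
          (firstFive F 0).space (i + 4)).map V.mkQ) ∧
      (∀ i, 2 ≤ i → i ≤ b → (G (Fin.castAdd r 1)).space i =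
        (fiberSpaceOf (firstFive F) (h.map V.subtype) ⊓
          (firstFive F 1).space (i + 4)).map V.mkQ) ∧
      (∀ i, i + 2 ≤ b → (G (Fin.castAdd r 2)).space i =
        (fiberSpaceOf (firstFive F) (h.map V.subtype) ⊓
          (firstFive F 2).space (i + 2)).map V.mkQ) ∧
      (∀ i ≤ b, (G (Fin.castAdd r 3)).space i =
        (fiberSpaceOf (firstFive F) (h.map V.subtype) ⊓
          (firstFive F 3).space (i + 2)).map V.mkQ) ∧
      (∀ i ≤ b, (G (Fin.castAdd r 4)).space i =
        (fiberSpaceOf (firstFive F) (h.map V.subtype) ⊓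
          (firstFive F 4).space (i + 2)).map V.mkQ) ∧
      ∀ j, ∀ i ≤ b, (G (Fin.natAdd 5 j)).space i =
        (fiberSpaceOf (firstFive F) (h.map V.subtype) ⊓
          (F (Fin.natAdd 5 j)).space (i + 3)).map V.mkQ := by
    intro h
    obtain ⟨G'⟩ := nonempty_completeFlag hQ
    by_cases hh : h ∈ solutions 2 5 baseProblem ![E0, E1, E2, E3, E4]
    swap
    -- Off the solutions nothing is asked of the flags, so any flag will do.
    · exact ⟨fun _ => G', fun h => (hh h).elim⟩
    have O := hF.overSolution hV.symm (E := ![E0, E1, E2, E3, E4]) h0 h1 h2 h3 h4 hh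
    generalize fiberSpaceOf (firstFive F) (h.map V.subtype) = Z at O
    have mono : ∀ (f : CompleteFlag (5 + b) A) (k i : ℕ),
        (Z ⊓ f.space (i + k)).map V.mkQ ≤ (Z ⊓ f.space (i + 1 + k)).map V.mkQ := fun f k i =>
      map_mono (inf_le_inf_left _ (f.mono (by omega)))
    have key := finrank_map_inf_mkQ O.inf_eq
    obtain ⟨G0, hG0⟩ := exists_completeFlag hQ (lo := 1) (hi := b) (by omega) le_rfl
      (fun i => (Z ⊓ (firstFive F 0).space (i + 4)).map V.mkQ) (fun i _ _ => mono _ _ _)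
      (fun i hi hi' => by
        have e1 := key ((firstFive F 0).space (i + 4))
        have e2 := O.Z₀ (i + 4) (by omega) (by omega)
        have e3 := O.h₀ (i + 4) (by omega) (by omega)
        omega)
    obtain ⟨G1, hG1⟩ := exists_completeFlag hQ (lo := 2) (hi := b) (by omega) le_rfl
      (fun i => (Z ⊓ (firstFive F 1).space (i + 4)).map V.mkQ) (fun i _ _ => mono _ _ _)
      (fun i hi hi' => by
        have e1 := key ((firstFive F 1).space (i + 4))
        have e2 := O.Z₁ (i + 4) (by omega) (by omega)
        have e3 := O.h₁ (i + 4) (by omega) (by omega)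
        omega)
    obtain ⟨G2, hG2⟩ := exists_completeFlag hQ (lo := 0) (hi := b - 2) (by omega) (by omega)
      (fun i => (Z ⊓ (firstFive F 2).space (i + 2)).map V.mkQ) (fun i _ _ => mono _ _ _)
      (fun i hi hi' => by
        have e1 := key ((firstFive F 2).space (i + 2))
        have e2 := O.Z₂ (i + 2) (by omega) (by omega)
        have e3 := O.h₂ (i + 2) (by omega)
        omega)
    obtain ⟨G3, hG3⟩ := exists_completeFlag hQ (lo := 0) (hi := b) (by omega) (by omega)
      (fun i => (Z ⊓ (firstFive F 3).space (i + 2)).map V.mkQ) (fun i _ _ => mono _ _ _)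
      (fun i hi hi' => by
        have e1 := key ((firstFive F 3).space (i + 2))
        have e2 := O.Z₃ (i + 2) (by omega) (by omega)
        have e3 := O.h₃ (i + 2) (by omega)
        omega)
    obtain ⟨G4, hG4⟩ := exists_completeFlag hQ (lo := 0) (hi := b) (by omega) (by omega)
      (fun i => (Z ⊓ (firstFive F 4).space (i + 2)).map V.mkQ) (fun i _ _ => mono _ _ _)
      (fun i hi hi' => by
        have e1 := key ((firstFive F 4).space (i + 2))
        have e2 := O.Z₄ (i + 2) (by omega) (by omega)
        have e3 := O.h₄ (i + 2) (by omega)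
        omega)
    have hG5 : ∀ j : Fin r, ∃ G : CompleteFlag b (A ⧸ V), ∀ i, 0 ≤ i → i ≤ b →
        G.space i = (Z ⊓ (F (Fin.natAdd 5 j)).space (i + 3)).map V.mkQ := fun j =>
      exists_completeFlag hQ (lo := 0) (hi := b) (by omega) (by omega)
        (fun i => (Z ⊓ (F (Fin.natAdd 5 j)).space (i + 3)).map V.mkQ) (fun i _ _ => mono _ _ _)
        (fun i hi hi' => by
          have e1 := key ((F (Fin.natAdd 5 j)).space (i + 3))
          have e2 := O.Z₅ j (i + 3) (by omega) (by omega)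
          have e3 := O.h₅ j (i + 3) (by omega)
          omega)
    choose G5 hG5 using hG5
    refine ⟨Fin.append ![G0, G1, G2, G3, G4] G5, fun _ => ?_⟩
    simp only [Fin.append_left, Fin.append_right]
    exact ⟨hG0, hG1, fun i hi => hG2 i (Nat.zero_le _) (by omega),
      fun i hi => hG3 i (Nat.zero_le _) hi, fun i hi => hG4 i (Nat.zero_le _) hi,
      fun j i hi => hG5 j i (Nat.zero_le _) hi⟩
  choose G hG using hG
  exact ⟨⟨V, d1, ![E0, E1, E2, E3, E4], G⟩, hV.symm, h0, h1, h2, h3, h4,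
    fun h hh => (hG h hh).1, fun h hh => (hG h hh).2.1, fun h hh => (hG h hh).2.2.1,
    fun h hh => (hG h hh).2.2.2.1, fun h hh => (hG h hh).2.2.2.2.1,
    fun h hh => (hG h hh).2.2.2.2.2⟩

end Compatibility

/-! ### Solutions of the total problem over a solution of the base problem -/

section Fibers

set_option linter.unusedSectionVars false

variable {A : Type*} [AddCommGroup A] [Module ℂ A] [FiniteDimensional ℂ A]
  {a b r : ℕ} {F : Fin (5 + r) → CompleteFlag (5 + b) A} {ν₁ κ ρ ν₄ ν₅ : ℕ → ℕ}
  {τ : Fin r → ℕ → ℕ}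

/-- What a solution of the total problem satisfies by virtue of the added rows and columns. -/
structure MeetsFlags (a : ℕ) (F : Fin (5 + r) → CompleteFlag (5 + b) A) (H : Submodule ℂ A) :
    Prop where
  finrank_eq : finrank ℂ H = 2 + a
  h₀ : 1 ≤ finrank ℂ (H ⊓ (firstFive F 0).space 2 : Submodule ℂ A)
  h₁ : 2 ≤ finrank ℂ (H ⊓ (firstFive F 1).space 5 : Submodule ℂ A)
  h₂ : a ≤ finrank ℂ (H ⊓ (firstFive F 2).space (b + 1) : Submodule ℂ A)
  h₃ : a + 1 ≤ finrank ℂ (H ⊓ (firstFive F 3).space (b + 3) : Submodule ℂ A)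
  h₄ : a + 1 ≤ finrank ℂ (H ⊓ (firstFive F 4).space (b + 3) : Submodule ℂ A)

theorem meetsFlags_of_mem (ha : 0 < a) (hab : a < b) (hρ : ρ (a - 1) = 0)
    (h₄ : ν₄ a = 0) (h₅ : ν₅ a = 0) {H : Submodule ℂ A}
    (hH : H ∈ solutions (2 + a) (5 + b) (totalProblem a b ν₁ κ ρ ν₄ ν₅ τ) F) :
    MeetsFlags a F H := by
  obtain ⟨hH, h⟩ := hH
  obtain ⟨⟨h0, h1, h2, h3, h4⟩, -⟩ := forall_fin_five_add.1 h
  simp only [Fin.append_left] at h0 h1 h2 h3 h4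
  refine ⟨hH, ?_, ?_, ?_, ?_, ?_⟩
  · have := h0.2 0 (by omega)
    have e : 5 + b - (2 + a) + (0 + 1) - addRow (b - a + 2) ν₁ 0 = 2 := by
      simp only [addRow]
      omega
    exact e ▸ this
  · have := h1.2 1 (by omega)
    have e : 5 + b - (2 + a) + (1 + 1) - addRow (b - a) (addRow (b - a) κ) 1 = 5 := by
      simp only [addRow]
      omega
    have e' : (F (Fin.castAdd r 1)).space _ = (firstFive F 1).space 5 := congrArg _ e
    exact e' ▸ this
  · have := h2.2 (a - 1) (by omega)
    have e : 5 + b - (2 + a) + (a - 1 + 1) - (rect 2 a + ρ) (a - 1) = b + 1 := by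
      simp only [Pi.add_apply, rect, hρ, if_pos (show a - 1 < a by omega)]
      omega
    have e' : a - 1 + 1 = a := by omega
    exact e' ▸ e ▸ this
  · have := h3.2 a (by omega)
    have e : 5 + b - (2 + a) + (a + 1) - (rect 1 (a + 1) + ν₄) a = b + 3 := by
      simp only [Pi.add_apply, rect, h₄, if_pos (show a < a + 1 by omega)]
      omega
    exact e ▸ this
  · have := h4.2 a (by omega)
    have e : 5 + b - (2 + a) + (a + 1) - (rect 1 (a + 1) + ν₅) a = b + 3 := by
      simp only [Pi.add_apply, rect, h₅, if_pos (show a < a + 1 by omega)]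
      omega
    exact e ▸ this

theorem GoodInstance.base_of_meetsFlags (hF : GoodInstance F) {D : FibrationData A 5 b 5 (5 + r)}
    (hD : Compatible F D) {H : Submodule ℂ A} (hH : MeetsFlags a F H) :
    H.comap D.V.subtype ∈ solutions 2 5 baseProblem D.E ∧
      H ≤ fiberSpaceOf (firstFive F) ((H.comap D.V.subtype).map D.V.subtype) := by
  have hd : ∀ m ≤ 5 + b, ∀ i, finrank ℂ ((firstFive F i).space m) = m := fun m hm i =>
    (firstFive F i).finrank_space m hm
  obtain ⟨e0, e1, e2, e3, e4, e5⟩ := finrank_inf_baseSpace (firstFive F 0).finrank_eq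
    (hd 2 (by omega) 0) (hd 5 (by omega) 1) (hd (b + 1) (by omega) 2) (hd (b + 3) (by omega) 3)
    (hd (b + 3) (by omega) 4) hF.generic.LM hF.generic.LT hF.generic.indepM hF.generic.indepT
    hH.finrank_eq hH.h₀ hH.h₁ hH.h₂ hH.h₃ hH.h₄
  rw [← hD.V_eq] at e0 e1 e2 e3 e4 e5
  have hm : (H.comap D.V.subtype).map D.V.subtype = H ⊓ D.V := by
    rw [map_comap_subtype, inf_comm]
  have hsol : H.comap D.V.subtype ∈ solutions 2 5 baseProblem D.E := by
    rw [mem_solutions_baseProblem, hD.E₀, hD.E₁, hD.E₂, hD.E₃, hD.E₄]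
    simp only [finrank_inf_comap_subtype]
    rw [hm]
    rw [finrank_comap_subtype, inf_comm, e0]
    exact ⟨rfl, e1, e2, e3, e4, e5⟩
  refine ⟨hsol, ?_⟩
  obtain ⟨x, t, hp, e⟩ := hF.exists_isPairOf hD.E₀ hD.E₁ hD.E₂ hD.E₃ hD.E₄ hsol
  rw [e]
  exact (hF.position hp).le_fiberSpace hH.finrank_eq (by rw [← hD.V_eq, ← hm, e]) hH.h₁ hH.h₂
    hH.h₃ hH.h₄

theorem map_mkQ_eq_of_le {V X Y : Submodule ℂ A} (h : X ≤ Y)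
    (hf : finrank ℂ (Y.map V.mkQ) ≤ finrank ℂ (X.map V.mkQ)) : Y.map V.mkQ = X.map V.mkQ :=
  (eq_of_le_of_finrank_le (map_mono h) hf).symm

/-- For `h ⊆ H ⊆ Z` every intersection of `H` with a flag member splits into a contribution of `h`,
known from `FlagDimensions`, and one of the image of `H`. This feeds the comparison of Schubert
conditions for each kind of flag. -/
theorem GoodInstance.mem_solutions_iff (hF : GoodInstance F)
    {D : FibrationData A 5 b 5 (5 + r)} (hD : Compatible F D)
    (ha : 0 < a) (hab : a < b) (hρ : Antitone ρ) (hρa : ρ (a - 1) = 0)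
    (hν : ∀ i, IsPartitionFor a b (fiberProblem a b ν₁ κ ρ ν₄ ν₅ τ i))
    {h : Submodule ℂ D.V} (hh : h ∈ solutions 2 5 baseProblem D.E) {H : Submodule ℂ A}
    (hH : finrank ℂ H = 2 + a) (hle : h.map D.V.subtype ≤ H)
    (hle' : H ≤ fiberSpaceOf (firstFive F) (h.map D.V.subtype)) :
    H ∈ solutions (2 + a) (5 + b) (totalProblem a b ν₁ κ ρ ν₄ ν₅ τ) F ↔
      H.map D.V.mkQ ∈ solutions a b (fiberProblem a b ν₁ κ ρ ν₄ ν₅ τ) (D.G h) := by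
  have O := hF.overSolution hD.V_eq hD.E₀ hD.E₁ hD.E₂ hD.E₃ hD.E₄ hh
  obtain ⟨⟨n0, n1, n2, n3, n4⟩, n5⟩ := forall_fin_five_add.1 hν
  simp only [Fin.append_left, Fin.append_right] at n0 n1 n2 n3 n4 n5
  have hG0 := hD.G₀ h hh
  have hG1 := hD.G₁ h hh
  have hG2 := hD.G₂ h hh
  have hG3 := hD.G₃ h hh
  have hG4 := hD.G₄ h hh
  have hG5 := hD.G₅ h hh
  have hsub := fun S => finrank_inf_eq_add O.inf_eq hle hle' S
  have key := finrank_map_inf_mkQ O.inf_eq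
  have hK : finrank ℂ (H.map D.V.mkQ) = a := by
    have h1 := hsub ⊤
    rw [inf_top_eq, inf_top_eq, O.finrank_h, inf_top_eq,
      inf_eq_left.2 (map_mono hle'), hH] at h1
    omega
  generalize fiberSpaceOf (firstFive F) (h.map D.V.subtype) = Z at *
  have hZ : finrank ℂ Z = b + 2 := by
    have := O.Z₀ (b + 5) (by omega) le_rfl
    rw [(firstFive F 0).space_eq_top _ (by omega), inf_top_eq] at this
    omega
  have hP : ∀ i, finrank ℂ (Z ⊓ (firstFive F i).space (b + 3) : Submodule ℂ A) = b + 1 →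
      a + 1 ≤ finrank ℂ (H ⊓ (firstFive F i).space (b + 3) : Submodule ℂ A) := by
    intro i hi
    have h1 := finrank_add_le_of_le hle' (inf_le_left : Z ⊓ (firstFive F i).space (b + 3) ≤ Z)
    rw [← inf_assoc, inf_eq_left.2 hle', hi, hH, hZ] at h1
    omega
  simp only [solutions, Set.mem_ofPred_eq, hH, hK, true_and, forall_fin_five_add, Fin.append_left,
    Fin.append_right]
  refine and_congr (and_congr ?_ (and_congr ?_ (and_congr ?_ (and_congr ?_ ?_)))) ?_
  · refine mem_schubertVariety_iff_of_addRow hab n0 hH hK ?_ fun i h1 h2 => ?_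
    · have := O.h₀ 2 le_rfl (by omega)
      rw [← this]
      exact finrank_mono (inf_le_inf_right _ hle)
    · rw [hG0 i h1 h2, ← O.h₀ (i + 4) (by omega) (by omega)]
      exact hsub _
  · refine mem_schubertVariety_iff_of_addRow_addRow ha hab n1 hH hK ?_ fun i h1 h2 => ?_
    -- `Z` has the same dimension 3 in the fifth and sixth members and `h` has dimension 1 in both,
    -- so both have the same image, the second member of the fiber flag.
    · rw [hG1 2 le_rfl (by omega), ← O.h₁ 5 (by omega) (by omega), map_mkQ_eq_of_le
        (inf_le_inf_left Z ((firstFive F 1).mono (show 5 ≤ 2 + 4 by omega)))]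
      · exact hsub _
      · have e1 := key ((firstFive F 1).space 5)
        have e2 := key ((firstFive F 1).space (2 + 4))
        have e3 := O.Z₁'
        have e4 := O.Z₁ (2 + 4) (by omega) (by omega)
        have e5 := O.h₁ 5 (by omega) (by omega)
        have e6 := O.h₁ (2 + 4) (by omega) (by omega)
        omega
    · rw [hG1 i h1 h2, ← O.h₁ (i + 4) (by omega) (by omega)]
      exact hsub _
  · refine mem_schubertVariety_iff_of_rect_two ha hab n2 hρ hρa hH hK ?_ fun i hi => ?_
    -- From member `b` to member `b + 1` both `Z` and `h` gain one dimension, so the image in the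
    -- quotient is unchanged.
    · rw [hG2 (b - 2) (by omega), ← map_mkQ_eq_of_le
        (inf_le_inf_left Z ((firstFive F 2).mono (show b - 2 + 2 ≤ b + 1 by omega)))]
      · have e := hsub ((firstFive F 2).space (b + 1))
        rwa [O.h₂'] at e
      · have e1 := key ((firstFive F 2).space (b - 2 + 2))
        have e2 := key ((firstFive F 2).space (b + 1))
        have e3 := O.Z₂ (b - 2 + 2) (by omega) (by omega)
        have e4 := O.Z₂ (b + 1) (by omega) (by omega)
        have e5 := O.h₂ (b - 2 + 2) (by omega)
        have e6 := O.h₂'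
        omega
    · have e := hsub ((firstFive F 2).space (i + 2))
      rwa [O.h₂ (i + 2) hi, zero_add, ← hG2 i hi] at e
  · refine mem_schubertVariety_iff_of_rect_one hab n3 hH hK ?_ fun i hi => ?_
    · exact hP 3 (by have := O.Z₃ (b + 3) (by omega) le_rfl; omega)
    · have e := hsub ((firstFive F 3).space (i + 2))
      rwa [O.h₃ (i + 2) (by omega), zero_add, ← hG3 i hi] at e
  · refine mem_schubertVariety_iff_of_rect_one hab n4 hH hK ?_ fun i hi => ?_
    · exact hP 4 (by have := O.Z₄ (b + 3) (by omega) le_rfl; omega)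
    · have e := hsub ((firstFive F 4).space (i + 2))
      rwa [O.h₄ (i + 2) (by omega), zero_add, ← hG4 i hi] at e
  · refine forall_congr' fun j => ?_
    refine mem_schubertVariety_iff_of_same hab (n5 j) hH hK fun i hi => ?_
    rw [hG5 j i hi, hsub, O.h₅ j (i + 3) (by omega), zero_add]

/-- The inverse of the map to pairs sends `(h, K)` to `Z ∩ π⁻¹(K)`, with `π` the projection to `A /
V`. It maps onto `K` because `Z + V = A` and meets `V` in `h` because `Z ∩ V = h`. -/
theorem GoodInstance.fibersInstance (hF : GoodInstance F) {D : FibrationData A 5 b 5 (5 + r)}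
    (hD : Compatible F D) (ha : 0 < a) (hab : a < b) (hρ : Antitone ρ) (hρa : ρ (a - 1) = 0)
    (hν : ∀ i, IsPartitionFor a b (fiberProblem a b ν₁ κ ρ ν₄ ν₅ τ i)) :
    FibersInstance 2 5 a b (totalProblem a b ν₁ κ ρ ν₄ ν₅ τ) baseProblem
      (fiberProblem a b ν₁ κ ρ ν₄ ν₅ τ) F D := by
  have h₄ : ν₄ a = 0 := (hν (Fin.castAdd r 3)).2.2
  have h₅ : ν₅ a = 0 := (hν (Fin.castAdd r 4)).2.2
  have base : ∀ H ∈ solutions (2 + a) (5 + b) (totalProblem a b ν₁ κ ρ ν₄ ν₅ τ) F,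
      H.comap D.V.subtype ∈ solutions 2 5 baseProblem D.E ∧
        H ≤ fiberSpaceOf (firstFive F) ((H.comap D.V.subtype).map D.V.subtype) := fun H hH =>
    hF.base_of_meetsFlags hD (meetsFlags_of_mem ha hab hρa h₄ h₅ hH)
  have hO := fun h hh => hF.overSolution hD.V_eq hD.E₀ hD.E₁ hD.E₂ hD.E₃ hD.E₄ (h := h) hh
  have fib : ∀ H ∈ solutions (2 + a) (5 + b) (totalProblem a b ν₁ κ ρ ν₄ ν₅ τ) F,
      H.map D.V.mkQ ∈ solutions a b (fiberProblem a b ν₁ κ ρ ν₄ ν₅ τ)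
        (D.G (H.comap D.V.subtype)) := fun H hH =>
    (hF.mem_solutions_iff hD ha hab hρ hρa hν (base H hH).1 hH.1
      (map_comap_le _ _) (base H hH).2).1 hH
  refine ⟨fun H hH => (base H hH).1, ?_, ?_, ?_, ?_⟩
  · rintro h - H hH rfl
    exact fib H hH
  · exact fun H hH => ⟨(base H hH).1, fib H hH⟩
  · intro H hH H' hH' he
    obtain ⟨e1, e2⟩ := Prod.mk.inj he
    have key : ∀ H₁ ∈ solutions (2 + a) (5 + b) (totalProblem a b ν₁ κ ρ ν₄ ν₅ τ) F,
        ∀ H₂ ∈ solutions (2 + a) (5 + b) (totalProblem a b ν₁ κ ρ ν₄ ν₅ τ) F,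
        H₁.comap D.V.subtype = H₂.comap D.V.subtype → H₁.map D.V.mkQ = H₂.map D.V.mkQ →
        H₁ ≤ H₂ := by
      intro H₁ h₁ H₂ h₂ e1 e2 z hz
      obtain ⟨y, hy, hyz⟩ : D.V.mkQ z ∈ H₂.map D.V.mkQ := e2 ▸ mem_map_of_mem hz
      have hV : z - y ∈ D.V := by
        rw [← Quotient.mk_eq_zero, ← mkQ_apply, map_sub, hyz, sub_self]
      have hZ := sub_mem ((base H₁ h₁).2 hz) (e1 ▸ (base H₂ h₂).2 hy)
      -- Both solutions lie in the same `Z`, so vectors with equal images differ by an element of `Z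
      -- ∩ V = h`, which both contain.
      have := (hO _ (base H₁ h₁).1).inf_eq.le ⟨hZ, hV⟩
      rw [e1] at this
      have := add_mem (map_comap_le _ _ this) hy
      rwa [sub_add_cancel] at this
    exact le_antisymm (key H hH H' hH' e1 e2) (key H' hH' H hH e1.symm e2.symm)
  · rintro ⟨h, K⟩ ⟨hh, hK⟩
    dsimp only at hh hK
    have O := hO h hh
    set Z := fiberSpaceOf (firstFive F) (h.map D.V.subtype) with hZ
    have hV : D.V ≤ K.comap D.V.mkQ := fun v hv => by
      rw [mem_comap, mkQ_apply, (Quotient.mk_eq_zero _).2 hv]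
      exact zero_mem _
    have hle : h.map D.V.subtype ≤ Z ⊓ K.comap D.V.mkQ := by
      rw [← O.inf_eq]
      exact inf_le_inf_left _ hV
    have hHV : Z ⊓ K.comap D.V.mkQ ⊓ D.V = h.map D.V.subtype := by
      rw [inf_assoc, inf_eq_right.2 hV, O.inf_eq]
    have hmap : (Z ⊓ K.comap D.V.mkQ).map D.V.mkQ = K := by
      refine le_antisymm (map_le_iff_le_comap.2 inf_le_right) fun q hq => ?_
      obtain ⟨w, rfl⟩ := D.V.mkQ_surjective q
      obtain ⟨z, hz, v, hv, rfl⟩ := mem_sup.1 (O.sup_eq.ge (mem_top (x := w)))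
      have e : D.V.mkQ (z + v) = D.V.mkQ z := by
        rw [map_add, mkQ_apply, mkQ_apply, (Quotient.mk_eq_zero _).2 hv, add_zero]
      rw [e] at hq ⊢
      exact mem_map_of_mem ⟨hz, hq⟩
    have hH : finrank ℂ (Z ⊓ K.comap D.V.mkQ : Submodule ℂ A) = 2 + a := by
      rw [← finrank_map_mkQ D.V, hmap, hHV, O.finrank_h, hK.1, add_comm]
    refine ⟨Z ⊓ K.comap D.V.mkQ, ?_, Prod.ext ?_ hmap⟩
    · rw [hF.mem_solutions_iff hD ha hab hρ hρa hν hh hH hle inf_le_left, hmap]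
      exact hK
    · apply map_injective_of_injective D.V.injective_subtype
      change ((Z ⊓ K.comap D.V.mkQ).comap D.V.subtype).map D.V.subtype = _
      rw [map_comap_subtype, inf_comm, hHV]

end Fibers

/-! ### Openness of general position -/

theorem isOpen_forall {X ι : Type*} [Finite ι] {R : Subalgebra ℂ (X → ℂ)} {p : ι → X → Prop}
    (hp : ∀ i, IsOpen[zariski R] {x | p i x}) : IsOpen[zariski R] {x | ∀ i, p i x} := by
  rw [Set.ofPred_forall]
  exact @isOpen_iInter_of_finite X ι (zariski R) _ _ hp

theorem isZariskiOpen_goodInstance {A : Type*} [AddCommGroup A] [Module ℂ A]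
    [FiniteDimensional ℂ A] {b r : ℕ} (e : Basis (Fin (5 + b)) ℂ A) :
    IsZariskiOpen {F : Fin (5 + r) → CompleteFlag (5 + b) A | GoodInstance F} := by
  refine isZariskiOpen_of_isOpen e ?_
  set R := basesAlgebra (5 + r) e
  have hF : ∀ i d, RegularFamily R
      (fun v : Fin (5 + r) → Basis (Fin (5 + b)) ℂ A => (CompleteFlag.ofBasis (v i)).space d) :=
    fun i d => regularFamily_ofBasis e i d
  let f : Fin 5 → Fin (5 + r) := Fin.castAdd r
  have avoids : ∀ i k d l, IsOpen[zariski R] {v : Fin (5 + r) → Basis (Fin (5 + b)) ℂ A |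
      ∀ x t, IsPairOf 5 b (b + 2) (firstFive fun i => CompleteFlag.ofBasis (v i)) x t →
        AvoidsOf (firstFive fun i => CompleteFlag.ofBasis (v i))
          ((CompleteFlag.ofBasis (v i)).space d ⊓ (CompleteFlag.ofBasis (v k)).space l) x t} :=
    fun i k d l => isOpen_pair_avoids (hF (f 0) 2) (hF (f 1) 5) (hF (f 2) (b + 1))
      (hF (f 3) (b + 2 + 1)) (hF (f 4) (b + 2 + 1)) (hF i d) (hF k l)
  have not_dep : ∀ i d, IsOpen[zariski R] {v : Fin (5 + r) → Basis (Fin (5 + b)) ℂ A |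
      ∀ x t, IsPairOf 5 b (b + 2) (firstFive fun i => CompleteFlag.ofBasis (v i)) x t →
        ¬ Dep ((CompleteFlag.ofBasis (v i)).space d) x t} :=
    fun i d => isOpen_pair_not_dep (hF (f 0) 2) (hF (f 1) 5) (hF (f 2) (b + 1))
      (hF (f 3) (b + 2 + 1)) (hF (f 4) (b + 2 + 1)) (hF i d)
  have gen : IsOpen[zariski R] {v : Fin (5 + r) → Basis (Fin (5 + b)) ℂ A |
      Generic 5 b (b + 2) (firstFive fun i => CompleteFlag.ofBasis (v i))} :=
    isOpen_generic fun i d => hF (f i) d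
  have := isOpen_and gen <| isOpen_and (avoids (f 0) (f 2) 5 (b + 3)) <|
    isOpen_and (avoids (f 1) (f 2) 6 (b + 2)) <| isOpen_and (avoids (f 2) (f 2) 2 2) <|
    isOpen_and (avoids (f 3) (f 3) 2 2) <| isOpen_and (avoids (f 4) (f 4) 2 2) <|
    isOpen_and (isOpen_forall fun j : Fin r => not_dep (Fin.natAdd 5 j) (b + 3))
      (isOpen_forall fun j : Fin r => avoids (Fin.natAdd 5 j) (Fin.natAdd 5 j) 3 3)
  convert this using 1
  ext v
  constructor
  · rintro ⟨h1, h2, h3, h4, h5, h6, h7, h8⟩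
    exact ⟨h1, h2, h3, h4, h5, h6, h7, h8⟩
  · rintro ⟨h1, h2, h3, h4, h5, h6, h7, h8⟩
    exact ⟨h1, h2, h3, h4, h5, h6, h7, h8⟩

/-! ### Split instances -/

section Base

variable {W : Type*} [AddCommGroup W] [Module ℂ W] [FiniteDimensional ℂ W]

theorem sup_eq_top_of_disjoint {S S' : Submodule ℂ W} (h : ∀ w ∈ S, w ∈ S' → w = 0)
    (hf : finrank ℂ S + finrank ℂ S' = finrank ℂ W) : S ⊔ S' = ⊤ :=
  eq_top_of_finrank_eq ((finrank_sup_of_disjoint h).trans hf)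

theorem exists_sub_smul_mem {S : Submodule ℂ W} (hS : finrank ℂ S + 1 = finrank ℂ W) {q : W}
    (hq : q ∉ S) (m : W) : ∃ e : ℂ, m - e • q ∈ S := by
  have hq0 : q ≠ 0 := fun h => hq (h ▸ zero_mem S)
  have htop : S ⊔ span ℂ {q} = ⊤ := by
    refine sup_eq_top_of_disjoint ?_ (by rwa [finrank_span_singleton hq0])
    rintro w hw hw'
    obtain ⟨e, rfl⟩ := mem_span_singleton.1 hw'
    by_contra h
    exact hq ((smul_mem_iff _ fun he => h (by rw [he, zero_smul])).1 hw)
  obtain ⟨s, hs, z, hz, rfl⟩ := mem_sup.1 (htop.ge (mem_top (x := m)))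
  obtain ⟨e, rfl⟩ := mem_span_singleton.1 hz
  exact ⟨e, by rwa [add_sub_cancel_right]⟩

/-- The plane of a pair meets the second subspace in a line spanned by `q`, and the vectors
aligned with the pair in the second and third subspace are multiples of `q` and of `t`. -/
theorem Generic.exists_aligned {E : Fin 5 → CompleteFlag 5 W} (hE : Generic 3 2 2 E) {x t : W}
    (hp : IsPairOf 3 2 2 E x t) : ∃ c d : ℂ, c ≠ 0 ∧ c • x + d • t ∈ (E 1).space 3 ∧
      c • x + d • t ∉ (E 2).space 4 ∧ t ∉ (E 1).space 4 ∧
      (∀ m ∈ (E 1).space 3, Aligned ((E 3).space 3) ((E 4).space 3) x t m →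
        ∃ e : ℂ, m = e • (c • x + d • t)) ∧
      ∀ w ∈ (E 2).space 3, Aligned ((E 3).space 3) ((E 4).space 3) x t w →
        ∃ f : ℂ, w = f • t := by
  obtain ⟨-, isoM, isoT, -, nP, nQ⟩ := hE.pair x t hp
  have hd : ∀ m ≤ 5, ∀ i, finrank ℂ ((E i).space m) = m := fun m hm i => (E i).finrank_space m hm
  have hW := (E 0).finrank_eq
  have hLM : (E 0).space 2 ⊔ (E 1).space 3 = ⊤ := sup_eq_top_of_disjoint hE.LM
    (by rw [hd _ (by omega), hd _ (by omega), hW])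
  have hLT : (E 0).space 2 ⊔ (E 2).space 3 = ⊤ := sup_eq_top_of_disjoint hE.LT
    (by rw [hd _ (by omega), hd _ (by omega), hW])
  have hfr := hp.finrank_span hE.LT
  have hal : ∀ m, Aligned ((E 3).space 3) ((E 4).space 3) x t m ↔
      m ∈ ((E 3).space 3 ⊔ span ℂ {x, t}) ⊓ ((E 4).space 3 ⊔ span ℂ {x, t}) := by
    intro m
    have hnot : ∀ i, ¬ Dep ((E i).space 2) x t → ¬ (x ∈ (E i).space 3 ∧ t ∈ (E i).space 3) := by
      rintro i hi ⟨h1, h2⟩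
      have h3 := finrank_span_inf_le_one (b := 0) (hd 3 (by omega) i) (hd 2 (by omega) i)
        ((E i).mono (by omega)) hi
      have h4 : span ℂ {x, t} ≤ (E i).space 3 := span_le.2 (by rintro z (rfl | rfl) <;> assumption)
      rw [inf_eq_left.2 h4, hfr] at h3
      omega
    rw [mem_inf, mem_sup_span_pair_iff hp.depP (hnot 3 nP),
      mem_sup_span_pair_iff hp.depQ (hnot 4 nQ)]
    exact ⟨fun h => ⟨⟨h.1, h.2⟩, ⟨h.3, h.4⟩⟩, fun h => ⟨h.1.1, h.1.2, h.2.1, h.2.2⟩⟩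
  have hspan : ∀ z ∈ span ℂ {x, t},
      z ∈ ((E 3).space 3 ⊔ span ℂ {x, t}) ⊓ ((E 4).space 3 ⊔ span ℂ {x, t}) := fun z hz =>
    ⟨mem_sup_right hz, mem_sup_right hz⟩
  -- In dimension 5 one has `L + T = W`, so isolation applies to all aligned vectors of `M`: they
  -- meet a hyperplane only in 0. Subtracting a multiple of `q` moves such a vector into that
  -- hyperplane, hence to 0. The same works for `T` and `t`.
  have eqM : ∀ m ∈ (E 1).space 3, m ∈ (E 2).space 4 →
      Aligned ((E 3).space 3) ((E 4).space 3) x t m → m = 0 := by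
    intro m hm hY ha
    obtain ⟨x', hx', w, hw, rfl⟩ := mem_sup.1 (hLT.ge (mem_top (x := m)))
    obtain ⟨e1, e2⟩ := isoM x' hx' w hw hm hY ha
    rw [e1, e2, add_zero]
  have eqT : ∀ m ∈ (E 2).space 3, m ∈ (E 1).space 4 →
      Aligned ((E 3).space 3) ((E 4).space 3) x t m → m = 0 := by
    intro m hm hY ha
    obtain ⟨x', hx', w, hw, rfl⟩ := mem_sup.1 (hLM.ge (mem_top (x := m)))
    obtain ⟨e1, e2⟩ := isoT x' hx' w hw hm hY ha
    rw [e1, e2, add_zero]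
  obtain ⟨c, d, h0, h⟩ := hp.depM
  have hqs : c • x + d • t ∈ span ℂ {x, t} :=
    add_mem (smul_mem _ _ left_mem_span_pair) (smul_mem _ _ right_mem_span_pair)
  have hq : c • x + d • t ∉ (E 2).space 4 := by
    intro hq
    obtain ⟨e1, e2⟩ := hp.coeff_eq_zero hE.LT (eqM _ h hq ((hal _).2 (hspan _ hqs)))
    simp [e1, e2] at h0
  have ht : t ∉ (E 1).space 4 := fun ht =>
    hp.right_ne (eqT t hp.right_mem ht ((hal _).2 (hspan _ right_mem_span_pair)))
  refine ⟨c, d, ?_, h, hq, ht, fun m hm ha => ?_, fun w hw ha => ?_⟩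
  · rintro rfl
    rw [zero_smul, zero_add] at hq
    exact hq (smul_mem _ _ ((E 2).mono (by omega) hp.right_mem))
  · obtain ⟨e, he⟩ := exists_sub_smul_mem (by rw [hd 4 (by omega), hW]) hq m
    refine ⟨e, sub_eq_zero.1 (eqM _ (sub_mem hm (smul_mem _ e h)) he ?_)⟩
    rw [hal] at ha ⊢
    exact sub_mem ha (smul_mem _ e (hspan _ hqs))
  · obtain ⟨f, hf⟩ := exists_sub_smul_mem (by rw [hd 4 (by omega), hW]) ht w
    refine ⟨f, sub_eq_zero.1 (eqT _ (sub_mem hw (smul_mem _ f hp.right_mem)) hf ?_)⟩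
    rw [hal] at ha ⊢
    exact sub_mem ha (smul_mem _ f (hspan _ right_mem_span_pair))

end Base

section Split

set_option linter.unusedSectionVars false

variable {A : Type*} [AddCommGroup A] [Module ℂ A] [FiniteDimensional ℂ A] {V : Submodule ℂ A}

theorem CompleteFlag.space_zero {n : ℕ} {W : Type*} [AddCommGroup W] [Module ℂ W]
    [FiniteDimensional ℂ W] (F : CompleteFlag n W) : F.space 0 = ⊥ :=
  finrank_eq_zero.1 (F.finrank_space 0 (Nat.zero_le n))

theorem eq_zero_of_projection {ρ : A →ₗ[ℂ] V} (hρ : ∀ v : V, ρ v = v) {z : A} (h1 : ρ z = 0)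
    (h2 : V.mkQ z = 0) : z = 0 := by
  have hz : z ∈ V := (Quotient.mk_eq_zero V).1 h2
  have := hρ ⟨z, hz⟩
  rw [h1] at this
  exact (congrArg Subtype.val this).symm

/-- The projection `ρ` identifies `A` with `V ⊕ A / V`, and the subspace in question is `X ⊕ Y`. -/
theorem finrank_comap_inf_comap {ρ : A →ₗ[ℂ] V} (hρ : ∀ v : V, ρ v = v) (X : Submodule ℂ V)
    (Y : Submodule ℂ (A ⧸ V)) :
    finrank ℂ (X.comap ρ ⊓ Y.comap V.mkQ : Submodule ℂ A) = finrank ℂ X + finrank ℂ Y := by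
  have hinf : X.comap ρ ⊓ Y.comap V.mkQ ⊓ V = X.map V.subtype := by
    ext z
    constructor
    · rintro ⟨⟨h1, -⟩, h3⟩
      have : ρ z = ⟨z, h3⟩ := hρ ⟨z, h3⟩
      exact ⟨⟨z, h3⟩, this ▸ h1, rfl⟩
    · rintro ⟨v, hv, rfl⟩
      refine ⟨⟨?_, ?_⟩, v.2⟩
      · rw [SetLike.mem_coe, mem_comap, subtype_apply, hρ]
        exact hv
      · rw [SetLike.mem_coe, mem_comap, mkQ_apply, subtype_apply, (Quotient.mk_eq_zero V).2 v.2]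
        exact zero_mem _
  have hmap : (X.comap ρ ⊓ Y.comap V.mkQ).map V.mkQ = Y := by
    refine le_antisymm (map_le_iff_le_comap.2 inf_le_right) fun y hy => ?_
    obtain ⟨z, rfl⟩ := V.mkQ_surjective y
    have hz : V.mkQ (z - ρ z) = V.mkQ z := by
      rw [map_sub, mkQ_apply V (ρ z), (Quotient.mk_eq_zero V).2 (ρ z).2, sub_zero]
    refine ⟨z - ρ z, ⟨?_, ?_⟩, hz⟩
    · rw [SetLike.mem_coe, mem_comap, map_sub, hρ, sub_self]
      exact zero_mem _
    · rwa [SetLike.mem_coe, mem_comap, hz]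
  rw [← finrank_map_mkQ V, hmap, hinf, finrank_map_subtype_eq, add_comm]

/-- A way to merge a flag in a space of dimension `n` and a flag in a space of dimension `b` into
a flag in their sum. -/
structure MergePath (n b : ℕ) where
  -- Of the first `m` steps of the merged flag, `fst m` are taken in the flag of dimension `n` and
  -- `m - fst m` in the other.
  fst : ℕ → ℕ
  mono : Monotone fst
  mono' : Monotone fun m => m - fst m
  le : ∀ m ≤ n + b, fst m ≤ n ∧ fst m ≤ m ∧ m - fst m ≤ b
  ge : ∀ m, n + b ≤ m → n ≤ fst m ∧ b ≤ m - fst m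

/-- The flag in `A` merged from flags in `V` and in `A ⧸ V` by means of a projection to `V`. -/
def mergeFlag {n b : ℕ} {ρ : A →ₗ[ℂ] V} (hρ : ∀ v : V, ρ v = v) (p : MergePath n b)
    (E : CompleteFlag n V) (G : CompleteFlag b (A ⧸ V)) : CompleteFlag (n + b) A where
  space m := (E.space (p.fst m)).comap ρ ⊓ (G.space (m - p.fst m)).comap V.mkQ
  mono := fun _ _ h => inf_le_inf (comap_mono (E.mono (p.mono h))) (comap_mono (G.mono (p.mono' h)))
  finrank_space := by
    intro m hm
    obtain ⟨h1, h2, h3⟩ := p.le m hm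
    rw [finrank_comap_inf_comap hρ, E.finrank_space _ h1, G.finrank_space _ h3]
    omega
  space_eq_top := by
    intro m hm
    obtain ⟨h1, h2⟩ := p.ge m hm
    rw [E.space_eq_top _ h1, G.space_eq_top _ h2, comap_top, comap_top, inf_top_eq]

theorem mem_mergeFlag {n b : ℕ} {ρ : A →ₗ[ℂ] V} {hρ : ∀ v : V, ρ v = v} {p : MergePath n b}
    {E : CompleteFlag n V} {G : CompleteFlag b (A ⧸ V)} {m : ℕ} {z : A} :
    z ∈ (mergeFlag hρ p E G).space m ↔
      ρ z ∈ E.space (p.fst m) ∧ V.mkQ z ∈ G.space (m - p.fst m) := Iff.rfl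

/-- The paths by which the five special flags and the remaining ones are merged. -/
def path₀ (b : ℕ) : MergePath 5 b where
  -- Gives `L = E₂ ⊕ 0`, and `E₄ ⊕ Gᵢ` in dimension `i + 4`.
  fst m := min m 4 + min (m - (b + 4)) 1
  mono := fun m m' h => by dsimp only; omega
  mono' := fun m m' h => by dsimp only; omega
  le := fun m h => by omega
  ge := fun m h => by omega

/-- The second path. -/
def path₁ {b : ℕ} (hb : 2 ≤ b) : MergePath 5 b where
  -- Gives `M = E₃ ⊕ G₂`, and `E₄ ⊕ Gᵢ` in dimension `i + 4` for `i ≥ 2`.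
  fst m := min m 3 + min (m - 5) 1 + min (m - (b + 4)) 1
  mono := fun m m' h => by dsimp only; omega
  mono' := fun m m' h => by dsimp only; omega
  le := fun m h => by omega
  ge := fun m h => by omega

/-- The third path. -/
def path₂ {b : ℕ} (hb : 2 ≤ b) : MergePath 5 b where
  -- Gives `E₂ ⊕ Gᵢ` in dimension `i + 2` for `i ≤ b - 2`, then `T = E₃ ⊕ G_{b-2}` and the
  -- hyperplane `E₄ ⊕ A / V`.
  fst m := min m 2 + min (m - b) 2 + min (m - (b + 4)) 1
  mono := fun m m' h => by dsimp only; omega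
  mono' := fun m m' h => by dsimp only; omega
  le := fun m h => by omega
  ge := fun m h => by omega

/-- The fourth and fifth path. -/
def path₃ (b : ℕ) : MergePath 5 b where
  -- Gives `E₂ ⊕ Gᵢ` in dimension `i + 2`. The spaces `P` and `Q` become `E₃ ⊕ A / V`, so they
  -- contain the kernel of `ρ`.
  fst m := min m 2 + min (m - (b + 2)) 3
  mono := fun m m' h => by dsimp only; omega
  mono' := fun m m' h => by dsimp only; omega
  le := fun m h => by omega
  ge := fun m h => by omega

/-- The remaining path. -/
def path₅ (b : ℕ) : MergePath 5 b where
  -- Gives `X₃ ⊕ Gᵢ` in dimension `i + 3`.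
  fst m := min m 3 + min (m - (b + 3)) 2
  mono := fun m m' h => by dsimp only; omega
  mono' := fun m m' h => by dsimp only; omega
  le := fun m h => by omega
  ge := fun m h => by omega

/-- The instance merged from an instance in `V` and an instance in `A ⧸ V`. -/
def mergeInstance {b r : ℕ} (hb : 2 ≤ b) {ρ : A →ₗ[ℂ] V} (hρ : ∀ v : V, ρ v = v)
    (E : Fin 5 → CompleteFlag 5 V) (X : CompleteFlag 5 V)
    (G : Fin (5 + r) → CompleteFlag b (A ⧸ V)) : Fin (5 + r) → CompleteFlag (5 + b) A :=
  Fin.append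
    ![mergeFlag hρ (path₀ b) (E 0) (G (Fin.castAdd r 0)),
      mergeFlag hρ (path₁ hb) (E 1) (G (Fin.castAdd r 1)),
      mergeFlag hρ (path₂ hb) (E 2) (G (Fin.castAdd r 2)),
      mergeFlag hρ (path₃ b) (E 3) (G (Fin.castAdd r 3)),
      mergeFlag hρ (path₃ b) (E 4) (G (Fin.castAdd r 4))]
    -- A single auxiliary flag `X` of `V` serves all remaining indices: its third member only has to
    -- miss the solution planes.
    fun j => mergeFlag hρ (path₅ b) X (G (Fin.natAdd 5 j))

/-- The genericity required of an instance of the base problem. -/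
structure GoodBase {W : Type*} [AddCommGroup W] [Module ℂ W] (E : Fin 5 → CompleteFlag 5 W)
    (X : CompleteFlag 5 W) : Prop where
  generic : Generic 3 2 2 E
  not_dep : ∀ x t, IsPairOf 3 2 2 E x t → ¬ Dep (X.space 3) x t

/-- The genericity required of an instance of the fiber. -/
structure GoodFiber {W : Type*} [AddCommGroup W] [Module ℂ W] {b r : ℕ}
    (G : Fin (5 + r) → CompleteFlag b W) : Prop where
  disjoint₁₂ : ∀ w ∈ (G (Fin.castAdd r 1)).space 2, w ∈ (G (Fin.castAdd r 2)).space (b - 2) →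
    w = 0
  disjoint₀₂ : ∀ w ∈ (G (Fin.castAdd r 0)).space 1, w ∈ (G (Fin.castAdd r 2)).space (b - 1) →
    w = 0

variable {b r : ℕ} {hb : 2 ≤ b} {ρ : A →ₗ[ℂ] V} {hρ : ∀ v : V, ρ v = v}
  {E : Fin 5 → CompleteFlag 5 V} {X : CompleteFlag 5 V} {G : Fin (5 + r) → CompleteFlag b (A ⧸ V)}
  {z : A}

theorem mem_merge₀ {m p q : ℕ} (hp : (path₀ b).fst m = p) (hq : m - (path₀ b).fst m = q) :
    z ∈ (firstFive (mergeInstance hb hρ E X G) 0).space m ↔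
      ρ z ∈ (E 0).space p ∧ V.mkQ z ∈ (G (Fin.castAdd r 0)).space q := by
  subst hp hq
  simp only [firstFive, mergeInstance, Fin.append_left]
  exact mem_mergeFlag (hρ := hρ)

theorem mem_merge₁ {m p q : ℕ} (hp : (path₁ hb).fst m = p) (hq : m - (path₁ hb).fst m = q) :
    z ∈ (firstFive (mergeInstance hb hρ E X G) 1).space m ↔
      ρ z ∈ (E 1).space p ∧ V.mkQ z ∈ (G (Fin.castAdd r 1)).space q := by
  subst hp hq
  simp only [firstFive, mergeInstance, Fin.append_left]
  exact mem_mergeFlag (hρ := hρ)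

theorem mem_merge₂ {m p q : ℕ} (hp : (path₂ hb).fst m = p) (hq : m - (path₂ hb).fst m = q) :
    z ∈ (firstFive (mergeInstance hb hρ E X G) 2).space m ↔
      ρ z ∈ (E 2).space p ∧ V.mkQ z ∈ (G (Fin.castAdd r 2)).space q := by
  subst hp hq
  simp only [firstFive, mergeInstance, Fin.append_left]
  exact mem_mergeFlag (hρ := hρ)

theorem mem_merge₃ {m p q : ℕ} (hp : (path₃ b).fst m = p) (hq : m - (path₃ b).fst m = q) :
    z ∈ (firstFive (mergeInstance hb hρ E X G) 3).space m ↔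
      ρ z ∈ (E 3).space p ∧ V.mkQ z ∈ (G (Fin.castAdd r 3)).space q := by
  subst hp hq
  simp only [firstFive, mergeInstance, Fin.append_left]
  exact mem_mergeFlag (hρ := hρ)

theorem mem_merge₄ {m p q : ℕ} (hp : (path₃ b).fst m = p) (hq : m - (path₃ b).fst m = q) :
    z ∈ (firstFive (mergeInstance hb hρ E X G) 4).space m ↔
      ρ z ∈ (E 4).space p ∧ V.mkQ z ∈ (G (Fin.castAdd r 4)).space q := by
  subst hp hq
  simp only [firstFive, mergeInstance, Fin.append_left]
  exact mem_mergeFlag (hρ := hρ)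

theorem mem_merge₅ {j : Fin r} {m p q : ℕ} (hp : (path₅ b).fst m = p)
    (hq : m - (path₅ b).fst m = q) :
    z ∈ (mergeInstance hb hρ E X G (Fin.natAdd 5 j)).space m ↔
      ρ z ∈ X.space p ∧ V.mkQ z ∈ (G (Fin.natAdd 5 j)).space q := by
  subst hp hq
  simp only [mergeInstance, Fin.append_right]
  exact mem_mergeFlag (hρ := hρ)

end Split

/-! ### Merged instances are in general position -/

section Split

set_option linter.unusedSectionVars false

variable {A : Type*} [AddCommGroup A] [Module ℂ A] [FiniteDimensional ℂ A] {V : Submodule ℂ A}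
  {b r : ℕ} {hb : 2 ≤ b} {ρ : A →ₗ[ℂ] V} {hρ : ∀ v : V, ρ v = v}
  {E : Fin 5 → CompleteFlag 5 V} {X : CompleteFlag 5 V} {G : Fin (5 + r) → CompleteFlag b (A ⧸ V)}
  {z : A}

theorem mem_merge_L : z ∈ (firstFive (mergeInstance hb hρ E X G) 0).space 2 ↔
    ρ z ∈ (E 0).space 2 ∧ V.mkQ z = 0 := by
  rw [mem_merge₀ (p := 2) (q := 0) (by dsimp only [path₀]; omega) (by dsimp only [path₀]; omega),
    CompleteFlag.space_zero, mem_bot]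

theorem mem_merge_M : z ∈ (firstFive (mergeInstance hb hρ E X G) 1).space 5 ↔
    ρ z ∈ (E 1).space 3 ∧ V.mkQ z ∈ (G (Fin.castAdd r 1)).space 2 :=
  mem_merge₁ (by dsimp only [path₁]; omega) (by dsimp only [path₁]; omega)

theorem mem_merge_T : z ∈ (firstFive (mergeInstance hb hρ E X G) 2).space (b + 1) ↔
    ρ z ∈ (E 2).space 3 ∧ V.mkQ z ∈ (G (Fin.castAdd r 2)).space (b - 2) :=
  mem_merge₂ (by dsimp only [path₂]; omega) (by dsimp only [path₂]; omega)

theorem mem_merge_P : z ∈ (firstFive (mergeInstance hb hρ E X G) 3).space (b + 2 + 1) ↔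
    ρ z ∈ (E 3).space 3 := by
  rw [mem_merge₃ (p := 3) (q := b) (by dsimp only [path₃]; omega) (by dsimp only [path₃]; omega),
    CompleteFlag.space_eq_top _ _ le_rfl, and_iff_left mem_top]

theorem mem_merge_Q : z ∈ (firstFive (mergeInstance hb hρ E X G) 4).space (b + 2 + 1) ↔
    ρ z ∈ (E 4).space 3 := by
  rw [mem_merge₄ (p := 3) (q := b) (by dsimp only [path₃]; omega) (by dsimp only [path₃]; omega),
    CompleteFlag.space_eq_top _ _ le_rfl, and_iff_left mem_top]

theorem dep_iff_of_mem_iff {S : Submodule ℂ A} {S' : Submodule ℂ V}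
    (h : ∀ z, z ∈ S ↔ ρ z ∈ S') {u w : A} : Dep S u w ↔ Dep S' (ρ u) (ρ w) := by
  simp only [Dep, h, map_add, map_smul]

theorem aligned_merge {x t m : A} :
    Aligned ((firstFive (mergeInstance hb hρ E X G) 3).space (b + 2 + 1))
      ((firstFive (mergeInstance hb hρ E X G) 4).space (b + 2 + 1)) x t m ↔
    Aligned ((E 3).space 3) ((E 4).space 3) (ρ x) (ρ t) (ρ m) := by
  have h1 := fun {u w : A} => dep_iff_of_mem_iff (u := u) (w := w)
    fun z => mem_merge_P (hb := hb) (hρ := hρ) (E := E) (X := X) (G := G) (z := z)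
  have h2 := fun {u w : A} => dep_iff_of_mem_iff (u := u) (w := w)
    fun z => mem_merge_Q (hb := hb) (hρ := hρ) (E := E) (X := X) (G := G) (z := z)
  constructor
  · rintro ⟨a1, a2, a3, a4⟩
    exact ⟨h1.1 a1, h1.1 a2, h2.1 a3, h2.1 a4⟩
  · rintro ⟨a1, a2, a3, a4⟩
    exact ⟨h1.2 a1, h1.2 a2, h2.2 a3, h2.2 a4⟩

/-- `x` lies in `V`. Dependence of `x` and `t` modulo `M`, together with `L ∩ M = 0`, puts the image
of `t` in `A / V` into `G₂` of the second flag; it also lies in `G_{b-2}` of the third, so it is 0.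
All pairs therefore come from `V`. -/
theorem GoodBase.isPair_of_merge (hE : GoodBase E X) (hG : GoodFiber G) {x t : A}
    (hp : IsPairOf 5 b (b + 2) (firstFive (mergeInstance hb hρ E X G)) x t) :
    V.mkQ x = 0 ∧ V.mkQ t = 0 ∧ IsPairOf 3 2 2 E (ρ x) (ρ t) := by
  obtain ⟨hxE, hx⟩ := mem_merge_L.1 hp.left_mem
  obtain ⟨htE, ht⟩ := mem_merge_T.1 hp.right_mem
  have hx0 : ρ x ≠ 0 := fun h => hp.left_ne (eq_zero_of_projection hρ h hx)
  obtain ⟨c, d, h0, h⟩ := hp.depM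
  rw [mem_merge_M] at h
  simp only [map_add, map_smul, hx, smul_zero, zero_add] at h
  have hd : d ≠ 0 := by
    rintro rfl
    rw [zero_smul, add_zero] at h
    have := hE.generic.LM _ (smul_mem _ c hxE) h.1
    rw [smul_eq_zero] at this
    simp_all
  have ht0 : V.mkQ t = 0 := hG.disjoint₁₂ _ ((smul_mem_iff _ hd).1 h.2) ht
  exact ⟨hx, ht0, hx0, fun h => hp.right_ne (eq_zero_of_projection hρ h ht0), hxE, htE,
    ⟨c, d, h0, h.1⟩, (dep_iff_of_mem_iff fun z => mem_merge_P).1 hp.depP,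
    (dep_iff_of_mem_iff fun z => mem_merge_Q).1 hp.depQ⟩

/-- The components in `V` of aligned vectors of `M` and `T` are multiples `e • q` and `f • t`, where
`q` is the vector of the plane in `M`. Thus `hY'` disposes of these components, and `hY` with
`disjoint₁₂` of those in `A / V`. -/
theorem GoodBase.avoids_merge (hE : GoodBase E X) (hG : GoodFiber G) {x t : A}
    (hp : IsPairOf 5 b (b + 2) (firstFive (mergeInstance hb hρ E X G)) x t) {Y : Submodule ℂ A}
    (hY : ∀ z ∈ Y, V.mkQ z = 0)
    (hY' : ∀ c d : ℂ, c ≠ 0 → c • ρ x + d • ρ t ∈ (E 1).space 3 →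
      c • ρ x + d • ρ t ∉ (E 2).space 4 → ρ t ∉ (E 1).space 4 →
      ∀ e f : ℂ, ∀ z ∈ Y, ρ z = e • (c • ρ x + d • ρ t) + f • ρ t → e = 0 ∧ f = 0) :
    AvoidsOf (firstFive (mergeInstance hb hρ E X G)) Y x t := by
  intro m hm w hw ham haw hmw
  obtain ⟨hx, ht, hp'⟩ := hE.isPair_of_merge hG hp
  rw [aligned_merge] at ham haw
  rw [mem_merge_M] at hm
  rw [mem_merge_T] at hw
  obtain ⟨c, d, hc, h1, h2, h3, h4, h5⟩ := hE.generic.exists_aligned hp'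
  obtain ⟨e, he⟩ := h4 _ hm.1 ham
  obtain ⟨f, hf⟩ := h5 _ hw.1 haw
  obtain ⟨rfl, rfl⟩ := hY' c d hc h1 h2 h3 e f _ hmw (by rw [map_add, he, hf])
  have hsum := hY _ hmw
  rw [map_add] at hsum
  have hw0 : V.mkQ w = 0 := by
    refine hG.disjoint₁₂ _ ?_ hw.2
    rw [← neg_eq_of_add_eq_zero_right hsum]
    exact neg_mem hm.2
  rw [hw0, add_zero] at hsum
  exact ⟨eq_zero_of_projection hρ (by rw [he, zero_smul]) hsum,
    eq_zero_of_projection hρ (by rw [hf, zero_smul]) hw0⟩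

/-- Since `P` and `Q` contain the kernel of `ρ`, alignment is tested on components in `V`. Each
requirement reduces there to general position of `E` and `X`, and in `A / V` to `GoodFiber`. -/
theorem GoodBase.goodInstance (hE : GoodBase E X) (hG : GoodFiber G) :
    GoodInstance (mergeInstance hb hρ E X G) := by
  have eq0 : ∀ z : A, ρ z = 0 → V.mkQ z = 0 → z = 0 := fun z => eq_zero_of_projection hρ
  -- the two linear conditions on multiples of `q` and `t`
  have lin : ∀ {S : Submodule ℂ V} {x t : V} {c d e f : ℂ}, ¬ Dep S x t → c ≠ 0 →
      e • (c • x + d • t) + f • t ∈ S → e = 0 ∧ f = 0 := by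
    intro S x t c d e f hS hc h
    have h' : (e * c) • x + (e * d + f) • t ∈ S := by
      convert h using 1
      module
    by_contra hcon
    refine hS ⟨e * c, e * d + f, ?_, h'⟩
    by_contra! h0
    have he := (mul_eq_zero.1 h0.1).resolve_right hc
    have hf := h0.2
    rw [he, zero_mul, zero_add] at hf
    exact hcon ⟨he, hf⟩
  have lin' : ∀ {S S' : Submodule ℂ V} {q t : V} {e f : ℂ}, t ∈ S → q ∉ S → t ∉ S' →
      e • q + f • t ∈ S → (e = 0 → e • q + f • t ∈ S') → e = 0 ∧ f = 0 := by
    intro S S' q t e f ht hq ht' h h'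
    have he : e = 0 := by
      by_contra he
      refine hq ((smul_mem_iff _ he).1 ?_)
      have := sub_mem h (smul_mem _ f ht)
      rwa [add_sub_cancel_right] at this
    refine ⟨he, ?_⟩
    by_contra hf
    have := h' he
    rw [he, zero_smul, zero_add] at this
    exact ht' ((smul_mem_iff _ hf).1 this)
  refine ⟨⟨?_, ?_, ?_, ?_, ?_⟩, ?_, ?_, ?_, ?_, ?_, ?_, ?_⟩
  · intro w hw hw'
    rw [mem_merge_L] at hw
    rw [mem_merge_M] at hw'
    exact eq0 w (hE.generic.LM _ hw.1 hw'.1) hw.2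
  · intro w hw hw'
    rw [mem_merge_L] at hw
    rw [mem_merge_T] at hw'
    exact eq0 w (hE.generic.LT _ hw.1 hw'.1) hw.2
  · intro x₁ h₁ x₂ h₂ x₃ h₃ t₂ k₂ t₃ k₃
    simp only [mem_merge_L, mem_merge_M, mem_merge_T, mem_merge_P, mem_merge_Q, map_add] at *
    intro l1 l2 l3 l4 l5 l6
    rw [h₂.2, zero_add] at l1
    rw [h₃.2, zero_add] at l3
    obtain ⟨e1, e2, e3, e4, e5⟩ := hE.generic.indepM _ h₁.1 _ h₂.1 _ h₃.1 _ k₂.1 _ k₃.1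
      l1.1 l2 l3.1 l4 l5 l6
    exact ⟨eq0 _ e1 h₁.2, eq0 _ e2 h₂.2, eq0 _ e3 h₃.2,
      eq0 _ e4 (hG.disjoint₁₂ _ l1.2 k₂.2), eq0 _ e5 (hG.disjoint₁₂ _ l3.2 k₃.2)⟩
  · intro x₁ h₁ x₂ h₂ x₃ h₃ t₂ k₂ t₃ k₃
    simp only [mem_merge_L, mem_merge_M, mem_merge_T, mem_merge_P, mem_merge_Q, map_add] at *
    intro l1 l2 l3 l4 l5 l6
    rw [h₂.2, zero_add] at l1
    rw [h₃.2, zero_add] at l3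
    obtain ⟨e1, e2, e3, e4, e5⟩ := hE.generic.indepT _ h₁.1 _ h₂.1 _ h₃.1 _ k₂.1 _ k₃.1
      l1.1 l2 l3.1 l4 l5 l6
    exact ⟨eq0 _ e1 h₁.2, eq0 _ e2 h₂.2, eq0 _ e3 h₃.2,
      eq0 _ e4 (hG.disjoint₁₂ _ k₂.2 l1.2), eq0 _ e5 (hG.disjoint₁₂ _ k₃.2 l3.2)⟩
  · intro x t hp
    obtain ⟨hx, ht, hp'⟩ := hE.isPair_of_merge hG hp
    obtain ⟨g1, g2, g3, g4, g5, g6⟩ := hE.generic.pair _ _ hp'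
    refine ⟨fun h => g1 ?_, ?_, ?_, fun h => g4 ?_, ?_, ?_⟩
    · exact ((mem_merge₀ (p := 4) (q := b) (by dsimp only [path₀]; omega)
        (by dsimp only [path₀]; omega)).1 h).1
    · intro x' hx' w hw hM hY ha
      have hY := ((mem_merge₂ (p := 4) (q := b) (by dsimp only [path₂]; omega)
        (by dsimp only [path₂]; omega)).1 hY).1
      rw [aligned_merge] at ha
      rw [mem_merge_L] at hx'
      rw [mem_merge_T] at hw
      rw [mem_merge_M] at hM
      rw [map_add] at ha hY
      rw [map_add, map_add, hx'.2, zero_add] at hM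
      obtain ⟨e1, e2⟩ := g2 _ hx'.1 _ hw.1 hM.1 hY ha
      exact ⟨eq0 _ e1 hx'.2, eq0 _ e2 (hG.disjoint₁₂ _ hM.2 hw.2)⟩
    · intro x' hx' w hw hM hY ha
      have hY := ((mem_merge₁ (p := 4) (q := b) (by dsimp only [path₁]; omega)
        (by dsimp only [path₁]; omega)).1 hY).1
      rw [aligned_merge] at ha
      rw [mem_merge_L] at hx'
      rw [mem_merge_M] at hw
      rw [mem_merge_T] at hM
      rw [map_add] at ha hY
      rw [map_add, map_add, hx'.2, zero_add] at hM
      obtain ⟨e1, e2⟩ := g3 _ hx'.1 _ hw.1 hM.1 hY ha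
      exact ⟨eq0 _ e1 hx'.2, eq0 _ e2 (hG.disjoint₁₂ _ hw.2 hM.2)⟩
    · exact ((mem_merge₂ (p := 2) (q := b - 2) (by dsimp only [path₂]; omega)
        (by dsimp only [path₂]; omega)).1 h).1
    · rintro ⟨c, d, h0, h⟩
      refine g5 ⟨c, d, h0, ?_⟩
      rw [← map_smul, ← map_smul, ← map_add]
      exact ((mem_merge₃ (p := 2) (q := b) (by dsimp only [path₃]; omega)
        (by dsimp only [path₃]; omega)).1 h).1
    · rintro ⟨c, d, h0, h⟩
      refine g6 ⟨c, d, h0, ?_⟩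
      rw [← map_smul, ← map_smul, ← map_add]
      exact ((mem_merge₄ (p := 2) (q := b) (by dsimp only [path₃]; omega)
        (by dsimp only [path₃]; omega)).1 h).1
  · intro x t hp
    obtain ⟨hx, ht, hp'⟩ := hE.isPair_of_merge hG hp
    have m0 := fun z => mem_merge₀ (hb := hb) (hρ := hρ) (E := E) (X := X) (G := G) (z := z)
      (m := 5) (p := 4) (q := 1) (by dsimp only [path₀]; omega) (by dsimp only [path₀]; omega)
    have m2 := fun z => mem_merge₂ (hb := hb) (hρ := hρ) (E := E) (X := X) (G := G) (z := z)
      (m := b + 3) (p := 4) (q := b - 1) (by dsimp only [path₂]; omega)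
      (by dsimp only [path₂]; omega)
    refine hE.avoids_merge hG hp (fun z hz => ?_) fun c d hc h1 h2 h3 e f z hz hze => ?_
    · exact hG.disjoint₀₂ _ ((m0 z).1 hz.1).2 ((m2 z).1 hz.2).2
    · have k1 := ((m0 z).1 hz.1).1
      have k2 := ((m2 z).1 hz.2).1
      rw [hze] at k1 k2
      exact lin' ((E 2).mono (by omega) hp'.right_mem) h2 (hE.generic.pair _ _ hp').1 k2
        fun _ => k1
  · intro x t hp
    obtain ⟨hx, ht, hp'⟩ := hE.isPair_of_merge hG hp
    have m1 := fun z => mem_merge₁ (hb := hb) (hρ := hρ) (E := E) (X := X) (G := G) (z := z)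
      (m := 6) (p := 4) (q := 2) (by dsimp only [path₁]; omega) (by dsimp only [path₁]; omega)
    have m2 := fun z => mem_merge₂ (hb := hb) (hρ := hρ) (E := E) (X := X) (G := G) (z := z)
      (m := b + 2) (p := 4) (q := b - 2) (by dsimp only [path₂]; omega)
      (by dsimp only [path₂]; omega)
    refine hE.avoids_merge hG hp (fun z hz => ?_) fun c d hc h1 h2 h3 e f z hz hze => ?_
    · exact hG.disjoint₁₂ _ ((m1 z).1 hz.1).2 ((m2 z).1 hz.2).2
    · have k1 := ((m1 z).1 hz.1).1
      have k2 := ((m2 z).1 hz.2).1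
      rw [hze] at k1 k2
      exact lin' ((E 2).mono (by omega) hp'.right_mem) h2 h3 k2 fun _ => k1
  · intro x t hp
    obtain ⟨hx, ht, hp'⟩ := hE.isPair_of_merge hG hp
    have m2 := fun z => mem_merge₂ (hb := hb) (hρ := hρ) (E := E) (X := X) (G := G) (z := z)
      (m := 2) (p := 2) (q := 0) (by dsimp only [path₂]; omega) (by dsimp only [path₂]; omega)
    rw [inf_idem]
    refine hE.avoids_merge hG hp (fun z hz => ?_) fun c d hc h1 h2 h3 e f z hz hze => ?_
    · have := ((m2 z).1 hz).2
      rwa [CompleteFlag.space_zero, mem_bot] at this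
    · have k := ((m2 z).1 hz).1
      rw [hze] at k
      exact lin' ((E 2).mono (by omega) hp'.right_mem) h2 (hE.generic.pair _ _ hp').2.2.2.1
        ((E 2).mono (by omega) k) fun _ => k
  · intro x t hp
    obtain ⟨hx, ht, hp'⟩ := hE.isPair_of_merge hG hp
    have m3 := fun z => mem_merge₃ (hb := hb) (hρ := hρ) (E := E) (X := X) (G := G) (z := z)
      (m := 2) (p := 2) (q := 0) (by dsimp only [path₃]; omega) (by dsimp only [path₃]; omega)
    rw [inf_idem]
    refine hE.avoids_merge hG hp (fun z hz => ?_) fun c d hc h1 h2 h3 e f z hz hze => ?_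
    · have := ((m3 z).1 hz).2
      rwa [CompleteFlag.space_zero, mem_bot] at this
    · have k := ((m3 z).1 hz).1
      rw [hze] at k
      exact lin (hE.generic.pair _ _ hp').2.2.2.2.1 hc k
  · intro x t hp
    obtain ⟨hx, ht, hp'⟩ := hE.isPair_of_merge hG hp
    have m4 := fun z => mem_merge₄ (hb := hb) (hρ := hρ) (E := E) (X := X) (G := G) (z := z)
      (m := 2) (p := 2) (q := 0) (by dsimp only [path₃]; omega) (by dsimp only [path₃]; omega)
    rw [inf_idem]
    refine hE.avoids_merge hG hp (fun z hz => ?_) fun c d hc h1 h2 h3 e f z hz hze => ?_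
    · have := ((m4 z).1 hz).2
      rwa [CompleteFlag.space_zero, mem_bot] at this
    · have k := ((m4 z).1 hz).1
      rw [hze] at k
      exact lin (hE.generic.pair _ _ hp').2.2.2.2.2 hc k
  · rintro j x t hp ⟨c, d, h0, h⟩
    refine hE.not_dep _ _ (hE.isPair_of_merge hG hp).2.2 ⟨c, d, h0, ?_⟩
    rw [← map_smul, ← map_smul, ← map_add]
    exact ((mem_merge₅ (p := 3) (q := b) (by dsimp only [path₅]; omega)
      (by dsimp only [path₅]; omega)).1 h).1
  · intro j x t hp
    obtain ⟨hx, ht, hp'⟩ := hE.isPair_of_merge hG hp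
    have m5 := fun z => mem_merge₅ (hb := hb) (hρ := hρ) (E := E) (X := X) (G := G) (z := z)
      (j := j) (m := 3) (p := 3) (q := 0) (by dsimp only [path₅]; omega)
      (by dsimp only [path₅]; omega)
    rw [inf_idem]
    refine hE.avoids_merge hG hp (fun z hz => ?_) fun c d hc h1 h2 h3 e f z hz hze => ?_
    · have := ((m5 z).1 hz).2
      rwa [CompleteFlag.space_zero, mem_bot] at this
    · have k := ((m5 z).1 hz).1
      rw [hze] at k
      exact lin (hE.not_dep _ _ hp') hc k

end Split

/-! ### Recovering the two flags from a merged one -/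

section Recover

set_option linter.unusedSectionVars false

variable {A : Type*} [AddCommGroup A] [Module ℂ A] [FiniteDimensional ℂ A] {V : Submodule ℂ A}
  {b r : ℕ} {hb : 2 ≤ b} {ρ : A →ₗ[ℂ] V} {hρ : ∀ v : V, ρ v = v}
  {E : Fin 5 → CompleteFlag 5 V} {X : CompleteFlag 5 V} {G : Fin (5 + r) → CompleteFlag b (A ⧸ V)}

theorem mkQ_coe (v : V) : V.mkQ v = 0 := (Quotient.mk_eq_zero V).2 v.2

theorem comap_mergeFlag {n : ℕ} (p : MergePath n b) (E : CompleteFlag n V)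
    (G : CompleteFlag b (A ⧸ V)) (m : ℕ) :
    ((mergeFlag hρ p E G).space m).comap V.subtype = E.space (p.fst m) := by
  ext v
  rw [mem_comap, subtype_apply, mem_mergeFlag (hρ := hρ), hρ, mkQ_coe,
    and_iff_left (zero_mem _)]

theorem map_mergeFlag {n : ℕ} (p : MergePath n b) (E : CompleteFlag n V)
    (G : CompleteFlag b (A ⧸ V)) (m : ℕ) :
    ((mergeFlag hρ p E G).space m).map V.mkQ = G.space (m - p.fst m) := by
  refine le_antisymm (map_le_iff_le_comap.2 inf_le_right) fun y hy => ?_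
  obtain ⟨z, rfl⟩ := V.mkQ_surjective y
  have hz : V.mkQ (z - ρ z) = V.mkQ z := by rw [map_sub, mkQ_coe, sub_zero]
  refine ⟨z - ρ z, (mem_mergeFlag (hρ := hρ)).2 ⟨?_, by rwa [hz]⟩, hz⟩
  rw [map_sub, hρ, sub_self]
  exact zero_mem _

/-- A discrete intermediate value argument: `fst` increases by at most one at each step, because `m
- fst m` does not decrease. -/
theorem MergePath.exists_fst {n : ℕ} (p : MergePath n b) {k : ℕ} (hk : k ≤ n) :
    ∃ m, p.fst m = k := by
  classical
  have hex : ∃ m, k ≤ p.fst m := ⟨n + b, hk.trans (p.ge _ le_rfl).1⟩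
  refine ⟨Nat.find hex, le_antisymm ?_ (Nat.find_spec hex)⟩
  have hle : Nat.find hex ≤ n + b := Nat.find_le (hk.trans (p.ge _ le_rfl).1)
  have hmin := fun m => Nat.find_min hex (m := m)
  generalize Nat.find hex = m at hle hmin
  have h1 := (p.le m hle).2.1
  rcases m with - | m
  · omega
  · have h2 := hmin m (by omega)
    have h3 := (p.le m (by omega)).2.1
    have h4 : m - p.fst m ≤ m + 1 - p.fst (m + 1) := p.mono' (by omega)
    omega

theorem MergePath.exists_snd {n : ℕ} (p : MergePath n b) {k : ℕ} (hk : k ≤ b) :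
    ∃ m, m - p.fst m = k := by
  classical
  have hex : ∃ m, k ≤ m - p.fst m := ⟨n + b, hk.trans (p.ge _ le_rfl).2⟩
  refine ⟨Nat.find hex, le_antisymm ?_ (Nat.find_spec hex)⟩
  have hle : Nat.find hex ≤ n + b := Nat.find_le (hk.trans (p.ge _ le_rfl).2)
  have hmin := fun m => Nat.find_min hex (m := m)
  generalize Nat.find hex = m at hle hmin
  rcases m with - | m
  · omega
  · have h2 := hmin m (by omega)
    have h4 : p.fst m ≤ p.fst (m + 1) := p.mono (by omega)
    omega

/-- Intersection with `V` returns `E` and projection to `A / V` returns `G`, neither involving the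
projection `ρ`; so `ρ` and `ρ'` may differ. -/
theorem mergeFlag_inj {n : ℕ} {p : MergePath n b} {ρ' : A →ₗ[ℂ] V} {hρ' : ∀ v : V, ρ' v = v}
    {E E' : CompleteFlag n V} {G G' : CompleteFlag b (A ⧸ V)}
    (h : mergeFlag hρ p E G = mergeFlag hρ' p E' G') : E = E' ∧ G = G' := by
  constructor
  · ext1
    funext k
    rcases le_total n k with hk | hk
    · rw [E.space_eq_top k hk, E'.space_eq_top k hk]
    · obtain ⟨m, rfl⟩ := p.exists_fst hk
      rw [← comap_mergeFlag (hρ := hρ) p E G, h, comap_mergeFlag]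
  · ext1
    funext k
    rcases le_total b k with hk | hk
    · rw [G.space_eq_top k hk, G'.space_eq_top k hk]
    · obtain ⟨m, rfl⟩ := p.exists_snd hk
      rw [← map_mergeFlag (hρ := hρ) p E G, h, map_mergeFlag]

theorem mergeInstance_inj {ρ' : A →ₗ[ℂ] V} {hρ' : ∀ v : V, ρ' v = v}
    {E' : Fin 5 → CompleteFlag 5 V} {X' : CompleteFlag 5 V}
    {G' : Fin (5 + r) → CompleteFlag b (A ⧸ V)}
    (h : mergeInstance hb hρ E X G = mergeInstance hb hρ' E' X' G') : E = E' ∧ G = G' := by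
  have h' := fun i => congrFun h i
  obtain ⟨⟨h0, h1, h2, h3, h4⟩, h5⟩ := forall_fin_five_add.1 h'
  simp only [mergeInstance, Fin.append_left, Fin.append_right] at h0 h1 h2 h3 h4 h5
  obtain ⟨e0, g0⟩ := mergeFlag_inj (hρ := hρ) (hρ' := hρ') h0
  obtain ⟨e1, g1⟩ := mergeFlag_inj (hρ := hρ) (hρ' := hρ') h1
  obtain ⟨e2, g2⟩ := mergeFlag_inj (hρ := hρ) (hρ' := hρ') h2
  obtain ⟨e3, g3⟩ := mergeFlag_inj (hρ := hρ) (hρ' := hρ') h3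
  obtain ⟨e4, g4⟩ := mergeFlag_inj (hρ := hρ) (hρ' := hρ') h4
  refine ⟨?_, funext (forall_fin_five_add.2 ⟨⟨g0, g1, g2, g3, g4⟩,
    fun i => (mergeFlag_inj (hρ := hρ) (hρ' := hρ') (h5 i)).2⟩)⟩
  funext i
  fin_cases i <;> assumption

/-- The image of `Z ∩ S` is contained in the corresponding `Gᵢ` and has dimension `i` by
`FlagDimensions`, so it equals `Gᵢ`. In particular the induced flags are the same for all `h`. -/
theorem GoodBase.compatible (hV : finrank ℂ V = 5) (hE : GoodBase E X) (hG : GoodFiber G) :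
    Compatible (mergeInstance hb hρ E X G) ⟨V, hV, E, fun _ => G⟩ := by
  have good := hE.goodInstance (hb := hb) (hρ := hρ) hG
  set F := mergeInstance hb hρ E X G with hFdef
  have hd : ∀ m ≤ 5, ∀ i, finrank ℂ ((E i).space m) = m := fun m hm i => (E i).finrank_space m hm
  have hLM : (E 0).space 2 ⊔ (E 1).space 3 = ⊤ := sup_eq_top_of_disjoint hE.generic.LM
    (by rw [hd _ (by omega), hd _ (by omega), hV])
  have hLT : (E 0).space 2 ⊔ (E 2).space 3 = ⊤ := sup_eq_top_of_disjoint hE.generic.LT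
    (by rw [hd _ (by omega), hd _ (by omega), hV])
  have E₀ : (E 0).space 2 = ((firstFive F 0).space 2).comap V.subtype := by
    ext v
    rw [mem_comap, subtype_apply, mem_merge_L, hρ, mkQ_coe, and_iff_left rfl]
  have E₁ : (E 1).space 3 = ((firstFive F 1).space 5).comap V.subtype := by
    ext v
    rw [mem_comap, subtype_apply, mem_merge_M, hρ, mkQ_coe, and_iff_left (zero_mem _)]
  have E₂ : (E 2).space 3 = ((firstFive F 2).space (b + 1)).comap V.subtype := by
    ext v
    rw [mem_comap, subtype_apply, mem_merge_T, hρ, mkQ_coe, and_iff_left (zero_mem _)]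
  have E₃ : (E 3).space 3 = ((firstFive F 3).space (b + 3)).comap V.subtype := by
    ext v
    rw [mem_comap, subtype_apply]
    have h := mem_merge_P (hb := hb) (hρ := hρ) (E := E) (X := X) (G := G) (z := (v : A))
    rw [hρ] at h
    exact h.symm
  have E₄ : (E 4).space 3 = ((firstFive F 4).space (b + 3)).comap V.subtype := by
    ext v
    rw [mem_comap, subtype_apply]
    have h := mem_merge_Q (hb := hb) (hρ := hρ) (E := E) (X := X) (G := G) (z := (v : A))
    rw [hρ] at h
    exact h.symm
  have hVeq : V = baseSpace ((firstFive F 0).space 2) ((firstFive F 1).space 5)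
      ((firstFive F 2).space (b + 1)) := by
    have hd' : ∀ m ≤ 5 + b, ∀ i, finrank ℂ ((firstFive F i).space m) = m := fun m hm i =>
      (firstFive F i).finrank_space m hm
    have hle : ∀ {S S' : Submodule ℂ A},
        S.comap V.subtype ⊔ S'.comap V.subtype = ⊤ → V ≤ S ⊔ S' := by
      intro S S' h v hv
      obtain ⟨s, hs, s', hs', h⟩ := mem_sup.1 (h.ge (mem_top (x := (⟨v, hv⟩ : V))))
      exact mem_sup.2 ⟨s, hs, s', hs', congrArg Subtype.val h⟩
    refine eq_of_le_of_finrank_le (le_inf (hle (by rw [← E₀, ← E₁, hLM]))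
      (hle (by rw [← E₀, ← E₂, hLT]))) ?_
    rw [hV, (finrank_baseSpace (firstFive F 0).finrank_eq (hd' 2 (by omega) 0)
      (by rw [hd' 5 (by omega) 1, hd' (b + 1) (by omega) 2]; omega) (hd' (b + 3) (by omega) 3)
      (hd' (b + 3) (by omega) 4) good.generic.LM good.generic.LT good.generic.indepM).1]
  have key : ∀ h ∈ solutions 2 5 baseProblem E, ∀ (f : CompleteFlag (5 + b) A) (S : Submodule ℂ A)
      (g : CompleteFlag b (A ⧸ V)) (i : ℕ), i ≤ b → (∀ z ∈ S, V.mkQ z ∈ g.space i) →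
      finrank ℂ (fiberSpaceOf (firstFive F) (h.map V.subtype) ⊓ S : Submodule ℂ A) =
        i + finrank ℂ (h.map V.subtype ⊓ S : Submodule ℂ A) →
      g.space i = (fiberSpaceOf (firstFive F) (h.map V.subtype) ⊓ S).map V.mkQ := by
    intro h hh f S g i hi hS hf
    have O := good.overSolution hVeq E₀ E₁ E₂ E₃ E₄ hh
    symm
    refine eq_of_le_of_finrank_eq (map_le_iff_le_comap.2 fun z hz => hS z hz.2) ?_
    rw [g.finrank_space i hi]
    have := finrank_map_inf_mkQ O.inf_eq S
    omega
  refine ⟨hVeq, E₀, E₁, E₂, E₃, E₄, ?_, ?_, ?_, ?_, ?_, ?_⟩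
  · intro h hh i h1 h2
    have O := good.overSolution hVeq E₀ E₁ E₂ E₃ E₄ hh
    refine key h hh (firstFive F 0) _ _ i h2 (fun z hz => ?_) ?_
    · exact ((mem_merge₀ (p := 4) (q := i) (by dsimp only [path₀]; omega)
        (by dsimp only [path₀]; omega)).1 hz).2
    · have e1 := O.Z₀ (i + 4) (by omega) (by omega)
      have e2 := O.h₀ (i + 4) (by omega) (by omega)
      omega
  · intro h hh i h1 h2
    have O := good.overSolution hVeq E₀ E₁ E₂ E₃ E₄ hh
    refine key h hh (firstFive F 1) _ _ i h2 (fun z hz => ?_) ?_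
    · exact ((mem_merge₁ (p := 4) (q := i) (by dsimp only [path₁]; omega)
        (by dsimp only [path₁]; omega)).1 hz).2
    · have e1 := O.Z₁ (i + 4) (by omega) (by omega)
      have e2 := O.h₁ (i + 4) (by omega) (by omega)
      omega
  · intro h hh i hi
    have O := good.overSolution hVeq E₀ E₁ E₂ E₃ E₄ hh
    refine key h hh (firstFive F 2) _ _ i (by omega) (fun z hz => ?_) ?_
    · exact ((mem_merge₂ (p := 2) (q := i) (by dsimp only [path₂]; omega)
        (by dsimp only [path₂]; omega)).1 hz).2
    · have e1 := O.Z₂ (i + 2) (by omega) (by omega)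
      have e2 := O.h₂ (i + 2) (by omega)
      omega
  · intro h hh i hi
    have O := good.overSolution hVeq E₀ E₁ E₂ E₃ E₄ hh
    refine key h hh (firstFive F 3) _ _ i hi (fun z hz => ?_) ?_
    · exact ((mem_merge₃ (p := 2) (q := i) (by dsimp only [path₃]; omega)
        (by dsimp only [path₃]; omega)).1 hz).2
    · have e1 := O.Z₃ (i + 2) (by omega) (by omega)
      have e2 := O.h₃ (i + 2) (by omega)
      omega
  · intro h hh i hi
    have O := good.overSolution hVeq E₀ E₁ E₂ E₃ E₄ hh
    refine key h hh (firstFive F 4) _ _ i hi (fun z hz => ?_) ?_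
    · exact ((mem_merge₄ (p := 2) (q := i) (by dsimp only [path₃]; omega)
        (by dsimp only [path₃]; omega)).1 hz).2
    · have e1 := O.Z₄ (i + 2) (by omega) (by omega)
      have e2 := O.h₄ (i + 2) (by omega)
      omega
  · intro h hh j i hi
    have O := good.overSolution hVeq E₀ E₁ E₂ E₃ E₄ hh
    refine key h hh (F (Fin.natAdd 5 j)) _ _ i hi (fun z hz => ?_) ?_
    · exact ((mem_merge₅ (p := 3) (q := i) (by dsimp only [path₅]; omega)
        (by dsimp only [path₅]; omega)).1 hz).2
    · have e1 := O.Z₅ j (i + 3) (by omega) (by omega)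
      have e2 := O.h₅ j (i + 3) (by omega)
      omega

end Recover

/-! ### The Schubert problems -/

section Problems

theorem sum_addRow (r n : ℕ) (p : ℕ → ℕ) :
    ∑ j ∈ Finset.range (n + 1), addRow r p j = r + ∑ j ∈ Finset.range n, p j := by
  rw [Finset.sum_range_succ', add_comm]
  rfl

theorem sum_rect_add (r m : ℕ) {n : ℕ} (h : m ≤ n) (p : ℕ → ℕ) :
    ∑ j ∈ Finset.range n, (rect r m + p) j = m * r + ∑ j ∈ Finset.range n, p j := by
  simp only [Pi.add_apply, Finset.sum_add_distrib, add_left_inj, rect]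
  rw [← Finset.sum_filter]
  have : (Finset.range n).filter (· < m) = Finset.range m := by
    ext j
    simp only [Finset.mem_filter, Finset.mem_range]
    omega
  rw [this, Finset.sum_const, Finset.card_range, smul_eq_mul]

theorem sum_range_add_of_eq_zero {p : ℕ → ℕ} (hp : Antitone p) {m : ℕ} (hm : p m = 0) (k : ℕ) :
    ∑ j ∈ Finset.range (m + k), p j = ∑ j ∈ Finset.range m, p j := by
  rw [Finset.sum_range_add, Nat.add_eq_left]
  exact Finset.sum_eq_zero fun j _ => Nat.le_zero.1 (hm ▸ hp (Nat.le_add_right m j))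

theorem antitone_addRow {r : ℕ} {p : ℕ → ℕ} (hp : Antitone p) (h : p 0 ≤ r) :
    Antitone (addRow r p) :=
  antitone_nat_of_succ_le fun j => by
    cases j with
    | zero => exact h
    | succ j => exact hp (Nat.le_succ j)

theorem antitone_rect (r m : ℕ) : Antitone (rect r m) := fun i j h => by
  simp only [rect]
  split_ifs <;> omega

theorem isSchubertProblem_baseProblem : IsSchubertProblem 2 5 baseProblem := by
  refine ⟨fun i => ?_, by simp [Fin.sum_univ_succ, Finset.sum_range_succ, rect]⟩
  fin_cases i <;> exact ⟨antitone_rect _ _, by simp [rect], by simp [rect]⟩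

theorem isSchubertProblem_totalProblem {a b : ℕ} (ha : 0 < a) (hab : a < b) {r : ℕ}
    {ν₁ κ ρ ν₄ ν₅ : ℕ → ℕ} {τ : Fin r → ℕ → ℕ} (hκ : Antitone κ) (hρ : Antitone ρ)
    (hρa : ρ (a - 1) = 0) (hν : IsSchubertProblem a b (fiberProblem a b ν₁ κ ρ ν₄ ν₅ τ)) :
    IsSchubertProblem (2 + a) (5 + b) (totalProblem a b ν₁ κ ρ ν₄ ν₅ τ) := by
  obtain ⟨hpart, hsum⟩ := hν
  obtain ⟨⟨n1, n2, n3, n4, n5⟩, nt⟩ := forall_fin_five_add.1 hpart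
  simp only [Fin.append_left, Fin.append_right] at n1 n2 n3 n4 n5 nt
  have n1 : IsPartitionFor a b ν₁ := n1
  have n2 : IsPartitionFor a b (addRow (b - a - 1) κ) := n2
  have n3 : IsPartitionFor a b (rect 1 (a - 1) + ρ) := n3
  have n4 : IsPartitionFor a b ν₄ := n4
  have n5 : IsPartitionFor a b ν₅ := n5
  obtain ⟨c, rfl⟩ : ∃ c, b = a + 1 + c := ⟨b - a - 1, by omega⟩
  obtain ⟨a, rfl⟩ := Nat.exists_eq_succ_of_ne_zero ha.ne'
  have ec : a + 1 + 1 + c - (a + 1) = c + 1 := by omega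
  have ec' : c + 1 - 1 = c := by omega
  have ec'' : 5 + (a + 1 + 1 + c) - (2 + (a + 1)) = c + 4 := by omega
  simp only [Nat.succ_eq_add_one, Nat.add_sub_cancel, IsPartitionFor, IsSchubertProblem,
    fiberProblem, totalProblem, ec, ec', ec''] at *
  have hκ0 : κ 0 ≤ c := n2.1 (Nat.zero_le 1)
  have hκa : κ a = 0 := n2.2.2
  have hρ0 : ρ 0 ≤ c + 1 := le_trans (Nat.le_add_left _ _) n3.2.1
  have vanish : ∀ {p : ℕ → ℕ} {m : ℕ} (k : ℕ), Antitone p → p m = 0 → m ≤ k → p k = 0 :=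
    fun k hp hm h => Nat.le_zero.1 (hm ▸ hp h)
  have hcol : ∀ {p : ℕ → ℕ}, (Antitone p ∧ p 0 ≤ c + 1 ∧ p (a + 1) = 0) →
      (Antitone (rect 1 (a + 1 + 1) + p) ∧ (rect 1 (a + 1 + 1) + p) 0 ≤ c + 4 ∧
        (rect 1 (a + 1 + 1) + p) (2 + (a + 1)) = 0) := by
    intro p hp
    refine ⟨(antitone_rect _ _).add hp.1, ?_, ?_⟩
    · have := hp.2.1
      simp only [Pi.add_apply, rect, if_pos (show 0 < a + 1 + 1 by omega)]
      omega
    · simp only [Pi.add_apply, rect, if_neg (show ¬ 2 + (a + 1) < a + 1 + 1 by omega),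
        vanish (2 + (a + 1)) hp.1 hp.2.2 (by omega)]
  refine ⟨forall_fin_five_add.2 ⟨⟨?_, ?_, ?_, ?_, ?_⟩, fun j => ?_⟩, ?_⟩
  · simp only [Fin.append_left]
    refine ⟨antitone_addRow n1.1 (n1.2.1.trans (by omega)), ?_, ?_⟩
    · change c + 1 + 2 ≤ c + 4
      omega
    · change addRow (c + 1 + 2) ν₁ (2 + (a + 1)) = 0
      rw [show 2 + (a + 1) = a + 2 + 1 by omega]
      exact vanish (a + 2) n1.1 n1.2.2 (by omega)
  · simp only [Fin.append_left]
    refine ⟨antitone_addRow (antitone_addRow hκ (by omega)) le_rfl, ?_, ?_⟩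
    · change c + 1 ≤ c + 4
      omega
    · change addRow (c + 1) (addRow (c + 1) κ) (2 + (a + 1)) = 0
      rw [show 2 + (a + 1) = a + 1 + 1 + 1 by omega]
      exact vanish (a + 1) hκ hκa (by omega)
  · simp only [Fin.append_left]
    refine ⟨(antitone_rect _ _).add hρ, ?_, ?_⟩
    · change (if 0 < a + 1 then 2 else 0) + ρ 0 ≤ c + 4
      rw [if_pos (by omega)]
      omega
    · change (if 2 + (a + 1) < a + 1 then 2 else 0) + ρ (2 + (a + 1)) = 0
      rw [if_neg (by omega), vanish _ hρ hρa (by omega)]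
  · simp only [Fin.append_left]
    exact hcol n4
  · simp only [Fin.append_left]
    exact hcol n5
  · simp only [Fin.append_right]
    exact ⟨(nt j).1, (nt j).2.1.trans (by omega), vanish _ (nt j).1 (nt j).2.2 (by omega)⟩
  · rw [Fin.sum_univ_add] at hsum ⊢
    simp only [Fin.append_left, Fin.append_right, Fin.sum_univ_five] at hsum ⊢
    have et : ∑ i, ∑ j ∈ Finset.range (2 + (a + 1)), τ i j =
        ∑ i, ∑ j ∈ Finset.range (a + 1), τ i j := Finset.sum_congr rfl fun i _ => by
      rw [add_comm 2]
      exact sum_range_add_of_eq_zero (nt i).1 (nt i).2.2 2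
    have e1 := sum_range_add_of_eq_zero n1.1 n1.2.2 1
    have e2 := sum_range_add_of_eq_zero hκ hκa 1
    have e3 := sum_range_add_of_eq_zero hρ hρa 3
    have e3' := sum_range_add_of_eq_zero hρ hρa 1
    have e4 := sum_range_add_of_eq_zero n4.1 n4.2.2 2
    have e5 := sum_range_add_of_eq_zero n5.1 n5.2.2 2
    rw [et]
    have hsum : ∑ j ∈ Finset.range (a + 1), ν₁ j + ∑ j ∈ Finset.range (a + 1), addRow c κ j +
      ∑ j ∈ Finset.range (a + 1), (rect 1 a + ρ) j + ∑ j ∈ Finset.range (a + 1), ν₄ j +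
      ∑ j ∈ Finset.range (a + 1), ν₅ j + ∑ i, ∑ j ∈ Finset.range (a + 1), τ i j =
        (a + 1) * (c + 1) := hsum
    change ∑ j ∈ Finset.range (2 + (a + 1)), addRow (c + 1 + 2) ν₁ j +
      ∑ j ∈ Finset.range (2 + (a + 1)), addRow (c + 1) (addRow (c + 1) κ) j +
      ∑ j ∈ Finset.range (2 + (a + 1)), (rect 2 (a + 1) + ρ) j +
      ∑ j ∈ Finset.range (2 + (a + 1)), (rect 1 (a + 1 + 1) + ν₄) j +
      ∑ j ∈ Finset.range (2 + (a + 1)), (rect 1 (a + 1 + 1) + ν₅) j + _ = _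
    rw [sum_addRow, sum_rect_add _ _ (by omega)] at hsum
    rw [show 2 + (a + 1) = a + 1 + 1 + 1 by omega, sum_addRow, sum_addRow, sum_addRow,
      sum_rect_add _ _ (by omega), sum_rect_add _ _ (by omega), sum_rect_add _ _ (by omega)]
    rw [show a + 1 + 1 + 1 = a + 3 by omega] at *
    rw [show a + 1 + 2 = a + 3 by omega] at e4 e5
    rw [e1, e2, e3, e4, e5]
    rw [e3'] at hsum
    -- Here `a + 1` stands for the original `a`, and `c = b - a - 1` for the original values. The
    -- five enlarged partitions gain `c + 3`, `c + 2`, `a + 2`, `a + 2` and `a + 2` boxes.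
    rw [show (a + 3) * (c + 4) = (a + 1) * (c + 1) + (3 * a + 2 * c + 11) by ring]
    generalize (a + 1) * (c + 1) = N at *
    omega

end Problems

/-! ### A general instance of the base problem -/

section Sample

variable {W : Type*} [AddCommGroup W] [Module ℂ W]

theorem Dep.mul_eq_mul {S : Submodule ℂ W} {φ ψ : W →ₗ[ℂ] ℂ} {u w : W} (h : Dep S u w)
    (hφ : ∀ z ∈ S, φ z = 0) (hψ : ∀ z ∈ S, ψ z = 0) : φ u * ψ w = ψ u * φ w := by
  obtain ⟨c, d, h0, h⟩ := h
  have h1 := hφ _ h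
  have h2 := hψ _ h
  simp only [map_add, map_smul, smul_eq_mul] at h1 h2
  rcases h0 with hc | hd
  · refine mul_left_cancel₀ hc ?_
    linear_combination ψ w * h1 - φ w * h2
  · refine mul_left_cancel₀ hd ?_
    linear_combination φ u * h2 - ψ u * h1

theorem exists_basis_flag [FiniteDimensional ℂ W] (hW : finrank ℂ W = 5)
    (φ : Fin 5 → W →ₗ[ℂ] ℂ) (hφ : ∀ z, (∀ k, φ k z = 0) → z = 0) :
    ∃ v : Basis (Fin 5) ℂ W, ∀ j z, z ∈ (CompleteFlag.ofBasis v).space j ↔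
      ∀ k : Fin 5, j ≤ k → φ k z = 0 := by
  have hinj : Function.Injective (LinearMap.pi φ) := by
    rw [← LinearMap.ker_eq_bot, LinearMap.ker_eq_bot']
    exact fun z hz => hφ z fun k => congrFun hz k
  let g := LinearEquiv.ofInjectiveOfFinrankEq (LinearMap.pi φ) hinj
    (by rw [hW, finrank_fin_fun])
  refine ⟨Basis.ofEquivFun g, fun j z => ?_⟩
  rw [CompleteFlag.mem_ofBasis_space]
  rfl

/-- The subspaces `R` of a sample instance: the complements of the first subspace given by
`x₁ = β y₂ - γ y₃`, `x₂ = - α y₁ - γ y₃`. -/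
structure GraphFlag (c : Fin 5 → W →ₗ[ℂ] ℂ) (α β γ : ℂ) (G : CompleteFlag 5 W) : Prop where
  -- `c 0`, `c 1` are the coordinates `x₁`, `x₂`, and `c 2`, `c 3`, `c 4` are `y₁`, `y₂`, `y₃`.
  -- Whatever `α`, `β`, `γ`, the graph sends the three `y`-axes into the `x₂`-axis, the `x₁`-axis
  -- and the diagonal respectively. The three planes combining a `y`-axis with its target line
  -- therefore meet all such graphs.
  mem_three : ∀ z, z ∈ G.space 3 ↔ c 0 z = β * c 3 z - γ * c 4 z ∧ c 1 z = -(α * c 2 z) - γ * c 4 z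
  mem_two : ∀ z, z ∈ G.space 2 ↔ c 2 z + c 3 z + c 4 z = 0 ∧ z ∈ G.space 3
  mem_four : ∀ z, z ∈ G.space 4 ↔ c 0 z + c 1 z + α * c 2 z - β * c 3 z + 2 * γ * c 4 z = 0

theorem exists_graphFlag [FiniteDimensional ℂ W] (e : Basis (Fin 5) ℂ W) (α β γ : ℂ) :
    ∃ v : Basis (Fin 5) ℂ W, GraphFlag e.coord α β γ (CompleteFlag.ofBasis v) := by
  obtain ⟨v, hv⟩ := exists_basis_flag (finrank_eq_card_basis e)
    ![e.coord 2, e.coord 3, e.coord 2 + e.coord 3 + e.coord 4,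
      e.coord 0 - β • e.coord 3 + γ • e.coord 4,
      e.coord 0 + e.coord 1 + α • e.coord 2 - β • e.coord 3 + (2 * γ) • e.coord 4] (by
    intro z hz
    have h0 := hz 0
    have h1 := hz 1
    have h2 := hz 2
    have h3 := hz 3
    have h4 := hz 4
    simp at h0 h1 h2 h3 h4
    refine e.ext_elem fun i => ?_
    fin_cases i <;> simp <;> grind)
  refine ⟨v, ⟨fun z => ?_, fun z => ?_, fun z => ?_⟩⟩
  · rw [hv]
    simp [Fin.forall_fin_succ]
    grind
  · rw [hv, hv]
    simp [Fin.forall_fin_succ]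
  · rw [hv]
    simp [Fin.forall_fin_succ]

/-- The sample instance. -/
structure Sample (c : Fin 5 → W →ₗ[ℂ] ℂ) (E : Fin 5 → CompleteFlag 5 W) (X : CompleteFlag 5 W) :
    Prop where
  eq_zero : ∀ z, c 0 z = 0 → c 1 z = 0 → c 2 z = 0 → c 3 z = 0 → c 4 z = 0 → z = 0
  mem_one : ∀ z ∈ (E 0).space 1, c 0 z + c 1 z = 0
  mem_L : ∀ z, z ∈ (E 0).space 2 ↔ c 2 z = 0 ∧ c 3 z = 0 ∧ c 4 z = 0
  mem_four : ∀ z ∈ (E 0).space 4, c 2 z + c 3 z + c 4 z = 0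
  mem_M : ∀ z, z ∈ (E 1).space 3 ↔ c 0 z = 0 ∧ c 1 z = 0
  mem_four' : ∀ z ∈ (E 1).space 4, c 0 z + c 1 z = 0
  -- `M` is the graph with parameters 0. What matters is that the differences of `(1, 1, 1)` with
  -- `(0, 0, 0)`, `(-2, -1, -1)` and `(-1, -2, 2)` are linearly independent.
  graph₂ : GraphFlag c 1 1 1 (E 2)
  graph₃ : GraphFlag c (-2) (-1) (-1) (E 3)
  graph₄ : GraphFlag c (-1) (-2) 2 (E 4)
  mem_X : ∀ z ∈ X.space 3, c 0 z + c 1 z = 0 ∧ c 2 z + c 3 z + c 4 z = 0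

theorem exists_sample [FiniteDimensional ℂ W] (e : Basis (Fin 5) ℂ W) :
    ∃ (v : Fin 5 → Basis (Fin 5) ℂ W) (w : Basis (Fin 5) ℂ W),
      Sample e.coord (fun i => CompleteFlag.ofBasis (v i)) (CompleteFlag.ofBasis w) := by
  have hW : finrank ℂ W = 5 := finrank_eq_card_basis e
  have ext : ∀ z, e.coord 0 z = 0 → e.coord 1 z = 0 → e.coord 2 z = 0 → e.coord 3 z = 0 →
      e.coord 4 z = 0 → z = 0 := by
    intro z h0 h1 h2 h3 h4
    refine e.ext_elem fun i => ?_
    fin_cases i <;> simpa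
  obtain ⟨v0, h0⟩ := exists_basis_flag hW
    ![e.coord 0, e.coord 0 + e.coord 1, e.coord 2, e.coord 3,
      e.coord 2 + e.coord 3 + e.coord 4] (by
    intro z hz
    have h0 := hz 0
    have h1 := hz 1
    have h2 := hz 2
    have h3 := hz 3
    have h4 := hz 4
    simp only [Matrix.cons_val, LinearMap.add_apply] at h0 h1 h2 h3 h4
    apply ext <;> grind)
  obtain ⟨v1, h1⟩ := exists_basis_flag hW
    ![e.coord 2, e.coord 3, e.coord 4, e.coord 0, e.coord 0 + e.coord 1] (by
    intro z hz
    have h0 := hz 0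
    have h1 := hz 1
    have h2 := hz 2
    have h3 := hz 3
    have h4 := hz 4
    simp only [Matrix.cons_val, LinearMap.add_apply] at h0 h1 h2 h3 h4
    apply ext <;> grind)
  obtain ⟨w, hw⟩ := exists_basis_flag hW
    ![e.coord 0, e.coord 2, e.coord 3, e.coord 0 + e.coord 1,
      e.coord 2 + e.coord 3 + e.coord 4] (by
    intro z hz
    have h0 := hz 0
    have h1 := hz 1
    have h2 := hz 2
    have h3 := hz 3
    have h4 := hz 4
    simp only [Matrix.cons_val, LinearMap.add_apply] at h0 h1 h2 h3 h4
    apply ext <;> grind)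
  obtain ⟨v2, h2⟩ := exists_graphFlag e 1 1 1
  obtain ⟨v3, h3⟩ := exists_graphFlag e (-2) (-1) (-1)
  obtain ⟨v4, h4⟩ := exists_graphFlag e (-1) (-2) 2
  refine ⟨![v0, v1, v2, v3, v4], w, ext, fun z hz => ?_, fun z => ?_, fun z hz => ?_, fun z => ?_,
    fun z hz => ?_, h2, h3, h4, fun z hz => ?_⟩
  · exact (h0 1 z).1 hz 1 le_rfl
  · refine (h0 2 z).trans ?_
    simp only [Fin.forall_fin_succ]
    simp
    grind
  · exact (h0 4 z).1 hz 4 le_rfl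
  · refine (h1 3 z).trans ?_
    simp [Fin.forall_fin_succ]
    grind
  · exact (h1 4 z).1 hz 4 le_rfl
  · exact ⟨(hw 3 z).1 hz 3 le_rfl, (hw 3 z).1 hz 4 (by decide)⟩

end Sample

section Sample

variable {W : Type*} [AddCommGroup W] [Module ℂ W] {c : Fin 5 → W →ₗ[ℂ] ℂ}
  {E : Fin 5 → CompleteFlag 5 W} {X : CompleteFlag 5 W}

theorem GraphFlag.mul_eq_mul {α β γ : ℂ} {G : CompleteFlag 5 W} (hG : GraphFlag c α β γ G)
    {u w : W} (h : Dep (G.space 3) u w) :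
    (c 0 u - β * c 3 u + γ * c 4 u) * (c 1 w + α * c 2 w + γ * c 4 w) =
      (c 1 u + α * c 2 u + γ * c 4 u) * (c 0 w - β * c 3 w + γ * c 4 w) := by
  have := h.mul_eq_mul (φ := c 0 - β • c 3 + γ • c 4) (ψ := c 1 + α • c 2 + γ • c 4)
    (fun z hz => by
      have := (hG.mem_three z).1 hz
      simp only [LinearMap.add_apply, LinearMap.sub_apply, LinearMap.smul_apply, smul_eq_mul]
      linear_combination this.1)
    (fun z hz => by
      have := (hG.mem_three z).1 hz
      simp only [LinearMap.add_apply, LinearMap.smul_apply, smul_eq_mul]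
      linear_combination this.2)
  simpa using this

/-- The coordinates of a pair of the sample instance. -/
structure PairCoords (c : Fin 5 → W →ₗ[ℂ] ℂ) (x t : W) : Prop where
  left₂ : c 2 x = 0
  left₃ : c 3 x = 0
  left₄ : c 4 x = 0
  right₀ : c 0 t = c 3 t - c 4 t
  right₁ : c 1 t = -c 2 t - c 4 t
  cases : (c 0 x = 0 ∧ c 1 x ≠ 0 ∧ c 3 t = 0 ∧ c 4 t = 0 ∧ c 2 t ≠ 0) ∨
    (c 1 x = 0 ∧ c 0 x ≠ 0 ∧ c 2 t = 0 ∧ c 4 t = 0 ∧ c 3 t ≠ 0) ∨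
    (c 0 x = c 1 x ∧ c 0 x ≠ 0 ∧ c 2 t = 0 ∧ c 3 t = 0 ∧ c 4 t ≠ 0)

/-- With `t` in the graph `T`, dependence modulo `M`, `P`, `Q` gives three linear relations between
`x₁ y₁`, `x₂ y₂` and `(x₁ - x₂) y₃`, with coefficient rows `(1, 1, 1)`, `(3, 2, 2)`, `(2, 3, -1)` up
to sign. The determinant is 4, so all three products vanish. As `x ≠ 0`, at most one of `x₁`, `x₂`,
`x₁ - x₂` is 0, and as `t ≠ 0`, one of them is. -/
theorem Sample.pairCoords (h : Sample c E X) {x t : W} (hp : IsPairOf 3 2 2 E x t) :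
    PairCoords c x t := by
  obtain ⟨x2, x3, x4⟩ := (h.mem_L x).1 hp.left_mem
  obtain ⟨t0, t1⟩ := (h.graph₂.mem_three t).1 hp.right_mem
  have hx : ¬ (c 0 x = 0 ∧ c 1 x = 0) := fun h' => hp.left_ne (h.eq_zero x h'.1 h'.2 x2 x3 x4)
  have ht : ¬ (c 2 t = 0 ∧ c 3 t = 0 ∧ c 4 t = 0) := fun h' =>
    hp.right_ne (h.eq_zero t (by rw [t0, h'.2.1, h'.2.2]; ring) (by rw [t1, h'.1, h'.2.2]; ring)
      h'.1 h'.2.1 h'.2.2)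
  have d1 := hp.depM.mul_eq_mul (φ := c 0) (ψ := c 1) (fun z hz => ((h.mem_M z).1 hz).1)
    (fun z hz => ((h.mem_M z).1 hz).2)
  have d2 := h.graph₃.mul_eq_mul hp.depP
  have d3 := h.graph₄.mul_eq_mul hp.depQ
  rw [t0, t1] at d1 d2 d3
  rw [x2, x3, x4] at d2 d3
  have k1 : c 0 x * c 2 t = 0 := by grind
  have k2 : c 1 x * c 3 t = 0 := by grind
  have k3 : (c 0 x - c 1 x) * c 4 t = 0 := by grind
  refine ⟨x2, x3, x4, by rw [t0]; ring, by rw [t1]; ring, ?_⟩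
  simp only [mul_eq_zero, sub_eq_zero] at k1 k2 k3
  grind

/-- A vector aligned with a pair, taken modulo the second and third subspace respectively. -/
theorem Sample.aligned_coords (h : Sample c E X) {x t m : W} (hp : PairCoords c x t)
    (ha : Aligned ((E 3).space 3) ((E 4).space 3) x t m) :
    (c 0 m + c 3 m - c 4 m) * c 1 x = (c 1 m - 2 * c 2 m - c 4 m) * c 0 x ∧
      (c 0 m + 2 * c 3 m + 2 * c 4 m) * c 1 x = (c 1 m - c 2 m + 2 * c 4 m) * c 0 x := by
  have d1 := h.graph₃.mul_eq_mul ha.left_left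
  have d2 := h.graph₄.mul_eq_mul ha.right_left
  rw [hp.left₂, hp.left₃, hp.left₄] at d1 d2
  exact ⟨by linear_combination d1, by linear_combination d2⟩

theorem Sample.independentM (h : Sample c E X) :
    Independent ((E 0).space 2) ((E 1).space 3) ((E 2).space 3) ((E 3).space 3)
      ((E 4).space 3) := by
  intro x₁ h₁ x₂ h₂ x₃ h₃ t₂ k₂ t₃ k₃ l1 l2 l3 l4 l5 l6
  rw [h.mem_L] at h₁ h₂ h₃
  rw [h.graph₂.mem_three] at k₂ k₃
  rw [h.mem_M] at l1 l3
  rw [h.graph₃.mem_three] at l2 l5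
  rw [h.graph₄.mem_three] at l4 l6
  simp only [map_add] at l1 l2 l3 l4 l5 l6
  have e1 : c 4 t₂ = 0 := by grind
  have e2 : c 4 t₃ = 0 := by grind
  refine ⟨?_, ?_, ?_, ?_, ?_⟩ <;> apply h.eq_zero <;> grind

theorem Sample.independentT (h : Sample c E X) :
    Independent ((E 0).space 2) ((E 2).space 3) ((E 1).space 3) ((E 3).space 3)
      ((E 4).space 3) := by
  intro x₁ h₁ x₂ h₂ x₃ h₃ t₂ k₂ t₃ k₃ l1 l2 l3 l4 l5 l6
  rw [h.mem_L] at h₁ h₂ h₃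
  rw [h.mem_M] at k₂ k₃
  rw [h.graph₂.mem_three] at l1 l3
  rw [h.graph₃.mem_three] at l2 l5
  rw [h.graph₄.mem_three] at l4 l6
  simp only [map_add] at l1 l2 l3 l4 l5 l6
  have e1 : c 4 t₂ = 0 := by grind
  have e2 : c 4 t₃ = 0 := by grind
  refine ⟨?_, ?_, ?_, ?_, ?_⟩ <;> apply h.eq_zero <;> grind

/-- Exactly one `y`-coordinate of `t` is nonzero, so the equation `y₁ + y₂ + y₃ = 0` removes `t`
from the combination; a multiple of `x` in a graph is 0. -/
theorem GraphFlag.not_dep {α β γ : ℂ} {G : CompleteFlag 5 W}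
    (hG : GraphFlag c α β γ G) {x t : W} (hp : PairCoords c x t) : ¬ Dep (G.space 2) x t := by
  rintro ⟨a, d, h0, hz⟩
  obtain ⟨h1, h2⟩ := (hG.mem_two _).1 hz
  have h3 := (hG.mem_three _).1 h2
  obtain ⟨x2, x3, x4, t0, t1, hcases⟩ := hp
  simp only [map_add, map_smul, smul_eq_mul, x2, x3, x4, t0, t1] at h1 h3
  have hd : d = 0 := by
    rcases hcases with ⟨-, -, h4, h5, h6⟩ | ⟨-, -, h4, h5, h6⟩ | ⟨-, -, h4, h5, h6⟩ <;>
      rw [h4, h5] at h1 <;> simpa [h6] using h1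
  rw [hd] at h3 h0
  simp only [zero_mul, mul_zero, add_zero, sub_zero, neg_zero, mul_eq_zero] at h3
  grind

theorem Sample.not_dep (h : Sample c E X) {x t : W} (hp : PairCoords c x t) :
    ¬ Dep (X.space 3) x t := by
  rintro ⟨a, d, h0, hz⟩
  obtain ⟨h3, h1⟩ := h.mem_X _ hz
  obtain ⟨x2, x3, x4, t0, t1, hcases⟩ := hp
  simp only [map_add, map_smul, smul_eq_mul, x2, x3, x4, t0, t1] at h1 h3
  have hd : d = 0 := by
    rcases hcases with ⟨-, -, h4, h5, h6⟩ | ⟨-, -, h4, h5, h6⟩ | ⟨-, -, h4, h5, h6⟩ <;>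
      rw [h4, h5] at h1 <;> simpa [h6] using h1
  rw [hd] at h3 h0
  have ha : a ≠ 0 := by simpa using h0
  have h4 : a * (c 0 x + c 1 x) = 0 := by linear_combination h3
  have h5 := (mul_eq_zero.1 h4).resolve_left ha
  grind

theorem Sample.isolatedM (h : Sample c E X) {x t : W} (hp : PairCoords c x t) :
    Isolated ((E 0).space 2) ((E 1).space 3) ((E 2).space 3) ((E 3).space 3) ((E 4).space 3)
      ((E 2).space 4) x t := by
  intro x' hx' w hw hM hY ha
  obtain ⟨d1, d2⟩ := h.aligned_coords hp ha
  have hm := (h.mem_M _).1 hM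
  have hy := (h.graph₂.mem_four _).1 hY
  rw [h.mem_L] at hx'
  rw [h.graph₂.mem_three] at hw
  obtain ⟨x2, x3, x4, t0, t1, hcases⟩ := hp
  generalize hz : x' + w = z at *
  have hz' : c 2 z = 0 ∧ c 3 z = 0 ∧ c 4 z = 0 := by
    rcases hcases with ⟨h1, h2, -⟩ | ⟨h1, h2, -⟩ | ⟨h1, h2, -⟩
    · rw [h1, hm.1] at d1 d2
      have e1 := mul_right_cancel₀ h2 (d1.trans (by ring : _ = 0 * c 1 x))
      have e2 := mul_right_cancel₀ h2 (d2.trans (by ring : _ = 0 * c 1 x))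
      grind
    · rw [h1, hm.2] at d1 d2
      have e1 := mul_right_cancel₀ h2 (d1.symm.trans (by ring : _ = 0 * c 0 x))
      have e2 := mul_right_cancel₀ h2 (d2.symm.trans (by ring : _ = 0 * c 0 x))
      grind
    · rw [← h1] at d1 d2
      have e1 := mul_right_cancel₀ h2 d1
      have e2 := mul_right_cancel₀ h2 d2
      grind
  have e : ∀ k, c k x' + c k w = c k z := fun k => by rw [← hz, map_add]
  have e0 := e 0
  have e1 := e 1
  have e2 := e 2
  have e3 := e 3
  have e4 := e 4
  constructor <;> apply h.eq_zero <;> grind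

theorem Sample.isolatedT (h : Sample c E X) {x t : W} (hp : PairCoords c x t) :
    Isolated ((E 0).space 2) ((E 2).space 3) ((E 1).space 3) ((E 3).space 3) ((E 4).space 3)
      ((E 1).space 4) x t := by
  intro x' hx' w hw hM hY ha
  obtain ⟨d1, d2⟩ := h.aligned_coords hp ha
  have hm := (h.graph₂.mem_three _).1 hM
  have hy := h.mem_four' _ hY
  rw [h.mem_L] at hx'
  rw [h.mem_M] at hw
  obtain ⟨x2, x3, x4, t0, t1, hcases⟩ := hp
  generalize hz : x' + w = z at *
  have hz' : c 2 z = 0 ∧ c 3 z = 0 ∧ c 4 z = 0 := by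
    rcases hcases with ⟨h1, h2, -⟩ | ⟨h1, h2, -⟩ | ⟨h1, h2, -⟩
    · rw [h1] at d1 d2
      have e1 := mul_right_cancel₀ h2 (d1.trans (by ring : _ = 0 * c 1 x))
      have e2 := mul_right_cancel₀ h2 (d2.trans (by ring : _ = 0 * c 1 x))
      grind
    · rw [h1] at d1 d2
      have e1 := mul_right_cancel₀ h2 (d1.symm.trans (by ring : _ = 0 * c 0 x))
      have e2 := mul_right_cancel₀ h2 (d2.symm.trans (by ring : _ = 0 * c 0 x))
      grind
    · rw [← h1] at d1 d2
      have e1 := mul_right_cancel₀ h2 d1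
      have e2 := mul_right_cancel₀ h2 d2
      grind
  have e : ∀ k, c k x' + c k w = c k z := fun k => by rw [← hz, map_add]
  have e0 := e 0
  have e1 := e 1
  have e2 := e 2
  have e3 := e 3
  have e4 := e 4
  constructor <;> apply h.eq_zero <;> grind

theorem Sample.goodBase (h : Sample c E X) : GoodBase E X := by
  refine ⟨⟨fun w hw hw' => ?_, fun w hw hw' => ?_, h.independentM, h.independentT,
    fun x t hp => ?_⟩, fun x t hp => h.not_dep (h.pairCoords hp)⟩
  · rw [h.mem_L] at hw
    rw [h.mem_M] at hw'
    exact h.eq_zero w hw'.1 hw'.2 hw.1 hw.2.1 hw.2.2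
  · rw [h.mem_L] at hw
    rw [h.graph₂.mem_three, hw.1, hw.2.1, hw.2.2] at hw'
    exact h.eq_zero w (by rw [hw'.1]; ring) (by rw [hw'.2]; ring) hw.1 hw.2.1 hw.2.2
  · have hc := h.pairCoords hp
    refine ⟨fun ht => ?_, h.isolatedM hc, h.isolatedT hc, fun ht => ?_,
      h.graph₃.not_dep hc, h.graph₄.not_dep hc⟩
    · have := h.mem_four t ht
      have := hc.cases
      grind
    · have := ((h.graph₂.mem_two t).1 ht).1
      have := hc.cases
      grind

theorem Sample.notMem_one (h : Sample c E X) {x t : W} (hp : IsPairOf 3 2 2 E x t) :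
    x ∉ (E 0).space 1 := by
  intro hx
  have := h.mem_one x hx
  have := (h.pairCoords hp).cases
  grind

end Sample

/-! ### The fibration -/

section Fibration

theorem regularFamily_const {X A : Type*} [AddCommGroup A] [Module ℂ A]
    [FiniteDimensional ℂ A] {R : Subalgebra ℂ (X → ℂ)} {n : ℕ} (w : Basis (Fin n) ℂ A) (d : ℕ) :
    RegularFamily R (fun _ => (CompleteFlag.ofBasis w).space d) :=
  ⟨n, fun _ => w, d, fun _ => Regular.const _, fun _ => rfl⟩

/-- The flag `X` may depend on `E`: the set is a union, over fixed `X`, of open sets. -/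
theorem isZariskiOpen_goodBase {W : Type*} [AddCommGroup W] [Module ℂ W] [FiniteDimensional ℂ W]
    (e : Basis (Fin 5) ℂ W) :
    IsZariskiOpen {E : Fin 5 → CompleteFlag 5 W |
      ∃ w : Basis (Fin 5) ℂ W, GoodBase E (CompleteFlag.ofBasis w)} := by
  refine isZariskiOpen_of_isOpen e ?_
  have hE : ∀ i d, RegularFamily (basesAlgebra 5 e)
      (fun v : Fin 5 → Basis (Fin 5) ℂ W => (CompleteFlag.ofBasis (v i)).space d) :=
    fun i d => regularFamily_ofBasis e i d
  have h : {v : Fin 5 → Basis (Fin 5) ℂ W | (fun i => CompleteFlag.ofBasis (v i)) ∈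
      {E : Fin 5 → CompleteFlag 5 W |
        ∃ w : Basis (Fin 5) ℂ W, GoodBase E (CompleteFlag.ofBasis w)}} =
      ⋃ w : Basis (Fin 5) ℂ W, {v | Generic 3 2 2 (fun i => CompleteFlag.ofBasis (v i)) ∧
        ∀ x t, IsPairOf 3 2 2 (fun i => CompleteFlag.ofBasis (v i)) x t →
          ¬ Dep ((CompleteFlag.ofBasis w).space 3) x t} := by
    ext v
    simp only [Set.mem_ofPred_eq, Set.mem_iUnion]
    exact exists_congr fun w => ⟨fun h => ⟨h.1, h.2⟩, fun h => ⟨h.1, h.2⟩⟩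
  rw [h]
  exact @isOpen_iUnion _ _ (zariski _) _ fun w => isOpen_and (isOpen_generic hE)
    (isOpen_pair_not_dep (hE 0 2) (hE 1 3) (hE 2 3) (hE 3 3) (hE 4 3) (regularFamily_const w 3))

theorem isDenseOpen_goodFiber {W : Type*} [AddCommGroup W] [Module ℂ W] [FiniteDimensional ℂ W]
    {b r : ℕ} (hb : 2 ≤ b) (e : Basis (Fin b) ℂ W) :
    IsDenseOpen {G : Fin (5 + r) → CompleteFlag b W | GoodFiber G} := by
  constructor
  · refine isZariskiOpen_of_isOpen e ?_
    have hG : ∀ i d, RegularFamily (basesAlgebra (5 + r) e)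
        (fun v : Fin (5 + r) → Basis (Fin b) ℂ W => (CompleteFlag.ofBasis (v i)).space d) :=
      fun i d => regularFamily_ofBasis e i d
    convert isOpen_and (isOpen_disjoint (hG (Fin.castAdd r 1) 2) (hG (Fin.castAdd r 2) (b - 2)))
      (isOpen_disjoint (hG (Fin.castAdd r 0) 1) (hG (Fin.castAdd r 2) (b - 1))) using 1
    ext v
    exact ⟨fun h => ⟨h.1, h.2⟩, fun h => ⟨h.1, h.2⟩⟩
  -- The flags of a basis and of the reversed basis are opposite, which gives a point of the open
  -- set.
  · have key : ∀ k ≤ b, ∀ w ∈ (CompleteFlag.ofBasis e).space k,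
        w ∈ (CompleteFlag.ofBasis (e.reindex Fin.revPerm)).space (b - k) → w = 0 := by
      intro k hk w h1 h2
      rw [CompleteFlag.mem_ofBasis_space] at h1 h2
      refine e.ext_elem fun i => ?_
      rw [map_zero, Finsupp.zero_apply]
      by_cases hi : k ≤ i
      · exact h1 i hi
      · have := h2 (Fin.rev i) (by rw [Fin.val_rev]; omega)
        simpa using this
    have hne : Fin.castAdd r (0 : Fin 5) ≠ Fin.castAdd r 2 ∧
        Fin.castAdd r (1 : Fin 5) ≠ Fin.castAdd r 2 := by
      constructor <;> simp [Fin.ext_iff]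
    refine ⟨Function.update (fun _ => CompleteFlag.ofBasis e) (Fin.castAdd r 2)
      (CompleteFlag.ofBasis (e.reindex Fin.revPerm)), ?_, ?_⟩
    · rw [Function.update_self, Function.update_of_ne hne.2]
      exact key 2 hb
    · rw [Function.update_self, Function.update_of_ne hne.1]
      exact key 1 (by omega)

/-- The fibration data from which a merged instance is merged. -/
def IsSplit {A : Type*} [AddCommGroup A] [Module ℂ A] [FiniteDimensional ℂ A] {b r : ℕ}
    (hb : 2 ≤ b) (F : Fin (5 + r) → CompleteFlag (5 + b) A) (D : FibrationData A 5 b 5 (5 + r)) :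
    Prop :=
  ∃ (V : Submodule ℂ A) (hV : finrank ℂ V = 5) (ρ : A →ₗ[ℂ] V) (hρ : ∀ v : V, ρ v = v)
    (E : Fin 5 → CompleteFlag 5 V) (X : CompleteFlag 5 V)
    (G : Fin (5 + r) → CompleteFlag b (A ⧸ V)), GoodBase E X ∧ GoodFiber G ∧
    F = mergeInstance hb hρ E X G ∧ D = ⟨V, hV, E, fun _ => G⟩

/-- `F` determines `V` as `(L + M) ∩ (L + T)`, and then `E` and `G`. The projection and `X` are not
determined, but they do not enter the data. -/
theorem IsSplit.unique {A : Type*} [AddCommGroup A] [Module ℂ A] [FiniteDimensional ℂ A] {b r : ℕ}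
    {hb : 2 ≤ b} {F : Fin (5 + r) → CompleteFlag (5 + b) A} {D D' : FibrationData A 5 b 5 (5 + r)}
    (h : IsSplit hb F D) (h' : IsSplit hb F D') : D = D' := by
  obtain ⟨V, hV, ρ, hρ, E, X, G, hE, hG, rfl, rfl⟩ := h
  obtain ⟨V', hV', ρ', hρ', E', X', G', hE', hG', hF, rfl⟩ := h'
  have e : V = V' := by
    have h₁ := (hE.compatible (hb := hb) (hρ := hρ) hV hG).V_eq
    have h₂ := (hE'.compatible (hb := hb) (hρ := hρ') hV' hG').V_eq
    rw [← hF] at h₂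
    exact h₁.trans h₂.symm
  subst e
  obtain ⟨rfl, rfl⟩ := mergeInstance_inj hF
  rfl

theorem IsSplit.compatible {A : Type*} [AddCommGroup A] [Module ℂ A] [FiniteDimensional ℂ A]
    {b r : ℕ} {hb : 2 ≤ b} {F : Fin (5 + r) → CompleteFlag (5 + b) A}
    {D : FibrationData A 5 b 5 (5 + r)} (h : IsSplit hb F D) : Compatible F D := by
  obtain ⟨V, hV, ρ, hρ, E, X, G, hE, hG, rfl, rfl⟩ := h
  exact hE.compatible hV hG

theorem IsSplit.goodInstance {A : Type*} [AddCommGroup A] [Module ℂ A] [FiniteDimensional ℂ A]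
    {b r : ℕ} {hb : 2 ≤ b} {F : Fin (5 + r) → CompleteFlag (5 + b) A}
    {D : FibrationData A 5 b 5 (5 + r)} (h : IsSplit hb F D) : GoodInstance F := by
  obtain ⟨V, hV, ρ, hρ, E, X, G, hE, hG, rfl, rfl⟩ := h
  exact hE.goodInstance hG

theorem exists_isSplit {A : Type*} [AddCommGroup A] [Module ℂ A] [FiniteDimensional ℂ A]
    {b r : ℕ} (hb : 2 ≤ b) {V : Submodule ℂ A} (hV : finrank ℂ V = 5)
    {E : Fin 5 → CompleteFlag 5 V} {X : CompleteFlag 5 V} (hE : GoodBase E X)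
    {G : Fin (5 + r) → CompleteFlag b (A ⧸ V)} (hG : GoodFiber G) :
    ∃ F, IsSplit hb F ⟨V, hV, E, fun _ => G⟩ := by
  obtain ⟨ρ, hρ⟩ := LinearMap.exists_leftInverse_of_injective V.subtype V.ker_subtype
  have hρ' : ∀ v : V, ρ v = v := fun v => LinearMap.congr_fun hρ v
  exact ⟨_, V, hV, ρ, hρ', E, X, G, hE, hG, rfl, rfl⟩

theorem isFibered {a b : ℕ} (ha : 0 < a) (hab : a < b) {r : ℕ}
    {ν₁ κ ρ ν₄ ν₅ : ℕ → ℕ} {τ : Fin r → ℕ → ℕ} (hκ : Antitone κ) (hρ : Antitone ρ)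
    (hρa : ρ (a - 1) = 0) (hν : IsSchubertProblem a b (fiberProblem a b ν₁ κ ρ ν₄ ν₅ τ)) :
    IsFibered 2 5 a b (totalProblem a b ν₁ κ ρ ν₄ ν₅ τ) baseProblem
      (fiberProblem a b ν₁ κ ρ ν₄ ν₅ τ) := by
  have hb : 2 ≤ b := by omega
  have hex : ∀ V : Submodule ℂ (Fin (5 + b) → ℂ), finrank ℂ V = 5 →
      ∃ (E : Fin 5 → CompleteFlag 5 V) (w : Basis (Fin 5) ℂ V),
        GoodBase E (CompleteFlag.ofBasis w) := by
    intro V hV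
    obtain ⟨v, w, h⟩ := exists_sample (finBasisOfFinrankEq ℂ V hV)
    exact ⟨_, w, h.goodBase⟩
  have hquot : ∀ V : Submodule ℂ (Fin (5 + b) → ℂ), finrank ℂ V = 5 →
      finrank ℂ ((Fin (5 + b) → ℂ) ⧸ V) = b := by
    intro V hV
    have := finrank_quotient_add_finrank V
    rw [finrank_fin_fun] at this
    omega
  have hfib : ∀ (V : Submodule ℂ (Fin (5 + b) → ℂ)) (_ : finrank ℂ V = 5),
      IsDenseOpen {G : Fin (5 + r) → CompleteFlag b ((Fin (5 + b) → ℂ) ⧸ V) | GoodFiber G} :=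
    fun V hV => isDenseOpen_goodFiber hb (finBasisOfFinrankEq ℂ _ (hquot V hV))
  obtain ⟨V₁, hV₁⟩ : ∃ V : Submodule ℂ (Fin (5 + b) → ℂ), finrank ℂ V = 5 :=
    ⟨_, (CompleteFlag.ofBasis (Pi.basisFun ℂ (Fin (5 + b)))).finrank_space 5 (by omega)⟩
  obtain ⟨E₁, w₁, hE₁⟩ := hex V₁ hV₁
  obtain ⟨G₁, hG₁⟩ := (hfib V₁ hV₁).2
  have hD : ∃ D : (Fin (5 + r) → CompleteFlag (5 + b) (Fin (5 + b) → ℂ)) →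
      FibrationData (Fin (5 + b) → ℂ) 5 b 5 (5 + r),
      ∀ F, (GoodInstance F → Compatible F (D F)) ∧ ∀ D', IsSplit hb F D' → D F = D' := by
    classical
    -- On split instances the rule must return the data they were merged from, so that prescribed
    -- `E₀` and `G₀` are attained; elsewhere any compatible data will do.
    refine ⟨fun F => if h : ∃ D, IsSplit hb F D then h.choose else
      if h : ∃ D, Compatible F D then h.choose else ⟨V₁, hV₁, E₁, fun _ => G₁⟩, fun F => ?_⟩
    by_cases h : ∃ D, IsSplit hb F D
    · simp only [dif_pos h]
      exact ⟨fun _ => h.choose_spec.compatible, fun D' hD' => h.choose_spec.unique hD'⟩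
    · simp only [dif_neg h]
      refine ⟨fun hF => ?_, fun D' hD' => (h ⟨D', hD'⟩).elim⟩
      have h' := hF.exists_compatible hb
      rw [dif_pos h']
      exact h'.choose_spec
  obtain ⟨D, hD⟩ := hD
  refine ⟨isSchubertProblem_totalProblem ha hab hκ hρ hρa hν, isSchubertProblem_baseProblem, hν,
    {F | GoodInstance F}, D, ⟨isZariskiOpen_goodInstance (Pi.basisFun ℂ _), ?_⟩, fun F hF =>
    hF.fibersInstance ((hD F).1 hF) ha hab hρ hρa hν.1, fun V hV => ?_⟩
  · obtain ⟨F, hF⟩ := exists_isSplit hb hV₁ hE₁ hG₁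
    exact ⟨F, hF.goodInstance⟩
  · obtain ⟨E, w, hE⟩ := hex V hV
    refine ⟨_, ⟨isZariskiOpen_goodBase (finBasisOfFinrankEq ℂ _ hV), E, w, hE⟩, ?_⟩
    rintro E₀ ⟨w, hE₀⟩
    refine ⟨?_, fun h _ => ⟨_, hfib V hV, fun G₀ hG₀ => ?_⟩⟩
    · obtain ⟨G, hG⟩ := (hfib V hV).2
      obtain ⟨F, hF⟩ := exists_isSplit hb hV hE₀ hG
      exact ⟨F, hF.goodInstance, _, (hD F).2 _ hF⟩
    · obtain ⟨F, hF⟩ := exists_isSplit hb hV hE₀ hG₀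
      exact ⟨F, hF.goodInstance, _, (hD F).2 _ hF, rfl⟩

end Fibration

/-! ### The degree of the base problem -/

section Pencil

/-- The determinant of `s p + q` as a cubic polynomial in `s`. -/
def pencilCubic {K : Type*} [CommRing K] (p q : Matrix (Fin 3) (Fin 3) K) : Cubic K :=
  -- Expansion by rows: the coefficient of `s ^ 2` takes one row from `q`, that of `s` takes one row
  -- from `p`.
  ⟨p.det, ∑ i, (p.updateRow i (q i)).det, ∑ i, (q.updateRow i (p i)).det, q.det⟩

theorem det_smul_add {K : Type*} [CommRing K] (p q : Matrix (Fin 3) (Fin 3) K) (s : K) :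
    (s • p + q).det = (pencilCubic p q).toPoly.eval s := by
  simp only [pencilCubic, Cubic.toPoly, Polynomial.eval_add, Polynomial.eval_mul,
    Polynomial.eval_C, Polynomial.eval_pow, Polynomial.eval_X, Fin.sum_univ_three,
    Matrix.det_fin_three, Matrix.updateRow_apply, Matrix.add_apply, Matrix.smul_apply, smul_eq_mul]
  simp
  ring

theorem map_pencilCubic {K K' : Type*} [CommRing K] [CommRing K'] (φ : K →+* K')
    (p q : Matrix (Fin 3) (Fin 3) K) :
    Cubic.map φ (pencilCubic p q) = pencilCubic (p.map φ) (q.map φ) := by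
  have h : ∀ (p q : Matrix (Fin 3) (Fin 3) K) (i : Fin 3),
      φ (p.updateRow i (q i)).det = ((p.map φ).updateRow i ((q.map φ) i)).det := by
    intro p q i
    rw [RingHom.map_det, RingHom.mapMatrix_apply, Matrix.map_updateRow]
    rfl
  simp only [Cubic.map, pencilCubic, map_sum, h]
  simp only [RingHom.map_det, RingHom.mapMatrix_apply]

theorem map_discr {K K' : Type*} [CommRing K] [CommRing K'] (φ : K →+* K') (P : Cubic K) :
    φ P.discr = (Cubic.map φ P).discr := by
  simp [Cubic.discr, Cubic.map, map_ofNat]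

theorem encard_zeros_eq_three_iff {P : Cubic ℂ} (ha : P.a ≠ 0) :
    {s : ℂ | P.toPoly.eval s = 0}.encard = 3 ↔ P.discr ≠ 0 := by
  classical
  have h0 : P.toPoly ≠ 0 := Cubic.ne_zero_of_a_ne_zero ha
  have hmap : P.toPoly.map (RingHom.id ℂ) = P.toPoly := Polynomial.map_id
  have hs : (P.toPoly.map (RingHom.id ℂ)).Splits := IsAlgClosed.splits _
  have hset : {s : ℂ | P.toPoly.eval s = 0} = (P.toPoly.roots.toFinset : Set ℂ) := by
    ext s
    simp [h0]
  have hcard : P.toPoly.roots.card = 3 := by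
    have := (Cubic.splits_iff_card_roots ha).1 hs
    rwa [Cubic.map_roots, hmap] at this
  have hd := Cubic.discr_ne_zero_iff_roots_nodup ha hs
  rw [Cubic.map_roots, hmap] at hd
  rw [hd, hset, Set.encard_coe_eq_coe_finsetCard, ← Multiset.toFinset_card_eq_card_iff_nodup, hcard]
  exact Nat.cast_inj (R := ℕ∞) (m := _) (n := 3)

variable {W : Type*} [AddCommGroup W] [Module ℂ W]

/-- Dependence modulo a subspace cut out by two equations is the vanishing of a 2 × 2 determinant,
which is linear in each of `u` and `w`. -/
theorem dep_iff_mul_eq_mul {S : Submodule ℂ W} {φ ψ : W →ₗ[ℂ] ℂ}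
    (hS : ∀ z, z ∈ S ↔ φ z = 0 ∧ ψ z = 0) {u w : W} :
    Dep S u w ↔ φ u * ψ w = ψ u * φ w := by
  refine ⟨fun h => h.mul_eq_mul (fun z hz => ((hS z).1 hz).1) fun z hz => ((hS z).1 hz).2,
    fun h => ?_⟩
  by_cases h1 : φ w = 0 ∧ φ u = 0
  · by_cases h2 : ψ w = 0 ∧ ψ u = 0
    · exact ⟨1, 0, by simp, by simp [hS, h1, h2]⟩
    · refine ⟨ψ w, -ψ u, by grind, (hS _).2 ⟨by simp [h1], by simp; ring⟩⟩
  · refine ⟨φ w, -φ u, by grind, (hS _).2 ⟨by simp; ring, ?_⟩⟩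
    simp only [map_add, map_smul, smul_eq_mul]
    linear_combination -h

theorem span_smul_pair {x t : W} {a d : ℂ} (ha : a ≠ 0) (hd : d ≠ 0) :
    span ℂ {a • x, d • t} = span ℂ {x, t} := by
  simp only [span_insert, span_singleton_smul_eq (IsUnit.mk0 _ ha),
    span_singleton_smul_eq (IsUnit.mk0 _ hd)]

theorem IsPair.smul {L M T P Q : Submodule ℂ W} {x t : W} (hp : IsPair L M T P Q x t) {a d : ℂ}
    (ha : a ≠ 0) (hd : d ≠ 0) : IsPair L M T P Q (a • x) (d • t) :=
  ⟨smul_ne_zero ha hp.left_ne, smul_ne_zero hd hp.right_ne, smul_mem _ _ hp.left_mem,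
    smul_mem _ _ hp.right_mem, (hp.depM.smul_left ha).smul_right hd,
    (hp.depP.smul_left ha).smul_right hd, (hp.depQ.smul_left ha).smul_right hd⟩

/-- The matrix of the conditions that `x` imposes on the members `t` of pairs `(x, t)`. -/
def pencil (φ ψ : Fin 3 → W →ₗ[ℂ] ℂ) (f : Fin 3 → W) (x : W) : Matrix (Fin 3) (Fin 3) ℂ :=
  Matrix.of fun i j => φ i x * ψ i (f j) - ψ i x * φ i (f j)

theorem pencil_smul_add (φ ψ : Fin 3 → W →ₗ[ℂ] ℂ) (f : Fin 3 → W) (s : ℂ) (x y : W) :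
    pencil φ ψ f (s • x + y) = s • pencil φ ψ f x + pencil φ ψ f y := by
  ext i j
  simp [pencil]
  ring

theorem pencil_mulVec (φ ψ : Fin 3 → W →ₗ[ℂ] ℂ) (f : Fin 3 → W) (x : W) (c : Fin 3 → ℂ)
    (i : Fin 3) : (pencil φ ψ f x).mulVec c i =
      φ i x * ψ i (∑ j, c j • f j) - ψ i x * φ i (∑ j, c j • f j) := by
  simp only [Matrix.mulVec, dotProduct, pencil, Matrix.of_apply, map_sum, map_smul, smul_eq_mul,
    Finset.mul_sum, ← Finset.sum_sub_distrib]
  exact Finset.sum_congr rfl fun j _ => by ring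

variable {E : Fin 5 → CompleteFlag 5 W}

section Count

variable {x₀ x₁ : W} {f : Fin 3 → W} {φ ψ : Fin 3 → W →ₗ[ℂ] ℂ}

/-- Equations of the subspaces of an instance of the base problem. -/
structure Equations (E : Fin 5 → CompleteFlag 5 W) (x₀ x₁ : W) (f : Fin 3 → W)
    (φ ψ : Fin 3 → W →ₗ[ℂ] ℂ) : Prop where
  mem_one : x₀ ∈ (E 0).space 1
  linearIndependent : LinearIndependent ℂ ![x₀, x₁]
  mem_L : ∀ x, x ∈ (E 0).space 2 ↔ ∃ a d : ℂ, a • x₀ + d • x₁ = x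
  linearIndependent' : LinearIndependent ℂ f
  mem_T : ∀ t, t ∈ (E 2).space 3 ↔ ∃ c : Fin 3 → ℂ, ∑ j, c j • f j = t
  mem_M : ∀ z, z ∈ (E 1).space 3 ↔ φ 0 z = 0 ∧ ψ 0 z = 0
  mem_P : ∀ z, z ∈ (E 3).space 3 ↔ φ 1 z = 0 ∧ ψ 1 z = 0
  mem_Q : ∀ z, z ∈ (E 4).space 3 ↔ φ 2 z = 0 ∧ ψ 2 z = 0

theorem Equations.isPair_iff (hq : Equations E x₀ x₁ f φ ψ) {x : W} (hx : x ∈ (E 0).space 2)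
    (hx0 : x ≠ 0) (c : Fin 3 → ℂ) :
    IsPairOf 3 2 2 E x (∑ j, c j • f j) ↔ c ≠ 0 ∧ (pencil φ ψ f x).mulVec c = 0 := by
  have hker : (pencil φ ψ f x).mulVec c = 0 ↔ ∀ i,
      φ i x * ψ i (∑ j, c j • f j) = ψ i x * φ i (∑ j, c j • f j) := by
    rw [funext_iff]
    exact forall_congr' fun i => by rw [pencil_mulVec, Pi.zero_apply, sub_eq_zero]
  have hne : ∑ j, c j • f j ≠ 0 ↔ c ≠ 0 := by
    refine not_congr ⟨fun h => funext (Fintype.linearIndependent_iff.1 hq.linearIndependent' c h),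
      fun h => by simp [h]⟩
  rw [hker, ← hne]
  constructor
  · intro hp
    refine ⟨hp.right_ne, fun i => ?_⟩
    fin_cases i
    · exact (dep_iff_mul_eq_mul hq.mem_M).1 hp.depM
    · exact (dep_iff_mul_eq_mul hq.mem_P).1 hp.depP
    · exact (dep_iff_mul_eq_mul hq.mem_Q).1 hp.depQ
  · rintro ⟨h0, h⟩
    exact ⟨hx0, h0, hx, (hq.mem_T _).2 ⟨c, rfl⟩, (dep_iff_mul_eq_mul hq.mem_M).2 (h 0),
      (dep_iff_mul_eq_mul hq.mem_P).2 (h 1), (dep_iff_mul_eq_mul hq.mem_Q).2 (h 2)⟩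

theorem Equations.exists_isPair_iff (hq : Equations E x₀ x₁ f φ ψ) {x : W}
    (hx : x ∈ (E 0).space 2) (hx0 : x ≠ 0) :
    (∃ t, IsPairOf 3 2 2 E x t) ↔ (pencil φ ψ f x).det = 0 := by
  rw [← Matrix.exists_mulVec_eq_zero_iff]
  constructor
  · rintro ⟨t, ht⟩
    obtain ⟨c, rfl⟩ := (hq.mem_T t).1 ht.right_mem
    exact ⟨c, (hq.isPair_iff hx hx0 c).1 ht⟩
  · rintro ⟨c, hc⟩
    exact ⟨_, (hq.isPair_iff hx hx0 c).2 hc⟩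

variable [FiniteDimensional ℂ W]

theorem IsPair.mem_solutions {x t : W} (hp : IsPairOf 3 2 2 E x t)
    (hLT : ∀ w ∈ (E 0).space 2, w ∈ (E 2).space 3 → w = 0) :
    span ℂ {x, t} ∈ solutions 2 5 baseProblem E :=
  mem_solutions_baseProblem.2 ⟨hp.finrank_span hLT,
    one_le_finrank_of_mem ⟨left_mem_span_pair, hp.left_mem⟩ hp.left_ne,
    hp.one_le_finrank hLT hp.depM,
    one_le_finrank_of_mem ⟨right_mem_span_pair, hp.right_mem⟩ hp.right_ne,
    hp.one_le_finrank hLT hp.depP, hp.one_le_finrank hLT hp.depQ⟩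

theorem exists_isPair_of_mem_solutions {h : Submodule ℂ W} (hh : h ∈ solutions 2 5 baseProblem E)
    (hLT : ∀ w ∈ (E 0).space 2, w ∈ (E 2).space 3 → w = 0) :
    ∃ x t, IsPairOf 3 2 2 E x t ∧ h = span ℂ {x, t} := by
  obtain ⟨h0, h1, h2, h3, h4, h5⟩ := mem_solutions_baseProblem.1 hh
  exact exists_isPair hLT h0 h1 h2 h3 h4 h5

/-- The second member of a pair is determined by the first, up to scaling. -/
theorem Generic.exists_eq_smul (hE : Generic 3 2 2 E) {x t t' : W} (hp : IsPairOf 3 2 2 E x t)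
    (hp' : IsPairOf 3 2 2 E x t')
    (hadd : ∀ e : ℂ, t' - e • t ≠ 0 → IsPairOf 3 2 2 E x (t' - e • t)) : ∃ e : ℂ, t' = e • t := by
  have hT : finrank ℂ ((E 2).space 3) = 3 := (E 2).finrank_space 3 (by omega)
  have hT' : finrank ℂ ((E 2).space 2) = 2 := (E 2).finrank_space 2 (by omega)
  have ht := (hE.pair x t hp).2.2.2.1
  -- If `t` and `t'` were independent, some nonzero `t' - e • t` would lie in the hyperplane `(E
  -- 2).space 2` of `T`, which no member of a pair does.
  obtain ⟨e, he⟩ := exists_sub_smul_mem (W := (E 2).space 3)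
    (S := ((E 2).space 2).comap ((E 2).space 3).subtype)
    (by rw [finrank_comap_subtype, inf_eq_right.2 ((E 2).mono (by omega)), hT, hT'])
    (q := ⟨t, hp.right_mem⟩) ht ⟨t', hp'.right_mem⟩
  refine ⟨e, sub_eq_zero.1 ?_⟩
  by_contra h0
  exact (hE.pair x _ (hadd e h0)).2.2.2.1 he

theorem Equations.exists_eq_smul (hq : Equations E x₀ x₁ f φ ψ) (hE : Generic 3 2 2 E)
    {x t t' : W} (hp : IsPairOf 3 2 2 E x t) (hp' : IsPairOf 3 2 2 E x t') :
    ∃ e : ℂ, t' = e • t := by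
  refine hE.exists_eq_smul hp hp' fun e he => ?_
  have hx := hp.left_mem
  have hx0 := hp.left_ne
  obtain ⟨c, rfl⟩ := (hq.mem_T t).1 hp.right_mem
  obtain ⟨c', rfl⟩ := (hq.mem_T t').1 hp'.right_mem
  have hsum : ∑ j, c' j • f j - e • ∑ j, c j • f j = ∑ j, (c' - e • c) j • f j := by
    simp only [Pi.sub_apply, Pi.smul_apply, sub_smul, Finset.sum_sub_distrib, Finset.smul_sum,
      smul_smul, smul_eq_mul]
  rw [hsum] at he ⊢
  rw [hq.isPair_iff hx hx0] at hp hp' ⊢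
  refine ⟨fun h => he (by rw [h]; simp), ?_⟩
  rw [Matrix.mulVec_sub, Matrix.mulVec_smul, hp.2, hp'.2, smul_zero, sub_zero]

theorem Equations.encard_solutions (hq : Equations E x₀ x₁ f φ ψ) (hE : Generic 3 2 2 E)
    (hno : ∀ x t, IsPairOf 3 2 2 E x t → x ∉ (E 0).space 1) :
    (solutions 2 5 baseProblem E).encard =
        {s : ℂ | (s • pencil φ ψ f x₀ + pencil φ ψ f x₁).det = 0}.encard ∧
      (pencil φ ψ f x₀).det ≠ 0 := by
  have hli := LinearIndependent.pair_iff.1 hq.linearIndependent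
  have hmem : ∀ s : ℂ, s • x₀ + x₁ ∈ (E 0).space 2 := fun s =>
    (hq.mem_L _).2 ⟨s, 1, by rw [one_smul]⟩
  have hne : ∀ s : ℂ, s • x₀ + x₁ ≠ 0 := fun s h =>
    one_ne_zero (hli s 1 (by rwa [one_smul])).2
  have hx₀ : x₀ ≠ 0 := fun h => one_ne_zero (hli 1 0 (by simp [h])).1
  refine ⟨?_, fun hdet => ?_⟩
  swap
  · obtain ⟨t, ht⟩ := (hq.exists_isPair_iff ((E 0).mono (by omega) hq.mem_one) hx₀).2 hdet
    exact hno _ _ ht hq.mem_one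
  have hroot : ∀ s : ℂ, (s • pencil φ ψ f x₀ + pencil φ ψ f x₁).det = 0 ↔
      ∃ t, IsPairOf 3 2 2 E (s • x₀ + x₁) t := fun s => by
    rw [hq.exists_isPair_iff (hmem s) (hne s), pencil_smul_add]
  simp only [hroot]
  have hex : ∀ s : ℂ, ∃ t, (∃ t, IsPairOf 3 2 2 E (s • x₀ + x₁) t) →
      IsPairOf 3 2 2 E (s • x₀ + x₁) t := fun s => by
    by_cases h : ∃ t, IsPairOf 3 2 2 E (s • x₀ + x₁) t
    · exact ⟨h.choose, fun _ => h.choose_spec⟩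
    · exact ⟨0, fun h' => (h h').elim⟩
  choose t ht using hex
  have himage : solutions 2 5 baseProblem E =
      (fun s => span ℂ {s • x₀ + x₁, t s}) '' {s : ℂ | ∃ t, IsPairOf 3 2 2 E (s • x₀ + x₁) t} := by
    ext h
    constructor
    · intro hh
      obtain ⟨x, y, hp, rfl⟩ := exists_isPair_of_mem_solutions hh hE.LT
      obtain ⟨a, d, rfl⟩ := (hq.mem_L x).1 hp.left_mem
      have hd : d ≠ 0 := by
        rintro rfl
        refine hno _ _ hp ?_
        rw [zero_smul, add_zero]
        exact smul_mem _ _ hq.mem_one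
      have hs : a • x₀ + d • x₁ = d • ((d⁻¹ * a) • x₀ + x₁) := by
        rw [smul_add, smul_smul, mul_inv_cancel_left₀ hd]
      have hp' : IsPairOf 3 2 2 E ((d⁻¹ * a) • x₀ + x₁) y := by
        have := hp.smul (inv_ne_zero hd) one_ne_zero
        rwa [hs, smul_smul, inv_mul_cancel₀ hd, one_smul, one_smul] at this
      obtain ⟨e, he⟩ := hq.exists_eq_smul hE (ht _ ⟨y, hp'⟩) hp'
      have he0 : e ≠ 0 := by
        rintro rfl
        exact hp'.right_ne (by rw [he, zero_smul])
      refine ⟨d⁻¹ * a, ⟨y, hp'⟩, ?_⟩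
      dsimp only
      rw [hs, he, span_smul_pair hd he0]
    · rintro ⟨s, hs, rfl⟩
      exact IsPair.mem_solutions (ht s hs) hE.LT
  rw [himage]
  refine Set.InjOn.encard_image fun s hs s' hs' h => ?_
  have hin : s' • x₀ + x₁ ∈ span ℂ {s • x₀ + x₁, t s} := by
    change span ℂ {s • x₀ + x₁, t s} = span ℂ {s' • x₀ + x₁, t s'} at h
    rw [h]
    exact left_mem_span_pair
  obtain ⟨a, d, had⟩ := mem_span_pair.1 hin
  have h0 : d • t s = 0 := hE.LT _ (by
    rw [eq_sub_of_add_eq' had]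
    exact sub_mem (hmem s') (smul_mem _ _ (hmem s))) (smul_mem _ _ (ht s hs).right_mem)
  rw [h0, add_zero] at had
  have hz : (a * s - s') • x₀ + (a - 1) • x₁ = 0 := by
    rw [← sub_eq_zero] at had
    rw [← had]
    module
  obtain ⟨e1, e2⟩ := hli _ _ hz
  rw [sub_eq_zero.1 e2, one_mul] at e1
  exact sub_eq_zero.1 e1

end Count

end Pencil

section Degree

variable {W : Type*} [AddCommGroup W] [Module ℂ W] {E : Fin 5 → CompleteFlag 5 W}
  {X : CompleteFlag 5 W}

theorem Sample.encard_solutions [FiniteDimensional ℂ W] {e : Basis (Fin 5) ℂ W}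
    (h : Sample e.coord E X) : (solutions 2 5 baseProblem E).encard = 3 := by
  have hLT := h.goodBase.generic.LT
  have hcoord : ∀ k l, e.coord k (e l) = if l = k then 1 else 0 := fun k l => by
    rw [Basis.coord_apply, Basis.repr_self, Finsupp.single_apply]
  -- In the three pairs the coefficients of `x` that carry `t` from the graph `T` to the graph with
  -- parameters `α`, `β`, `γ` are `1 - α`, `β - 1` and `1 - γ` respectively.
  have p₁ : IsPairOf 3 2 2 E (e 1) (e 2 - e 1) := by
    refine ⟨e.ne_zero 1, fun h0 => ?_, ?_, ?_, ⟨1, 1, by simp, ?_⟩, ⟨3, 1, by simp, ?_⟩,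
      ⟨2, 1, by simp, ?_⟩⟩
    · simpa [hcoord] using congrArg (e.coord 2) h0
    · simp [h.mem_L, hcoord]
    · simp [h.graph₂.mem_three]
    · simp [h.mem_M, hcoord]
    · simp [h.graph₃.mem_three]; norm_num
    · simp [h.graph₄.mem_three]; norm_num
  have p₂ : IsPairOf 3 2 2 E (e 0) (e 0 + e 3) := by
    refine ⟨e.ne_zero 0, fun h0 => ?_, ?_, ?_, ⟨-1, 1, by simp, ?_⟩, ⟨-2, 1, by simp, ?_⟩,
      ⟨-3, 1, by simp, ?_⟩⟩
    · simpa [hcoord] using congrArg (e.coord 3) h0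
    · simp [h.mem_L, hcoord]
    · simp [h.graph₂.mem_three]
    · simp [h.mem_M, hcoord]
    · simp [h.graph₃.mem_three]; norm_num
    · simp [h.graph₄.mem_three]; norm_num
  have p₃ : IsPairOf 3 2 2 E (e 0 + e 1) (e 4 - e 0 - e 1) := by
    refine ⟨fun h0 => ?_, fun h0 => ?_, ?_, ?_, ⟨1, 1, by simp, ?_⟩, ⟨2, 1, by simp, ?_⟩,
      ⟨-1, 1, by simp, ?_⟩⟩
    · simpa [hcoord] using congrArg (e.coord 0) h0
    · simpa [hcoord] using congrArg (e.coord 4) h0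
    · simp [h.mem_L]
    · simp [h.graph₂.mem_three]
    · simp [h.mem_M, hcoord]
    · simp [h.graph₃.mem_three]; norm_num
    · simp [h.graph₄.mem_three]; norm_num
  have hne : ∀ {x y t : W}, (∀ a d : ℂ, a • y + d • t ≠ x) → ∀ s, span ℂ {x, s} ≠ span ℂ {y, t} := by
    intro x y t h0 s hs
    have hx : x ∈ span ℂ {y, t} := hs ▸ left_mem_span_pair
    obtain ⟨a, d, had⟩ := mem_span_pair.1 hx
    exact h0 a d had
  rw [Set.encard_eq_three]
  refine ⟨span ℂ {e 1, e 2 - e 1}, span ℂ {e 0, e 0 + e 3}, span ℂ {e 0 + e 1, e 4 - e 0 - e 1},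
    hne (fun a d h0 => ?_) _, hne (fun a d h0 => ?_) _, hne (fun a d h0 => ?_) _, ?_⟩
  · simpa [hcoord] using congrArg (e.coord 1) h0
  · have h1 := congrArg (e.coord 0) h0
    have h2 := congrArg (e.coord 1) h0
    simp [hcoord] at h1 h2
    grind
  · have h1 := congrArg (e.coord 0) h0
    have h2 := congrArg (e.coord 1) h0
    simp [hcoord] at h1 h2
    grind
  ext H
  simp only [Set.mem_insert_iff, Set.mem_singleton_iff]
  constructor
  · intro hH
    obtain ⟨x, t, hp, rfl⟩ := exists_isPair_of_mem_solutions hH hLT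
    obtain ⟨x2, x3, x4, t0, t1, hc⟩ := h.pairCoords hp
    have ext : ∀ {y z : W}, (∀ k, e.coord k y = e.coord k z) → y = z := fun hyz =>
      e.ext_elem hyz
    rcases hc with ⟨h0, h1, h2, h3, h4⟩ | ⟨h0, h1, h2, h3, h4⟩ | ⟨h0, h1, h2, h3, h4⟩
    · left
      have hx : x = e.coord 1 x • e 1 := ext fun k => by
        fin_cases k <;> simp [-Basis.coord_apply, hcoord, h0, x2, x3, x4]
      have ht : t = e.coord 2 t • (e 2 - e 1) := ext fun k => by
        fin_cases k <;> simp [-Basis.coord_apply, hcoord, t0, t1, h2, h3]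
      rw [hx, ht, span_smul_pair h1 h4]
    · right; left
      have hx : x = e.coord 0 x • e 0 := ext fun k => by
        fin_cases k <;> simp [-Basis.coord_apply, hcoord, h0, x2, x3, x4]
      have ht : t = e.coord 3 t • (e 0 + e 3) := ext fun k => by
        fin_cases k <;> simp [-Basis.coord_apply, hcoord, t0, t1, h2, h3]
      rw [hx, ht, span_smul_pair h1 h4]
    · right; right
      have hx : x = e.coord 0 x • (e 0 + e 1) := ext fun k => by
        fin_cases k <;> simp [-Basis.coord_apply, hcoord, h0, x2, x3, x4]
      have ht : t = e.coord 4 t • (e 4 - e 0 - e 1) := ext fun k => by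
        fin_cases k <;> simp [-Basis.coord_apply, hcoord, t0, t1, h2, h3]
      rw [hx, ht, span_smul_pair h1 h4]
  · rintro (rfl | rfl | rfl)
    · exact IsPair.mem_solutions p₁ hLT
    · exact IsPair.mem_solutions p₂ hLT
    · exact IsPair.mem_solutions p₃ hLT

/-- The flags whose members of dimension `3` impose linear conditions. -/
def conditionIndex : Fin 3 → Fin 5 := ![1, 3, 4]

/-- A multiple of a coordinate in one of the bases. -/
def scaledCoord (e : Basis (Fin 5) ℂ W) (k : Fin 5) (v : Fin 5 → Basis (Fin 5) ℂ W) (r : Fin 3) :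
    W →ₗ[ℂ] ℂ :=
  e.det (v (conditionIndex r)) • (v (conditionIndex r)).coord k

/-- The scaling by the determinant clears the denominator in Cramer's rule. -/
theorem scaledCoord_mem (e : Basis (Fin 5) ℂ W) (k : Fin 5) (r : Fin 3) (i j : Fin 5) :
    (fun v : Fin 5 → Basis (Fin 5) ℂ W => scaledCoord e k v r (v i j)) ∈ basesAlgebra 5 e := by
  have h : (fun v : Fin 5 → Basis (Fin 5) ℂ W => scaledCoord e k v r (v i j)) =
      fun v => e.det (Function.update (v (conditionIndex r)) k (v i j)) := by
    ext v
    rw [det_update_eq, mul_comm]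
    rfl
  rw [h]
  refine Regular.det (fun l => ?_) e
  by_cases hl : l = k
  · subst hl
    simpa using regular_bases e i j
  · simpa [hl] using regular_bases e (conditionIndex r) l

theorem equations_ofBasis (e : Basis (Fin 5) ℂ W) (v : Fin 5 → Basis (Fin 5) ℂ W) :
    Equations (fun i => CompleteFlag.ofBasis (v i)) (v 0 0) (v 0 1)
      (fun j => v 2 (Fin.castLE (by omega) j)) (scaledCoord e 3 v) (scaledCoord e 4 v) := by
  have hker : ∀ r z, z ∈ (CompleteFlag.ofBasis (v (conditionIndex r))).space 3 ↔
      scaledCoord e 3 v r z = 0 ∧ scaledCoord e 4 v r z = 0 := by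
    intro r z
    have hdet : e.det (v (conditionIndex r)) ≠ 0 := (e.isUnit_det _).ne_zero
    rw [CompleteFlag.mem_ofBasis_space]
    simp [scaledCoord, hdet, Fin.forall_fin_succ]
  refine ⟨?_, ?_, fun x => ?_, ?_, fun t => ?_, hker 0, hker 1, hker 2⟩
  · rw [CompleteFlag.mem_ofBasis_space]
    intro k hk
    rw [Basis.repr_self, Finsupp.single_apply, if_neg]
    rintro rfl
    simp at hk
  · convert (v 0).linearIndependent.comp ![0, 1] (by decide) using 1
    ext i
    fin_cases i <;> rfl
  · change x ∈ span ℂ (v 0 '' {i | (i : ℕ) < 2}) ↔ _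
    have : v 0 '' {i : Fin 5 | (i : ℕ) < 2} = {v 0 0, v 0 1} := by
      rw [← Set.image_pair]
      congr 1
      ext i
      fin_cases i <;> simp
    rw [this, mem_span_pair]
  · exact (v 2).linearIndependent.comp _ (Fin.castLE_injective _)
  · change t ∈ span ℂ (v 2 '' {i | (i : ℕ) < 3}) ↔ _
    have : v 2 '' {i : Fin 5 | (i : ℕ) < 3} =
        Set.range fun j : Fin 3 => v 2 (Fin.castLE (by omega) j) := by
      rw [Set.range_comp' (v 2)]
      congr 1
      ext i
      simp
    rw [this, mem_span_range_iff_exists_fun]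

/-- Under the genericity conditions, having three solutions is the nonvanishing of the discriminant
of a cubic whose coefficients are polynomials in the entries of the bases. -/
theorem isOpen_encard_solutions [FiniteDimensional ℂ W] (e : Basis (Fin 5) ℂ W) :
    IsOpen[zariski (basesAlgebra 5 e)] {v : Fin 5 → Basis (Fin 5) ℂ W |
      (Generic 3 2 2 (fun i => CompleteFlag.ofBasis (v i)) ∧
        ∀ x t, IsPairOf 3 2 2 (fun i => CompleteFlag.ofBasis (v i)) x t →
          x ∉ (CompleteFlag.ofBasis (v 0)).space 1) ∧
      (solutions 2 5 baseProblem (fun i => CompleteFlag.ofBasis (v i))).encard = 3} := by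
  have hF : ∀ i d, RegularFamily (basesAlgebra 5 e) (fun v : Fin 5 → Basis (Fin 5) ℂ W =>
      (CompleteFlag.ofBasis (v i)).space d) := fun i d => regularFamily_ofBasis e i d
  have hmem : ∀ (i : Fin 5) (r j : Fin 3), (fun v : Fin 5 → Basis (Fin 5) ℂ W =>
      pencil (scaledCoord e 3 v) (scaledCoord e 4 v) (fun j => v 2 (Fin.castLE (by omega) j))
        (v 0 i) r j) ∈ basesAlgebra 5 e := fun i r j =>
    sub_mem (mul_mem (scaledCoord_mem e 3 r 0 i) (scaledCoord_mem e 4 r 2 _))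
      (mul_mem (scaledCoord_mem e 4 r 0 i) (scaledCoord_mem e 3 r 2 _))
  let p : Fin 5 → Matrix (Fin 3) (Fin 3) (basesAlgebra 5 e) := fun i =>
    Matrix.of fun r j => ⟨_, hmem i r j⟩
  have hp : ∀ v i, (p i).map (evalAt _ v) =
      pencil (scaledCoord e 3 v) (scaledCoord e 4 v) (fun j => v 2 (Fin.castLE (by omega) j))
        (v 0 i) := fun v i => rfl
  have hdiscr : IsOpen[zariski (basesAlgebra 5 e)] {v : Fin 5 → Basis (Fin 5) ℂ W |
      (pencilCubic (p 0) (p 1)).discr.1 v ≠ 0} :=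
    (@isOpen_compl_iff _ _ (zariski (basesAlgebra 5 e))).2 (isClosed_zeros (Subtype.property _))
  have hno : IsOpen[zariski (basesAlgebra 5 e)] {v : Fin 5 → Basis (Fin 5) ℂ W |
      ∀ x t, IsPairOf 3 2 2 (fun i => CompleteFlag.ofBasis (v i)) x t →
        x ∉ (CompleteFlag.ofBasis (v 0)).space 1} :=
    isOpen_forall_isPair (hF 0 2) (hF 1 3) (hF 2 3) (hF 3 3) (hF 4 3)
      (B := fun v x _ => x ∈ (CompleteFlag.ofBasis (v 0)).space 1)
      ((((hF 0 1).lift _).lift _).isClosed Regular.snd.lift)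
      (fun _ _ _ c _ h => smul_mem _ c h) (fun _ _ _ _ _ h => h)
  convert isOpen_and (isOpen_and (isOpen_generic hF) hno) hdiscr using 1
  ext v
  simp only [Set.mem_ofPred_eq]
  refine and_congr_right fun hv => ?_
  obtain ⟨h1, h2⟩ := (equations_ofBasis e v).encard_solutions hv.1 hv.2
  rw [h1]
  simp only [det_smul_add]
  rw [encard_zeros_eq_three_iff h2, ← hp, ← hp, ← map_pencilCubic, ← map_discr, evalAt_apply]

/-- The base problem has `3` solutions. -/
theorem hasDegree_baseProblem : HasDegree 2 5 baseProblem 3 := by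
  let e := Pi.basisFun ℂ (Fin 5)
  refine ⟨{E | (Generic 3 2 2 E ∧ ∀ x t, IsPairOf 3 2 2 E x t → x ∉ (E 0).space 1) ∧
    (solutions 2 5 baseProblem E).encard = 3},
    ⟨isZariskiOpen_of_isOpen e (isOpen_encard_solutions e), ?_⟩, fun E hE => hE.2⟩
  obtain ⟨v, w, h⟩ := exists_sample e
  exact ⟨_, ⟨h.goodBase.generic, fun x t hp => h.notMem_one hp⟩, h.encard_solutions⟩

end Degree

end Schubert

end

theorem theorem3p9 (a b : ℕ) (ha : 0 < a) (hab : a < b) (r : ℕ)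
    (ν₁ κ ρ ν₄ ν₅ : ℕ → ℕ) (τ : Fin r → ℕ → ℕ)
    (hκ : Antitone κ) (hρ : Antitone ρ) (hρa : ρ (a - 1) = 0)
    (hν : Schubert.IsSchubertProblem a b
      (Fin.append
        ![ν₁, Schubert.addRow (b - a - 1) κ, Schubert.rect 1 (a - 1) + ρ, ν₄, ν₅] τ)) :
    Schubert.IsSchubertProblem (2 + a) (5 + b)
      (Fin.append
        ![Schubert.addRow (b - a + 2) ν₁,
          Schubert.addRow (b - a) (Schubert.addRow (b - a) κ),
          Schubert.rect 2 a + ρ,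
          Schubert.rect 1 (a + 1) + ν₄,
          Schubert.rect 1 (a + 1) + ν₅] τ) ∧
    Schubert.IsFibered 2 5 a b
      (Fin.append
        ![Schubert.addRow (b - a + 2) ν₁,
          Schubert.addRow (b - a) (Schubert.addRow (b - a) κ),
          Schubert.rect 2 a + ρ,
          Schubert.rect 1 (a + 1) + ν₄,
          Schubert.rect 1 (a + 1) + ν₅] τ)
      ![Schubert.rect 2 1, Schubert.rect 1 1, Schubert.rect 1 1, Schubert.rect 1 1,
        Schubert.rect 1 1]
      (Fin.append
        ![ν₁, Schubert.addRow (b - a - 1) κ, Schubert.rect 1 (a - 1) + ρ, ν₄, ν₅] τ) ∧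
    Schubert.HasDegree 2 5
      ![Schubert.rect 2 1, Schubert.rect 1 1, Schubert.rect 1 1, Schubert.rect 1 1,
        Schubert.rect 1 1] 3 := by
  exact ⟨Schubert.isSchubertProblem_totalProblem ha hab hκ hρ hρa hν,
    Schubert.isFibered ha hab hκ hρ hρa hν, Schubert.hasDegree_baseProblem⟩
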